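/- Let $X\in\mathbb{Q}^{n\times p}$ have rows $x_1^{\mathrm T},\dots,x_n^{\mathrm T}$ and let $y\in\mathbb{Q}^n$, where no two rows of the matrix $(X,y)$ are identical. For $\beta\in\mathbb{R}^p$ let $r_i^\beta = y_i-x_i^{\mathrm T}\beta$, and for a permutation $\pi$ of $\{1,\dots,n\}$ let $C^\pi=\{\beta : r^\beta_{\pi(1)}\le\dots\le r^\beta_{\pi(n)}\}$; $C^\pi$ is called a cell if its interior is nonempty. The class $\mathsf{GEN}$ consists of the functions $F(\beta)=\sum_{i=1}^n a_i^\beta\, r_i^\beta$ on $\mathbb{R}^p$, with real coefficients $a_i^\beta$, such that (i) if $r^{\beta}_{\pi(1)}<\dots<r^{\beta}_{\pi(n)}$ and $r^{\beta'}_{\pi(1)}<\dots<r^{\beta'}_{\pi(n)}$ for the same permutation $\pi$, then $a_i^{\beta}=a_i^{\beta'}$ for all $i$ (so the coefficients are constant on the interior of every cell); (ii) $F$ is lower semicontinuous, and the value of $F$ at every point is inherited from a cell that contains the point: for every $\beta$ there are a cell $C^\pi\ni\beta$ and a point $\widetilde\beta$ in the interior of $C^\pi$ with $F(\beta)=\sum_i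 a_i^{\widetilde\beta}\,r_i^\beta$. The algorithm receives $(X,y)$ as input and has access to an oracle that, queried with a permutation $\pi$ for which $C^\pi$ is a cell, returns the coefficients $(a_1^\beta,\dots,a_n^\beta)$ for $\beta$ in the interior of $C^\pi$. These coefficients are rational; the time the oracle needs to compute them is disregarded, while writing the query and reading the answer are charged to the algorithm. Let $L$ be the bit size of $(X,y)$, that is, the sum over all entries of the binary lengths of numerator and denominator, plus one bit per entry for the sign. **Theorem.** If $p=O(1)$, a function $F\in\mathsf{GEN}$ can be minimized in polynomial time. More precisely: for every $p_0$ there is an algorithm (a program of an oracle random access machine with logarithmic cost) such that for every polynomial $q$ there is a polynomial $T$ with the following property. For all $n$, all $p\le p_0$, all $(X,y)$ and $F\in\mathsf{GEN}$ as above for which the coefficient vector of each cell has bit size at most $q(L)$, the algorithm halts within time $T(L)$. If $F$ is unbounded from below, it reports this; otherwise it outputs a rational minimizer $\beta_0$ of $F$ on $\mathbb{R}^p$ and the minimum $F(\beta_0)$. -/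

import Mathlib

/-! ## Oracle random access machines with logarithmic cost

Programs work on integers.  The storage consists of integer registers and of integer banks
(unbounded arrays with indirect addressing).  Every operation is charged the bit lengths of its
operands, and an oracle call the bit lengths of the whole query and of the whole answer. -/

namespace OracleRAM

/-- Storage: registers, and banks addressed by integers. -/
structure Mem where
  reg : ℕ → ℤ
  bank : ℕ → ℤ → ℤ

/-- Binary length of an integer, with one bit for the sign. -/
def bitLen (z : ℤ) : ℕ := z.natAbs.size + 1

/-- Binary length of a word of integers. -/
def wordLen (w : List ℤ) : ℕ := (w.map bitLen).sum

/-- Arithmetic expressions; `get k e` is the content of bank `k` at the address `e`. -/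
inductive Arith where
  | lit (c : ℤ)
  | reg (r : ℕ)
  | get (k : ℕ) (e : Arith)
  | add (e f : Arith)
  | sub (e f : Arith)
  | mul (e f : Arith)
  | div (e f : Arith)

/-- The value of an expression (`div` is integer division). -/
def Arith.val (m : Mem) : Arith → ℤ
  | .lit c => c
  | .reg r => m.reg r
  | .get k e => m.bank k (e.val m)
  | .add e f => e.val m + f.val m
  | .sub e f => e.val m - f.val m
  | .mul e f => e.val m * f.val m
  | .div e f => e.val m / f.val m

/-- The cost of evaluating an expression. -/
def Arith.cost (m : Mem) : Arith → ℕ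
  | .lit c => bitLen c
  | .reg r => bitLen (m.reg r)
  | .get k e => e.cost m + bitLen (e.val m) + bitLen (m.bank k (e.val m))
  | .add e f => e.cost m + f.cost m + bitLen (e.val m) + bitLen (f.val m)
  | .sub e f => e.cost m + f.cost m + bitLen (e.val m) + bitLen (f.val m)
  | .mul e f => e.cost m + f.cost m + bitLen (e.val m) + bitLen (f.val m)
  | .div e f => e.cost m + f.cost m + bitLen (e.val m) + bitLen (f.val m)

/-- Programs. -/
inductive Cmd where
  | skip
  /-- write the value of `e` into register `r` -/
  | assign (r : ℕ) (e : Arith)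
  /-- write the value of `e` into bank `k` at the address `i` -/
  | store (k : ℕ) (i e : Arith)
  | seq (c d : Cmd)
  /-- execute `c` if `e` is positive, and `d` otherwise -/
  | ifPos (e : Arith) (c d : Cmd)
  /-- execute `c` as long as `e` is positive -/
  | whilePos (e : Arith) (c : Cmd)
  /-- ask the oracle for its answer to the word in the first `len` cells of bank `k`, and write
  the answer into bank `l`, from address `0` on -/
  | query (k : ℕ) (len : Arith) (l : ℕ)

/-- The word in the cells `0, …, len - 1` of a bank. -/
def readWord (f : ℤ → ℤ) (len : ℕ) : List ℤ :=
  (List.range len).map fun i => f (i : ℤ)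

/-- A bank after a word was written into it, from address `0` on. -/
def writeWord (f : ℤ → ℤ) (w : List ℤ) : ℤ → ℤ := fun i =>
  if 0 ≤ i ∧ i < (w.length : ℤ) then w.getD i.toNat 0 else f i

def Mem.setReg (m : Mem) (r : ℕ) (z : ℤ) : Mem :=
  { m with reg := Function.update m.reg r z }

def Mem.setBank (m : Mem) (k : ℕ) (f : ℤ → ℤ) : Mem :=
  { m with bank := Function.update m.bank k f }

/-- `Exec O c m m' t`: started in `m` with oracle `O`, the program `c` halts in `m'`, after
time `t`. -/
inductive Exec (O : List ℤ → List ℤ) : Cmd → Mem → Mem → ℕ → Prop where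
  | skip (m : Mem) : Exec O .skip m m 1
  | assign (r : ℕ) (e : Arith) (m : Mem) :
      Exec O (.assign r e) m (m.setReg r (e.val m)) (e.cost m + 1)
  | store (k : ℕ) (i e : Arith) (m : Mem) :
      Exec O (.store k i e) m
        (m.setBank k (Function.update (m.bank k) (i.val m) (e.val m)))
        (i.cost m + e.cost m + 1)
  | seq {c d : Cmd} {m m' m'' : Mem} {t t' : ℕ} :
      Exec O c m m' t → Exec O d m' m'' t' → Exec O (.seq c d) m m'' (t + t')
  | ifPos_true {e : Arith} {c d : Cmd} {m m' : Mem} {t : ℕ} :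
      0 < e.val m → Exec O c m m' t → Exec O (.ifPos e c d) m m' (e.cost m + 1 + t)
  | ifPos_false {e : Arith} {c d : Cmd} {m m' : Mem} {t : ℕ} :
      ¬ 0 < e.val m → Exec O d m m' t → Exec O (.ifPos e c d) m m' (e.cost m + 1 + t)
  | while_true {e : Arith} {c : Cmd} {m m' m'' : Mem} {t t' : ℕ} :
      0 < e.val m → Exec O c m m' t → Exec O (.whilePos e c) m' m'' t' →
      Exec O (.whilePos e c) m m'' (e.cost m + 1 + t + t')
  | while_false {e : Arith} {c : Cmd} {m : Mem} :
      ¬ 0 < e.val m → Exec O (.whilePos e c) m m (e.cost m + 1)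
  | query (k : ℕ) (len : Arith) (l : ℕ) (m : Mem) :
      Exec O (.query k len l) m
        (m.setBank l (writeWord (m.bank l) (O (readWord (m.bank k) (len.val m).toNat))))
        (len.cost m + 1 + wordLen (readWord (m.bank k) (len.val m).toNat) +
          wordLen (O (readWord (m.bank k) (len.val m).toNat)))

/-- The initial storage: the input word in bank `0`, and zeros everywhere else. -/
def Mem.init (w : List ℤ) : Mem where
  reg := fun _ => 0
  bank := fun k => if k = 0 then writeWord (fun _ => 0) w else fun _ => 0

/-- The output word: it stands in bank `1`, and its length in register `0`. -/
def Mem.output (m : Mem) : List ℤ := readWord (m.bank 1) (m.reg 0).toNat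

/-- With oracle `O`, the program `c` halts on the input `w` after time `t`, with output `v`. -/
def Runs (O : List ℤ → List ℤ) (c : Cmd) (w v : List ℤ) (t : ℕ) : Prop :=
  ∃ m : Mem, Exec O c (Mem.init w) m t ∧ m.output = v

end OracleRAM

/-! ## Functions of ranks of residuals -/

namespace RankRegression

/-- The residual `r_i^β = y_i - x_iᵀ β`. -/
def residual {n p : ℕ} (X : Matrix (Fin n) (Fin p) ℚ) (y : Fin n → ℚ) (β : Fin p → ℝ)
    (i : Fin n) : ℝ :=
  (y i : ℝ) - ∑ j, (X i j : ℝ) * β j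

/-- The polyhedron `C^π = {β | r_{π(1)}^β ≤ ⋯ ≤ r_{π(n)}^β}`; it is a cell if it is
full-dimensional, that is, if its interior is nonempty. -/
def region {n p : ℕ} (X : Matrix (Fin n) (Fin p) ℚ) (y : Fin n → ℚ)
    (π : Equiv.Perm (Fin n)) : Set (Fin p → ℝ) :=
  {β | Monotone fun k => residual X y β (π k)}

/-- `r_{π(1)}^β < ⋯ < r_{π(n)}^β`. -/
def StrictlyOrders {n p : ℕ} (X : Matrix (Fin n) (Fin p) ℚ) (y : Fin n → ℚ)
    (π : Equiv.Perm (Fin n)) (β : Fin p → ℝ) : Prop :=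
  StrictMono fun k => residual X y β (π k)

/-- `F(β) = ∑ a_i^β (y_i - x_iᵀ β)`. -/
def objective {n p : ℕ} (X : Matrix (Fin n) (Fin p) ℚ) (y : Fin n → ℚ)
    (a : (Fin p → ℝ) → Fin n → ℝ) (β : Fin p → ℝ) : ℝ :=
  ∑ i, a β i * residual X y β i

/-- The function with coefficients `a` belongs to the class GEN. -/
structure IsGEN {n p : ℕ} (X : Matrix (Fin n) (Fin p) ℚ) (y : Fin n → ℚ)
    (a : (Fin p → ℝ) → Fin n → ℝ) : Prop where
  /-- no two rows of `(X, y)` are identical -/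
  rows_distinct : ∀ i j, X i = X j → y i = y j → i = j
  /-- the coefficients depend only on the ordering of the residuals -/
  rank_dependent : ∀ (π : Equiv.Perm (Fin n)) (β β' : Fin p → ℝ),
    StrictlyOrders X y π β → StrictlyOrders X y π β' → a β = a β'
  /-- lower semicontinuity -/
  lsc : LowerSemicontinuous (objective X y a)
  /-- everywhere, thus also on the common boundaries of cells, the value of the function is
  inherited from a cell that contains the point -/
  inherits : ∀ β, ∃ π : Equiv.Perm (Fin n), β ∈ region X y π ∧
    ∃ β' ∈ interior (region X y π), objective X y a β = ∑ i, a β' i * residual X y β i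

/-- Bit size of a rational number: numerator, denominator and sign. -/
def ratBits (r : ℚ) : ℕ := r.num.natAbs.size + r.den.size + 1

/-- Bit size of a rational vector. -/
def vecBits {k : ℕ} (v : Fin k → ℚ) : ℕ := ∑ i, ratBits (v i)

/-- Bit size of the data `(X, y)`. -/
def dataBits {n p : ℕ} (X : Matrix (Fin n) (Fin p) ℚ) (y : Fin n → ℚ) : ℕ :=
  (∑ i, vecBits (X i)) + vecBits y

/-- The word `u_1, d_1, u_2, d_2, …` -/
def fractionWord {k : ℕ} (u d : Fin k → ℤ) : List ℤ :=
  (List.ofFn fun i => [u i, d i]).flatten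

/-- A rational vector, as the word of its numerators and denominators in lowest terms. -/
def ratWord {k : ℕ} (v : Fin k → ℚ) : List ℤ :=
  fractionWord (fun i => (v i).num) (fun i => ((v i).den : ℤ))

/-- The data `(X, y)`, as the word `n, p`, rows of `X`, `y`. -/
def inputWord {n p : ℕ} (X : Matrix (Fin n) (Fin p) ℚ) (y : Fin n → ℚ) : List ℤ :=
  (n : ℤ) :: (p : ℤ) :: ((List.ofFn fun i => ratWord (X i)).flatten ++ ratWord y)

/-- A permutation, as the word of its values (in `0, …, n - 1`). -/
def permWord {n : ℕ} (π : Equiv.Perm (Fin n)) : List ℤ :=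
  List.ofFn fun k => ((π k : ℕ) : ℤ)

/-- The oracle `O` answers every query `π` that belongs to a cell with the coefficients on this
cell, which are rational and of bit size at most `B`. Its answers to other queries are
arbitrary. -/
def IsCoefficientOracle {n p : ℕ} (X : Matrix (Fin n) (Fin p) ℚ) (y : Fin n → ℚ)
    (a : (Fin p → ℝ) → Fin n → ℝ) (O : List ℤ → List ℤ) (B : ℕ) : Prop :=
  ∀ (π : Equiv.Perm (Fin n)) (β : Fin p → ℝ), StrictlyOrders X y π β →
    ∃ c : Fin n → ℚ, (∀ i, a β i = (c i : ℝ)) ∧ O (permWord π) = ratWord c ∧ vecBits c ≤ B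

/-- The word `w` is a correct answer to the problem of minimizing `F`: it is `0` and `F` is
unbounded from below, or it is `1` followed by (not necessarily reduced) fractions for the
coordinates of a minimizer and for the minimum of `F`. -/
def SolvesMin {p : ℕ} (F : (Fin p → ℝ) → ℝ) (w : List ℤ) : Prop :=
  (w = [0] ∧ ¬ BddBelow (Set.range F)) ∨
  ∃ (u d : Fin p → ℤ) (s e : ℤ), w = 1 :: (fractionWord u d ++ [s, e]) ∧
    (∀ j, 0 < d j) ∧ 0 < e ∧
    F (fun j => (u j : ℝ) / (d j : ℝ)) = (s : ℝ) / (e : ℝ) ∧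
    ∀ β, F (fun j => (u j : ℝ) / (d j : ℝ)) ≤ F β

end RankRegression

/-!
# Minimizing functions of ranks of residuals in polynomial time

**Reduction to candidates.** Let `D` be a common denominator of the data, and lift `β` to the
homogeneous vector `(1, β)` in dimension `p + 1`. The scaled residuals become the linear forms
`U_i = D • (y_i, -x_i)`, a cell becomes a cone that is cut out by differences of these forms, and on
this cone the function is given by a single linear form. To make all cones pointed, the coordinate
forms are added, so the forms considered are the differences of the rows of the table `U_i`, `0`,
`e_k` (`IsRowTable`). An *elementary vector* is a vector on a line on which `p` independent forms
vanish; Cramer's rule gives one as `det M • adj M e₀` (`elementary`), where the last `p` rows of `M`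
are the `p` forms. Every vector is a nonnegative combination of at most `p + 1` elementary vectors
at which no form has a sign opposite to its sign at the given vector
(`exists_conformal_decomposition`): one walks from the vector against an elementary vector of its
face until a further form vanishes, which decreases the dimension of the face.

Hence the sum of the elementary vectors for an interior point of a cell is again an interior point,
so all cells are found by trying sums of `p + 1` elementary vectors. The linear form of a cell is
controlled by its values at elementary vectors in the closed cone: if it is negative at one at
infinity, then the function is unbounded (`Admissible.not_bddBelow`). Otherwise the
least of the values at the finite ones bounds the function from below
(`le_objective_of_forall_admissible`), and by lower semicontinuity the function is at each of these
points at most the value of the form (`Admissible.objective_le`), so this least value is the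
minimum. A pair of a sample point and an elementary vector is given by `2 (p + 2) (p + 1)` row
indices, thus by a number `τ < (n + p + 2) ^ (2 (p + 2) (p + 1))`, and for fixed `p` there are
polynomially many.

**The program.** For fixed `p`, determinants of size `p + 1` are expressions of constant size
(`Arith.det`), so the program is a single loop over `τ`. It sorts the residuals at the sample point
by counting ranks, which yields the query, and it asks only for permutations that belong to cells.
Its correctness is shown in a calculus of weakest preconditions (`WP`) that also carries a bound `b`
for the bit lengths of all cells and for the number of iterations of all loops. The running time is
then bounded by a polynomial in `b` that depends on the program text only (`Cmd.cap`), and the bit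
lengths are polynomial because sums of fractions are the only quantities that grow along a loop,
by a bounded number of bits per term (`wp_evalCmd`).
-/

/-! ### Conformal decomposition into elementary vectors -/

namespace RankRegression

open Matrix

/-- The vector `det M • (adj M) e₀`. It spans the line on which all rows of `M` but the first one
vanish (if `M` is regular), and the first row takes the value `(det M)² ≥ 0` on it: the factor
`det M` fixes the orientation. -/
def elementary {R : Type*} [CommRing R] {p : ℕ} (M : Matrix (Fin (p + 1)) (Fin (p + 1)) R) :
    Fin (p + 1) → R :=
  fun k => M.det * (M.updateRow 0 (Pi.single k 1)).det

theorem mulVec_elementary {R : Type*} [CommRing R] {p : ℕ}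
    (M : Matrix (Fin (p + 1)) (Fin (p + 1)) R) :
    M *ᵥ elementary M = Pi.single 0 (M.det ^ 2) := by
  have h : elementary M = M.det • (M.adjugate *ᵥ Pi.single 0 1) := by
    ext k
    simp [elementary, Matrix.adjugate_apply]
  rw [h, mulVec_smul, mulVec_mulVec, mul_adjugate, smul_mulVec, one_mulVec]
  ext i
  by_cases hi : i = 0
  · subst hi; simp [sq]
  · simp [hi]

theorem elementary_zero {R : Type*} [CommRing R] {p : ℕ} :
    elementary (0 : Matrix (Fin (p + 1)) (Fin (p + 1)) R) = 0 := by
  ext k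
  simp [elementary]

theorem elementary_intCast {p : ℕ} (M : Matrix (Fin (p + 1)) (Fin (p + 1)) ℤ) (k : Fin (p + 1)) :
    ((elementary M k : ℤ) : ℝ) = elementary (M.map fun x => (x : ℝ)) k := by
  simp only [elementary, Int.cast_mul, Int.cast_det]
  congr 2
  ext i j
  by_cases hi : i = 0
  · subst hi
    by_cases hj : j = k
    · subst hj; simp
    · simp [hj]
  · simp [Matrix.updateRow_ne hi]

/-- The common zeros of those forms of the family that vanish at `s`. -/
def commonZeros {ι : Type*} {q : ℕ} (g : ι → Fin q → ℝ) (s : Fin q → ℝ) :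
    Submodule ℝ (Fin q → ℝ) where
  carrier := {x | ∀ f, g f ⬝ᵥ s = 0 → g f ⬝ᵥ x = 0}
  add_mem' := fun ha hb f hf => by rw [dotProduct_add, ha f hf, hb f hf, add_zero]
  zero_mem' := fun f _ => dotProduct_zero _
  smul_mem' := fun c x hx f hf => by rw [dotProduct_smul, hx f hf, smul_zero]

/-- `z` conforms to `s`: every form that is nonnegative at `s` is nonnegative at `z`. -/
def Conforms {ι : Type*} {q : ℕ} (g : ι → Fin q → ℝ) (z s : Fin q → ℝ) : Prop :=
  ∀ f, 0 ≤ g f ⬝ᵥ s → 0 ≤ g f ⬝ᵥ z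

theorem Conforms.trans {ι : Type*} {q : ℕ} {g : ι → Fin q → ℝ} {x y z : Fin q → ℝ}
    (h : Conforms g x y) (h' : Conforms g y z) : Conforms g x z :=
  fun f hf => h f (h' f hf)

section

variable {ι : Type*} [Finite ι] {p : ℕ} {g : ι → Fin (p + 1) → ℝ}
  (hneg : ∀ f, ∃ f', g f' = -g f) (hsep : ∀ x, (∀ f, g f ⬝ᵥ x = 0) → x = 0)

include hneg

omit [Finite ι] in
theorem Conforms.eq_zero {z s : Fin (p + 1) → ℝ} (h : Conforms g z s) (f : ι)
    (hf : g f ⬝ᵥ s = 0) : g f ⬝ᵥ z = 0 := by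
  obtain ⟨f', hf'⟩ := hneg f
  have h1 := h f hf.ge
  have h2 := h f' (by rw [hf', neg_dotProduct, hf, neg_zero])
  rw [hf', neg_dotProduct] at h2
  linarith

omit [Finite ι] in
theorem Conforms.pos {z s : Fin (p + 1) → ℝ} (h : Conforms g z s) (f : ι)
    (hf : 0 < g f ⬝ᵥ z) : 0 < g f ⬝ᵥ s := by
  obtain ⟨f', hf'⟩ := hneg f
  by_contra hs
  have h2 := h f' (by rw [hf', neg_dotProduct]; linarith)
  rw [hf', neg_dotProduct] at h2
  linarith

omit [Finite ι] in
theorem Conforms.commonZeros_le {z s : Fin (p + 1) → ℝ} (h : Conforms g z s) :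
    commonZeros g z ≤ commonZeros g s :=
  fun _ hx f hf => hx f (h.eq_zero hneg f hf)

/-- Walking from `s` against a direction `w` of the face of `s` until a form vanishes gives a point
that still conforms to `s`, but on a smaller face. -/
theorem exists_conforms_sub {s w : Fin (p + 1) → ℝ} (hw : w ∈ commonZeros g s)
    (hpos : ∃ f, 0 < g f ⬝ᵥ w ∧ 0 < g f ⬝ᵥ s) :
    ∃ t : ℝ, 0 < t ∧ Conforms g (s - t • w) s ∧
      commonZeros g (s - t • w) < commonZeros g s := by
  obtain ⟨f₀, ⟨hf₀w, hf₀s⟩, hmin⟩ := Set.exists_min_image {f | 0 < g f ⬝ᵥ w ∧ 0 < g f ⬝ᵥ s}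
    (fun f => (g f ⬝ᵥ s) / (g f ⬝ᵥ w)) (Set.toFinite _) hpos
  have hval : ∀ f, g f ⬝ᵥ (s - ((g f₀ ⬝ᵥ s) / (g f₀ ⬝ᵥ w)) • w) =
      g f ⬝ᵥ s - (g f₀ ⬝ᵥ s) / (g f₀ ⬝ᵥ w) * (g f ⬝ᵥ w) := fun f => by
    rw [dotProduct_sub, dotProduct_smul, smul_eq_mul]
  have ht : 0 < (g f₀ ⬝ᵥ s) / (g f₀ ⬝ᵥ w) := div_pos hf₀s hf₀w
  have hc : Conforms g (s - ((g f₀ ⬝ᵥ s) / (g f₀ ⬝ᵥ w)) • w) s := by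
    intro f hf
    rw [hval]
    rcases hf.eq_or_lt with hf0 | hfpos
    · rw [hw f hf0.symm, ← hf0, mul_zero, sub_zero]
    · rcases le_or_gt (g f ⬝ᵥ w) 0 with hfw | hfw
      · nlinarith
      · have := hmin f ⟨hfw, hfpos⟩
        rw [le_div_iff₀ hfw] at this
        linarith
  refine ⟨_, ht, hc, lt_of_le_of_ne (hc.commonZeros_le hneg) fun heq => ?_⟩
  have hs : s ∈ commonZeros g s := fun f hf => hf
  rw [← heq] at hs
  have := hs f₀ (by rw [hval, div_mul_cancel₀ _ hf₀w.ne', sub_self])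
  linarith

include hsep

omit [Finite ι] in
/-- If the common zeros of the forms that vanish at `s` form a line, then `s` is a positive multiple
of an elementary vector. -/
theorem exists_elementary_of_line {s : Fin (p + 1) → ℝ} (hs : s ≠ 0)
    (hline : ∀ x ∈ commonZeros g s, ∃ c : ℝ, x = c • s) :
    ∃ c : Fin (p + 1) → ι, elementary (Matrix.of fun i => g (c i)) ≠ 0 ∧
      ∃ t : ℝ, 0 < t ∧ elementary (Matrix.of fun i => g (c i)) = t • s := by
  classical
  obtain ⟨f₀, hf₀⟩ : ∃ f, 0 < g f ⬝ᵥ s := by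
    by_contra! h
    refine hs (hsep s fun f => le_antisymm (h f) ?_)
    obtain ⟨f', hf'⟩ := hneg f
    have := h f'
    rw [hf', neg_dotProduct] at this
    linarith
  obtain ⟨d, v, hvmem, hvspan, hvind⟩ : ∃ (d : ℕ) (v : Fin d → Fin (p + 1) → ℝ),
      (∀ i, v i ∈ g '' {f | g f ⬝ᵥ s = 0}) ∧
      Submodule.span ℝ (Set.range v) = Submodule.span ℝ (g '' {f | g f ⬝ᵥ s = 0}) ∧
      LinearIndependent ℝ v :=
    ⟨_, Submodule.exists_fun_fin_finrank_span_eq ℝ (g '' {f | g f ⬝ᵥ s = 0})⟩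
  have hker : ∀ x, (∀ i, v i ⬝ᵥ x = 0) → x ∈ commonZeros g s := by
    intro x hx f hf
    have hmem : g f ∈ Submodule.span ℝ (Set.range v) := by
      rw [hvspan]; exact Submodule.subset_span ⟨f, hf, rfl⟩
    refine Submodule.span_induction (p := fun y _ => y ⬝ᵥ x = 0) ?_ (zero_dotProduct _)
      (fun a b _ _ ha hb => by rw [add_dotProduct, ha, hb, add_zero])
      (fun c a _ ha => by rw [smul_dotProduct, ha, smul_zero]) hmem
    rintro _ ⟨i, rfl⟩
    exact hx i
  have hvs : ∀ i, v i ⬝ᵥ s = 0 := fun i => by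
    obtain ⟨f, hf, hfe⟩ := hvmem i
    rw [← hfe]; exact hf
  -- rank and nullity: the span of the vanishing forms has dimension `p`
  have hdp : d = p := by
    have h1 := LinearMap.finrank_range_add_finrank_ker (Matrix.of v).mulVecLin
    have h2 : (Matrix.of v).rank = d := by
      have : LinearIndependent ℝ (Matrix.of v).row := hvind
      simpa using this.rank_matrix
    have h3 : LinearMap.ker (Matrix.of v).mulVecLin = Submodule.span ℝ {s} := by
      ext x
      rw [LinearMap.mem_ker, mulVecLin_apply, Submodule.mem_span_singleton]
      constructor
      · intro hx
        obtain ⟨c, hc⟩ := hline x (hker x fun i => congrFun hx i)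
        exact ⟨c, hc.symm⟩
      · rintro ⟨c, rfl⟩
        ext i
        change v i ⬝ᵥ (c • s) = 0
        rw [dotProduct_smul, hvs, smul_zero]
    rw [Matrix.rank] at h2
    rw [h2, h3, finrank_span_singleton hs] at h1
    simpa using h1
  subst hdp
  choose e he hev using hvmem
  refine ⟨Fin.cons f₀ e, ?_⟩
  set M : Matrix (Fin (d + 1)) (Fin (d + 1)) ℝ :=
    Matrix.of fun i => g ((Fin.cons f₀ e : Fin (d + 1) → ι) i) with hM
  have hM0 : ∀ x, (M *ᵥ x) 0 = g f₀ ⬝ᵥ x := fun x => rfl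
  have hMs : ∀ x i, (M *ᵥ x) (Fin.succ i) = v i ⬝ᵥ x := fun x i => by
    rw [← hev i]; rfl
  have hinj : ∀ x, M *ᵥ x = 0 → x = 0 := by
    intro x hx
    obtain ⟨c, rfl⟩ := hline x (hker x fun i => by rw [← hMs, hx]; rfl)
    have h0 := hM0 (c • s)
    rw [hx, dotProduct_smul, smul_eq_mul] at h0
    rcases mul_eq_zero.mp h0.symm with h | h
    · rw [h, zero_smul]
    · exact absurd h hf₀.ne'
  have hdet : M.det ≠ 0 := by
    intro h
    obtain ⟨x, hx0, hx⟩ := Matrix.exists_mulVec_eq_zero_iff.mpr h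
    exact hx0 (hinj x hx)
  have hmul := mulVec_elementary M
  have hpos : 0 < M.det ^ 2 / (g f₀ ⬝ᵥ s) := div_pos (by positivity) hf₀
  have hE : elementary M = (M.det ^ 2 / (g f₀ ⬝ᵥ s)) • s := by
    refine sub_eq_zero.mp (hinj _ ?_)
    rw [mulVec_sub, hmul, mulVec_smul]
    ext i
    refine Fin.cases ?_ (fun i => ?_) i
    · simp [hM0, div_mul_cancel₀ _ hf₀.ne']
    · simp [hMs, hvs]
  refine ⟨?_, _, hpos, hE⟩
  rw [hE]
  exact smul_ne_zero hpos.ne' hs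

theorem exists_conforms_elementary {s : Fin (p + 1) → ℝ} (hs : s ≠ 0) :
    ∃ c : Fin (p + 1) → ι, elementary (Matrix.of fun i => g (c i)) ≠ 0 ∧
      Conforms g (elementary (Matrix.of fun i => g (c i))) s := by
  induction hk : Module.finrank ℝ (commonZeros g s)
    using Nat.strong_induction_on generalizing s with
  | _ k ih =>
  by_cases hline : ∀ x ∈ commonZeros g s, ∃ c : ℝ, x = c • s
  · obtain ⟨c, hc0, t, ht, hc⟩ := exists_elementary_of_line hneg hsep hs hline
    refine ⟨c, hc0, fun f hf => ?_⟩
    rw [hc, dotProduct_smul]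
    exact mul_nonneg ht.le hf
  · push Not at hline
    obtain ⟨w, hw, hws⟩ := hline
    have hw0 : w ≠ 0 := fun h => hws 0 (by rw [h, zero_smul])
    -- some form is nonzero at `w`; up to the signs of the form and of `w` it is positive at both
    obtain ⟨w', hw', hws', hpos⟩ : ∃ w' ∈ commonZeros g s, (∀ c : ℝ, w' ≠ c • s) ∧
        ∃ f, 0 < g f ⬝ᵥ w' ∧ 0 < g f ⬝ᵥ s := by
      obtain ⟨f, hf⟩ : ∃ f, g f ⬝ᵥ w ≠ 0 := by
        by_contra! h
        exact hw0 (hsep w h)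
      have hfs : g f ⬝ᵥ s ≠ 0 := fun h => hf (hw f h)
      obtain ⟨f', hf's, hf'w⟩ : ∃ f', 0 < g f' ⬝ᵥ s ∧ g f' ⬝ᵥ w ≠ 0 := by
        rcases hfs.lt_or_gt with h | h
        · obtain ⟨f', hf'⟩ := hneg f
          refine ⟨f', ?_, ?_⟩ <;> rw [hf', neg_dotProduct]
          · linarith
          · exact neg_ne_zero.mpr hf
        · exact ⟨f, h, hf⟩
      rcases hf'w.lt_or_gt with h | h
      · refine ⟨-w, neg_mem hw, fun c hc => hws (-c) ?_, f', ?_, hf's⟩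
        · rw [neg_smul, ← hc, neg_neg]
        · rw [dotProduct_neg]; linarith
      · exact ⟨w, hw, hws, f', h, hf's⟩
    obtain ⟨t, ht, hc, hlt⟩ := exists_conforms_sub hneg hw' hpos
    have hne : s - t • w' ≠ 0 := by
      intro h
      refine hws' t⁻¹ ?_
      rw [sub_eq_zero.mp h, smul_smul, inv_mul_cancel₀ ht.ne', one_smul]
    obtain ⟨c, hc0, hcc⟩ := ih _ (hk ▸ Submodule.finrank_lt_finrank_of_lt hlt) hne rfl
    exact ⟨c, hc0, hcc.trans hc⟩

theorem exists_conformal_sum (hzero : ∃ f, g f = 0) (k : ℕ) {s : Fin (p + 1) → ℝ}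
    (hk : Module.finrank ℝ (commonZeros g s) ≤ k) :
    ∃ (c : Fin k → Fin (p + 1) → ι) (t : Fin k → ℝ), (∀ j, 0 ≤ t j) ∧
      s = ∑ j, t j • elementary (Matrix.of fun i => g (c j i)) ∧
      ∀ j, Conforms g (elementary (Matrix.of fun i => g (c j i))) s := by
  induction k generalizing s with
  | zero =>
    have h0 : commonZeros g s = ⊥ := Submodule.finrank_eq_zero.mp (Nat.le_zero.mp hk)
    have hs : s ∈ commonZeros g s := fun f hf => hf
    rw [h0, Submodule.mem_bot] at hs
    exact ⟨Fin.elim0, Fin.elim0, fun j => j.elim0, by simp [hs], fun j => j.elim0⟩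
  | succ k ih =>
    by_cases hs : s = 0
    · obtain ⟨f, hf⟩ := hzero
      have h0 : elementary (Matrix.of fun _ : Fin (p + 1) => g f) = 0 := by
        rw [hf]; exact elementary_zero
      refine ⟨fun _ _ => f, fun _ => 0, fun _ => le_rfl, by simp [hs], fun j f' _ => ?_⟩
      rw [h0, dotProduct_zero]
    · obtain ⟨c₀, hc0, hcc⟩ := exists_conforms_elementary hneg hsep hs
      set z := elementary (Matrix.of fun i => g (c₀ i)) with hz
      have hmem : z ∈ commonZeros g s := fun f hf => hcc.eq_zero hneg f hf
      have hpos : ∃ f, 0 < g f ⬝ᵥ z ∧ 0 < g f ⬝ᵥ s := by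
        obtain ⟨f, hf⟩ : ∃ f, 0 < g f ⬝ᵥ z := by
          by_contra! h
          refine hc0 (hsep z fun f => le_antisymm (h f) ?_)
          obtain ⟨f', hf'⟩ := hneg f
          have := h f'
          rw [hf', neg_dotProduct] at this
          linarith
        exact ⟨f, hf, hcc.pos hneg f hf⟩
      obtain ⟨t₀, ht₀, hc, hlt⟩ := exists_conforms_sub hneg hmem hpos
      have hlt' := Submodule.finrank_lt_finrank_of_lt hlt
      obtain ⟨c, t, ht, hsum, hconf⟩ := ih (s := s - t₀ • z) (by omega)
      refine ⟨Fin.cons c₀ c, Fin.cons t₀ t, ?_, ?_, ?_⟩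
      · exact Fin.cases ht₀.le ht
      · rw [Fin.sum_univ_succ]
        simp only [Fin.cons_zero, Fin.cons_succ]
        rw [← hsum, ← hz]
        abel
      · exact Fin.cases hcc fun j => (hconf j).trans hc

/-- Every vector is a nonnegative combination of as many elementary vectors as the space has
dimensions, each of which conforms to it. -/
theorem exists_conformal_decomposition (hzero : ∃ f, g f = 0) (s : Fin (p + 1) → ℝ) :
    ∃ (c : Fin (p + 1) → Fin (p + 1) → ι) (t : Fin (p + 1) → ℝ), (∀ j, 0 ≤ t j) ∧
      s = ∑ j, t j • elementary (Matrix.of fun i => g (c j i)) ∧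
      ∀ j, Conforms g (elementary (Matrix.of fun i => g (c j i))) s :=
  exists_conformal_sum hneg hsep hzero (p + 1)
    ((Submodule.finrank_le _).trans (by simp))

end

end RankRegression

/-! ### The candidates determine the minimum -/

namespace RankRegression

open Matrix

section

variable {n p : ℕ} {X : Matrix (Fin n) (Fin p) ℚ} {y : Fin n → ℚ}

theorem residual_lineMap (β β' : Fin p → ℝ) (t : ℝ) (i : Fin n) :
    residual X y (fun j => β j + t * (β' j - β j)) i =
      (1 - t) * residual X y β i + t * residual X y β' i := by
  have h : ∑ j, (X i j : ℝ) * (β j + t * (β' j - β j)) =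
      (1 - t) * ∑ j, (X i j : ℝ) * β j + t * ∑ j, (X i j : ℝ) * β' j := by
    rw [Finset.mul_sum, Finset.mul_sum, ← Finset.sum_add_distrib]
    exact Finset.sum_congr rfl fun j _ => by ring
  simp only [residual, h]
  ring

theorem exists_strictlyOrders {β : Fin p → ℝ} (h : Function.Injective (residual X y β)) :
    ∃ π, StrictlyOrders X y π β :=
  ⟨Tuple.sort (residual X y β), (Tuple.monotone_sort (residual X y β)).strictMono_of_injective
    (h.comp (Equiv.injective _))⟩

/-- As no two rows coincide, the ordering is strict in the interior of a cell. -/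
theorem strictlyOrders_of_mem_interior (hrows : ∀ i j, X i = X j → y i = y j → i = j)
    {π : Equiv.Perm (Fin n)} {β : Fin p → ℝ} (hβ : β ∈ interior (region X y π)) :
    StrictlyOrders X y π β := by
  have hmem : β ∈ region X y π := interior_subset hβ
  refine Monotone.strictMono_of_injective hmem fun a b hab => ?_
  -- two residuals that agree at an interior point agree around it
  have hdir : ∀ j : Fin p, X (π a) j = X (π b) j := by
    intro j
    have hc : Filter.Tendsto (fun t : ℝ => fun k =>
        β k + t * ((β k + (Pi.single j 1 : Fin p → ℝ) k) - β k))
        (nhds 0) (nhds β) := by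
      have : Continuous fun t : ℝ => fun k =>
          β k + t * ((β k + (Pi.single j 1 : Fin p → ℝ) k) - β k) := by fun_prop
      simpa using this.tendsto 0
    have hev := hc.eventually (mem_interior_iff_mem_nhds.mp hβ)
    obtain ⟨ε, hε, hball⟩ := Metric.eventually_nhds_iff.mp hev
    have hres : ∀ i, residual X y (fun k => β k + (Pi.single j 1 : Fin p → ℝ) k) i =
        residual X y β i - X i j := by
      intro i
      simp only [residual, mul_add, Finset.sum_add_distrib]
      rw [show ∑ k, (X i k : ℝ) * (Pi.single j 1 : Fin p → ℝ) k = X i j by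
        simp [Pi.single_apply]]
      ring
    have key : ∀ t : ℝ, |t| < ε → ∀ k l : Fin n, k ≤ l →
        residual X y β (π k) - t * X (π k) j ≤ residual X y β (π l) - t * X (π l) j := by
      intro t ht k l hkl
      have h1 := hball (y := t) (by simpa [Real.dist_eq] using ht)
      have h2 := h1 hkl
      simp only [residual_lineMap, hres] at h2
      linarith
    have hwlog : ∀ k l : Fin n, k ≤ l → residual X y β (π k) = residual X y β (π l) →
        X (π k) j = X (π l) j := by
      intro k l hkl he
      have h1 := key (ε / 2) (by rw [abs_of_pos (by positivity)]; linarith) k l hkl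
      have h2 := key (-(ε / 2)) (by rw [abs_neg, abs_of_pos (by positivity)]; linarith) k l hkl
      have h3 : (X (π k) j : ℝ) = X (π l) j := by
        apply le_antisymm <;> nlinarith
      exact_mod_cast h3
    rcases le_total a b with h | h
    · exact hwlog a b h hab
    · exact (hwlog b a h hab.symm).symm
  have hX : X (π a) = X (π b) := funext hdir
  refine π.injective (hrows _ _ hX ?_)
  have : (y (π a) : ℝ) = y (π b) := by
    simp only [residual, hX] at hab
    linarith
  exact_mod_cast this

/-- By lower semicontinuity, the function is on a closed cell at most the linear function of the
cell. -/
theorem IsGEN.objective_le {a : (Fin p → ℝ) → Fin n → ℝ} (h : IsGEN X y a)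
    {π : Equiv.Perm (Fin n)} {β₀ β : Fin p → ℝ} (h₀ : StrictlyOrders X y π β₀)
    (hβ : β ∈ region X y π) :
    objective X y a β ≤ ∑ i, a β₀ i * residual X y β i := by
  have hc : Continuous fun t : ℝ => fun k => β k + t * (β₀ k - β k) := by fun_prop
  have hlim : Filter.Tendsto (fun t : ℝ => fun k => β k + t * (β₀ k - β k))
      (nhdsWithin 0 (Set.Ioi 0)) (nhds β) := by
    have := hc.tendsto 0
    simp only [zero_mul, add_zero] at this
    exact this.mono_left nhdsWithin_le_nhds
  have hval : ∀ t : ℝ, 0 < t → t < 1 →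
      objective X y a (fun k => β k + t * (β₀ k - β k)) =
        ∑ i, a β₀ i * ((1 - t) * residual X y β i + t * residual X y β₀ i) := by
    intro t ht ht1
    have hs : StrictlyOrders X y π (fun k => β k + t * (β₀ k - β k)) := by
      intro k l hkl
      have h1 := h₀ hkl
      have h2 := hβ hkl.le
      simp only [residual_lineMap] at h1 h2 ⊢
      nlinarith
    simp only [objective, h.rank_dependent π _ _ hs h₀, residual_lineMap]
  have hlim' : Filter.Tendsto
      (fun t : ℝ => ∑ i, a β₀ i * ((1 - t) * residual X y β i + t * residual X y β₀ i))
      (nhdsWithin 0 (Set.Ioi 0)) (nhds (∑ i, a β₀ i * residual X y β i)) := by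
    have : Continuous fun t : ℝ =>
        ∑ i, a β₀ i * ((1 - t) * residual X y β i + t * residual X y β₀ i) := by fun_prop
    have := this.tendsto 0
    simp only [sub_zero, one_mul, zero_mul, add_zero] at this
    exact this.mono_left nhdsWithin_le_nhds
  refine le_of_forall_lt fun c hcF => ?_
  obtain ⟨c', hc', hc'F⟩ := exists_between hcF
  have hev := hlim.eventually (h.lsc β c' hc'F)
  have h01 : ∀ᶠ t : ℝ in nhdsWithin 0 (Set.Ioi 0), 0 < t ∧ t < 1 :=
    Ioo_mem_nhdsGT one_pos
  refine lt_of_lt_of_le hc' (ge_of_tendsto hlim' ?_)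
  filter_upwards [hev, h01] with t h1 h2
  rw [← hval t h2.1 h2.2]
  exact h1.le

end

/-- Digit `a` of `τ` in base `N`. -/
def digit (N a τ : ℕ) : ℕ := τ / N ^ a % N

/-- The point with homogeneous coordinates `s`. -/
noncomputable def affinePoint {p : ℕ} (s : Fin (p + 1) → ℤ) : Fin p → ℝ :=
  fun j => (s j.succ : ℝ) / (s 0 : ℝ)

section

variable {p : ℕ} (U : ℕ → Fin (p + 1) → ℤ)

/-- Matrix number `c` encoded by `τ`: its rows are differences of rows of the table `U`, the
indices of which are read off from the digits of `τ` in base `N`. -/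
def formMatrix (N τ c : ℕ) : Matrix (Fin (p + 1)) (Fin (p + 1)) ℤ := Matrix.of fun r k =>
  U (digit N (2 * (c * (p + 1) + r)) τ) k - U (digit N (2 * (c * (p + 1) + r) + 1) τ) k

/-- The sample point encoded by `τ`, in homogeneous coordinates: the sum of `p + 1` elementary
vectors. -/
def sampleVec (N τ : ℕ) : Fin (p + 1) → ℤ := fun k =>
  ∑ c : Fin (p + 1), elementary (formMatrix U N τ c) k

/-- The elementary vector, encoded by `τ`, that is tested on the cell of the sample point. -/
def testVec (N τ : ℕ) : Fin (p + 1) → ℤ := elementary (formMatrix U N τ (p + 1))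

/-- Homogeneous residual at the sample point. -/
def sampleRes (N τ i : ℕ) : ℤ := U i ⬝ᵥ sampleVec U N τ

/-- Homogeneous residual at the tested vector. -/
def testRes (N τ i : ℕ) : ℤ := U i ⬝ᵥ testVec U N τ

/-- The sample point lies in the interior of a cell, and the tested vector in the closed cone over
this cell. -/
structure Admissible (n N τ : ℕ) : Prop where
  sample_pos : 0 < sampleVec U N τ 0
  test_nonneg : 0 ≤ testVec U N τ 0
  injective : ∀ i j : Fin n, sampleRes U N τ i = sampleRes U N τ j → i = j
  monotone : ∀ i j : Fin n, sampleRes U N τ j < sampleRes U N τ i →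
    testRes U N τ j ≤ testRes U N τ i

/-- Value of the linear function of the sampled cell at the tested vector, in the homogeneous
scale. -/
noncomputable def testValue {n : ℕ} (a : (Fin p → ℝ) → Fin n → ℝ) (N τ : ℕ) : ℝ :=
  ∑ i : Fin n, a (affinePoint (sampleVec U N τ)) i * (testRes U N τ i : ℝ)

/-- The table `U` holds the rows `D • (y_i, -x_i)`, followed by a zero row and the unit rows. -/
structure IsRowTable {n : ℕ} (X : Matrix (Fin n) (Fin p) ℚ) (y : Fin n → ℚ) (D : ℤ) : Prop where
  pos : 0 < D
  response : ∀ i : Fin n, (U i 0 : ℝ) = D * y i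
  predictor : ∀ (i : Fin n) (j : Fin p), (U i j.succ : ℝ) = -(D * X i j)
  zero : U n = 0
  unit : ∀ k : Fin (p + 1), U (n + 1 + k) = Pi.single k 1

end

section

variable {n p : ℕ} {X : Matrix (Fin n) (Fin p) ℚ} {y : Fin n → ℚ} {D : ℤ}
  {U : ℕ → Fin (p + 1) → ℤ} {a : (Fin p → ℝ) → Fin n → ℝ}

theorem IsRowTable.dot (hU : IsRowTable U X y D) (i : Fin n) (x : Fin (p + 1) → ℝ) :
    (fun k => (U i k : ℝ)) ⬝ᵥ x = D * (y i * x 0 - ∑ j, (X i j : ℝ) * x j.succ) := by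
  simp only [dotProduct, Fin.sum_univ_succ, hU.response, hU.predictor, mul_sub, Finset.mul_sum]
  rw [sub_eq_add_neg, ← Finset.sum_neg_distrib]
  congr 1
  · ring
  · exact Finset.sum_congr rfl fun j _ => by ring

theorem IsRowTable.dot_intCast (hU : IsRowTable U X y D) (i : Fin n) (s : Fin (p + 1) → ℤ)
    (hs : 0 < s 0) :
    ((U i ⬝ᵥ s : ℤ) : ℝ) = D * s 0 * residual X y (affinePoint s) i := by
  have hs' : (s 0 : ℝ) ≠ 0 := by exact_mod_cast hs.ne'
  have h : ((U i ⬝ᵥ s : ℤ) : ℝ) = (fun k => (U i k : ℝ)) ⬝ᵥ fun k => (s k : ℝ) := by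
    simp [dotProduct]
  rw [h, hU.dot, residual, mul_assoc, mul_sub (s 0 : ℝ), Finset.mul_sum]
  congr 2
  · ring
  · refine Finset.sum_congr rfl fun j _ => ?_
    rw [affinePoint]
    field_simp

theorem IsRowTable.dot_lt_iff (hU : IsRowTable U X y D) {s : Fin (p + 1) → ℤ} (hs : 0 < s 0)
    (i j : Fin n) : U i ⬝ᵥ s < U j ⬝ᵥ s ↔
      residual X y (affinePoint s) i < residual X y (affinePoint s) j := by
  have hpos : (0 : ℝ) < D * s 0 := by
    have := hU.pos
    exact_mod_cast mul_pos this hs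
  rw [← Int.cast_lt (R := ℝ), hU.dot_intCast i s hs, hU.dot_intCast j s hs,
    mul_lt_mul_iff_right₀ hpos]

/-- The permutation that sorts the sampled residuals belongs to a cell. -/
theorem Admissible.exists_strictlyOrders {N τ : ℕ} (h : Admissible U n N τ)
    (hU : IsRowTable U X y D) :
    ∃ π, StrictlyOrders X y π (affinePoint (sampleVec U N τ)) := by
  refine RankRegression.exists_strictlyOrders fun i j hij => h.injective i j ?_
  have h1 := hU.dot_lt_iff h.sample_pos i j
  have h2 := hU.dot_lt_iff h.sample_pos j i
  rw [hij] at h1 h2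
  simp only [lt_irrefl, iff_false, not_lt] at h1 h2
  exact le_antisymm h2 h1

theorem Admissible.testRes_mono {N τ : ℕ} (h : Admissible U n N τ)
    (hU : IsRowTable U X y D) {π : Equiv.Perm (Fin n)}
    (hπ : StrictlyOrders X y π (affinePoint (sampleVec U N τ))) {k l : Fin n} (hkl : k ≤ l) :
    testRes U N τ (π k) ≤ testRes U N τ (π l) := by
  rcases hkl.eq_or_lt with rfl | hlt
  · exact le_rfl
  · exact h.monotone _ _ ((hU.dot_lt_iff h.sample_pos _ _).mpr (hπ hlt))

/-- An admissible vertex bounds the minimum from above. -/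
theorem Admissible.objective_le {N τ : ℕ} (h : Admissible U n N τ) (hF : IsGEN X y a)
    (hU : IsRowTable U X y D) (hz : 0 < testVec U N τ 0) :
    objective X y a (affinePoint (testVec U N τ)) ≤
      testValue U a N τ / (D * testVec U N τ 0) := by
  obtain ⟨π, hπ⟩ := h.exists_strictlyOrders hU
  have hpos : (0 : ℝ) < D * testVec U N τ 0 := by
    have := hU.pos
    exact_mod_cast mul_pos this hz
  have hmem : affinePoint (testVec U N τ) ∈ region X y π := by
    intro k l hkl
    have := h.testRes_mono hU hπ hkl
    rw [← Int.cast_le (R := ℝ), testRes, testRes, hU.dot_intCast _ _ hz,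
      hU.dot_intCast _ _ hz] at this
    exact le_of_mul_le_mul_left this hpos
  refine (hF.objective_le hπ hmem).trans_eq ?_
  rw [eq_div_iff hpos.ne', testValue, Finset.sum_mul]
  refine Finset.sum_congr rfl fun i _ => ?_
  rw [testRes, hU.dot_intCast _ _ hz]
  ring

/-- Along an admissible ray on which the linear function of the cell decreases, the function
tends to `-∞`. -/
theorem Admissible.not_bddBelow {N τ : ℕ} (h : Admissible U n N τ) (hF : IsGEN X y a)
    (hU : IsRowTable U X y D) (hz : testVec U N τ 0 = 0) (hneg : testValue U a N τ < 0) :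
    ¬ BddBelow (Set.range (objective X y a)) := by
  obtain ⟨π, hπ⟩ := h.exists_strictlyOrders hU
  have hD : (0 : ℝ) < D := by exact_mod_cast hU.pos
  set b := affinePoint (sampleVec U N τ) with hb
  have hres : ∀ (t : ℝ) (i : Fin n),
      residual X y (fun j => b j + t * (testVec U N τ j.succ : ℝ)) i =
        residual X y b i + t * ((testRes U N τ i : ℝ) / D) := by
    intro t i
    have h1 : (testRes U N τ i : ℝ) =
        (fun k => (U i k : ℝ)) ⬝ᵥ fun k => (testVec U N τ k : ℝ) := by
      simp [testRes, dotProduct]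
    rw [h1, hU.dot, hz, mul_div_assoc, mul_comm (D : ℝ), div_mul_cancel₀ _ hD.ne']
    simp only [residual, mul_add, Finset.sum_add_distrib, Int.cast_zero, mul_zero, zero_sub,
      mul_neg, Finset.mul_sum]
    rw [sub_add_eq_sub_sub, ← sub_eq_add_neg]
    congr 1
    exact Finset.sum_congr rfl fun j _ => by ring
  rintro ⟨v, hv⟩
  have hval : ∀ t : ℝ, 0 ≤ t →
      objective X y a (fun j => b j + t * (testVec U N τ j.succ : ℝ)) =
        (∑ i, a b i * residual X y b i) + t * (testValue U a N τ / D) := by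
    intro t ht
    have hs : StrictlyOrders X y π (fun j => b j + t * (testVec U N τ j.succ : ℝ)) := by
      intro k l hkl
      simp only [hres]
      have h1 := hπ hkl
      have h2 : (testRes U N τ (π k) : ℝ) / D ≤ (testRes U N τ (π l) : ℝ) / D := by
        have : (testRes U N τ (π k) : ℝ) ≤ testRes U N τ (π l) := by
          exact_mod_cast h.testRes_mono hU hπ hkl.le
        gcongr
      have h3 := mul_le_mul_of_nonneg_left h2 ht
      simp only at h1
      linarith
    simp only [objective, hF.rank_dependent π _ _ hs hπ, hres, mul_add, Finset.sum_add_distrib,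
      testValue, Finset.sum_div, Finset.mul_sum]
    congr 1
    exact Finset.sum_congr rfl fun i _ => by ring
  set G := testValue U a N τ / D with hG
  have hGneg : G < 0 := div_neg_of_neg_of_pos hneg hD
  set A := ∑ i, a b i * residual X y b i with hA
  have ht : 0 ≤ (|A| + |v| + 1) / (-G) := by
    have : 0 < -G := by linarith
    positivity
  have h1 := hv ⟨_, hval _ ht⟩
  rw [div_neg, neg_mul, div_mul_cancel₀ _ hGneg.ne] at h1
  have h2 := le_abs_self A
  have h3 := neg_abs_le v
  linarith

theorem exists_digits {K N : ℕ} (d : Fin K → ℕ) (hd : ∀ a, d a < N) :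
    ∃ τ < N ^ K, ∀ a : Fin K, digit N a τ = d a := by
  refine ⟨finFunctionFinEquiv (fun a => (⟨d a, hd a⟩ : Fin N)), Fin.is_lt _, fun a => ?_⟩
  rw [digit, ← finFunctionFinEquiv_symm_apply_val, Equiv.symm_apply_apply]

/-- Every tuple of `p + 2` matrices of differences of rows is encoded by some `τ`. -/
theorem exists_formMatrix (N : ℕ) (c : ℕ → Fin (p + 1) → Fin N × Fin N) :
    ∃ τ < N ^ (2 * ((p + 2) * (p + 1))), ∀ m < p + 2, formMatrix U N τ m =
      Matrix.of fun r k => U (c m r).1 k - U (c m r).2 k := by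
  obtain ⟨τ, hτ, hdig⟩ := exists_digits (K := 2 * ((p + 2) * (p + 1))) (N := N)
    (fun a => if (a : ℕ) % 2 = 0
      then ((c (a / 2 / (p + 1)) (Fin.ofNat (p + 1) (a / 2))).1 : ℕ)
      else (c (a / 2 / (p + 1)) (Fin.ofNat (p + 1) (a / 2))).2)
    (fun a => by split_ifs <;> exact Fin.is_lt _)
  refine ⟨τ, hτ, fun m hm => ?_⟩
  ext r k
  have hlt : m * (p + 1) + r < (p + 2) * (p + 1) := by
    have h1 : (m + 1) * (p + 1) ≤ (p + 2) * (p + 1) := Nat.mul_le_mul_right _ hm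
    have := r.is_lt
    linarith [add_mul m 1 (p + 1)]
  have hdiv : (m * (p + 1) + r) / (p + 1) = m := by
    rw [mul_comm, Nat.mul_add_div (Nat.succ_pos p), Nat.div_eq_of_lt r.is_lt, add_zero]
  have hmod : Fin.ofNat (p + 1) (m * (p + 1) + r) = r := by
    ext
    rw [Fin.val_ofNat, mul_comm, Nat.mul_add_mod, Nat.mod_eq_of_lt r.is_lt]
  have h1 := hdig ⟨2 * (m * (p + 1) + r), by omega⟩
  have h2 := hdig ⟨2 * (m * (p + 1) + r) + 1, by omega⟩
  simp only [Nat.mul_mod_right, if_true, Nat.mul_div_cancel_left _ two_pos] at h1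
  rw [if_neg (by simp only; omega),
    show (2 * (m * (p + 1) + (r : ℕ)) + 1) / 2 = m * (p + 1) + r by omega] at h2
  rw [hdiv, hmod] at h1 h2
  rw [formMatrix, Matrix.of_apply, Matrix.of_apply, h1, h2]

/-- If no admissible ray is decreasing, then a lower bound for all admissible vertices is a lower
bound for the function. The lifts of a point and of an interior point of its cell are conformally
decomposed into elementary vectors: the vectors for the interior point add up to an admissible
sample, and on the others the linear function of the cell is controlled by assumption. -/
theorem le_objective_of_forall_admissible (hF : IsGEN X y a) (hU : IsRowTable U X y D)
    {N : ℕ} (hN : N = n + p + 2)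
    (hray : ∀ τ < N ^ (2 * ((p + 2) * (p + 1))), Admissible U n N τ → testVec U N τ 0 = 0 →
      0 ≤ testValue U a N τ)
    {v : ℝ} (hvert : ∀ τ < N ^ (2 * ((p + 2) * (p + 1))), Admissible U n N τ →
      0 < testVec U N τ 0 → v ≤ testValue U a N τ / (D * testVec U N τ 0))
    (β : Fin p → ℝ) : v ≤ objective X y a β := by
  obtain ⟨π, hβ, β', hβ', hval⟩ := hF.inherits β
  have hst := strictlyOrders_of_mem_interior hF.rows_distinct hβ'
  have hD : (0 : ℝ) < D := by exact_mod_cast hU.pos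
  set g : Fin N × Fin N → Fin (p + 1) → ℝ := fun f k => (U f.1 k : ℝ) - U f.2 k with hg
  have hneg : ∀ f, ∃ f', g f' = -g f := fun f => ⟨(f.2, f.1), by
    ext k; simp only [hg, Pi.neg_apply]; ring⟩
  have hnN : n < N := by omega
  have hzero : ∃ f, g f = 0 := ⟨(⟨n, hnN⟩, ⟨n, hnN⟩), by ext k; simp [hg]⟩
  have hcoord : ∀ k : Fin (p + 1), ∃ f, ∀ x : Fin (p + 1) → ℝ, g f ⬝ᵥ x = x k := fun k =>
    ⟨(⟨n + 1 + k, by have := k.is_lt; omega⟩, ⟨n, hnN⟩), fun x => by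
      simp only [hg, hU.zero, hU.unit, dotProduct]
      simp [Pi.single_apply]⟩
  have hsep : ∀ x, (∀ f, g f ⬝ᵥ x = 0) → x = 0 := fun x hx => by
    ext k
    obtain ⟨f, hf⟩ := hcoord k
    rw [← hf x, hx f]; rfl
  obtain ⟨f₀, hf₀⟩ := hcoord 0
  -- differences of residuals as forms
  have hdiff : ∀ i j : Fin n, ∃ f, ∀ x : Fin (p + 1) → ℝ, g f ⬝ᵥ x =
      (fun k => (U i k : ℝ)) ⬝ᵥ x - (fun k => (U j k : ℝ)) ⬝ᵥ x := fun i j =>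
    ⟨(⟨i, i.is_lt.trans hnN⟩, ⟨j, j.is_lt.trans hnN⟩), fun x => by
      rw [← sub_dotProduct]; rfl⟩
  have hlift : ∀ (i : Fin n) (b : Fin p → ℝ),
      (fun k => (U i k : ℝ)) ⬝ᵥ (Fin.cons 1 b : Fin (p + 1) → ℝ) = D * residual X y b i := by
    intro i b
    rw [hU.dot, residual]
    simp
  obtain ⟨c', t', ht', hsum', hconf'⟩ :=
    exists_conformal_decomposition hneg hsep hzero (Fin.cons 1 β' : Fin (p + 1) → ℝ)
  obtain ⟨c, t, ht, hsum, hconf⟩ :=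
    exists_conformal_decomposition hneg hsep hzero (Fin.cons 1 β : Fin (p + 1) → ℝ)
  have key : ∀ j, D * v * elementary (Matrix.of fun i => g (c j i)) 0 ≤
      ∑ i, a β' i * ((fun k => (U i k : ℝ)) ⬝ᵥ elementary (Matrix.of fun i => g (c j i))) := by
    intro j
    obtain ⟨τ, hτ, hmat⟩ := exists_formMatrix (U := U) N
      (fun m => if h : m < p + 1 then c' ⟨m, h⟩ else c j)
    have hcast : ∀ e : Fin (p + 1) → Fin N × Fin N, ∀ k,
        ((elementary (Matrix.of fun r k => U (e r).1 k - U (e r).2 k) k : ℤ) : ℝ) =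
          elementary (Matrix.of fun i => g (e i)) k := by
      intro e k
      rw [elementary_intCast]
      congr 2
      ext r k
      simp [hg]
    have htest : ∀ k, (testVec U N τ k : ℝ) = elementary (Matrix.of fun i => g (c j i)) k := by
      intro k
      rw [testVec, hmat (p + 1) (by omega), ← hcast]
      simp
    have hsample : ∀ k, (sampleVec U N τ k : ℝ) =
        ∑ l, elementary (Matrix.of fun i => g (c' l i)) k := by
      intro k
      rw [sampleVec, Int.cast_sum]
      refine Finset.sum_congr rfl fun l _ => ?_
      rw [hmat l (by have := l.is_lt; omega), ← hcast]
      simp [l.is_le]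
    have hsampleDot : ∀ w : Fin (p + 1) → ℝ, (w ⬝ᵥ fun k => (sampleVec U N τ k : ℝ)) =
        ∑ l, w ⬝ᵥ elementary (Matrix.of fun i => g (c' l i)) := by
      intro w
      rw [← dotProduct_sum]
      congr 1
      ext k
      rw [hsample, Finset.sum_apply]
    -- a form that is positive at the interior point is positive at the sample
    have hpos : ∀ f, 0 < g f ⬝ᵥ (Fin.cons 1 β' : Fin (p + 1) → ℝ) →
        0 < g f ⬝ᵥ fun k => (sampleVec U N τ k : ℝ) := by
      intro f hf
      rw [hsampleDot]
      have hnn : ∀ l, 0 ≤ g f ⬝ᵥ elementary (Matrix.of fun i => g (c' l i)) :=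
        fun l => hconf' l f hf.le
      refine lt_of_le_of_ne (Finset.sum_nonneg fun l _ => hnn l) fun h0 => ?_
      have h1 := (Finset.sum_eq_zero_iff_of_nonneg fun l _ => hnn l).mp h0.symm
      rw [hsum', dotProduct_sum, Finset.sum_eq_zero fun l hl => by
        rw [dotProduct_smul, h1 l hl, smul_zero]] at hf
      exact lt_irrefl _ hf
    have hs0 : 0 < sampleVec U N τ 0 := by
      have := hpos f₀ (by rw [hf₀]; simp)
      rw [hf₀] at this
      exact_mod_cast this
    have hcastDot : ∀ (i : Fin n) (s : Fin (p + 1) → ℤ), ((U i ⬝ᵥ s : ℤ) : ℝ) =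
        (fun k => (U i k : ℝ)) ⬝ᵥ fun k => (s k : ℝ) := by
      intro i s; simp [dotProduct]
    have hsl : ∀ k l : Fin n, k < l → sampleRes U N τ (π k) < sampleRes U N τ (π l) := by
      intro k l hkl
      obtain ⟨f, hf⟩ := hdiff (π l) (π k)
      have h1 := hpos f (by
        rw [hf, hlift, hlift, sub_pos]
        exact mul_lt_mul_of_pos_left (hst hkl) hD)
      rw [hf, ← hcastDot, ← hcastDot, sub_pos] at h1
      exact_mod_cast h1
    have hsπ : StrictlyOrders X y π (affinePoint (sampleVec U N τ)) := fun k l hkl =>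
      (hU.dot_lt_iff hs0 _ _).mp (hsl k l hkl)
    have hmono : StrictMono fun k => sampleRes U N τ (π k) := hsl
    have hadm : Admissible U n N τ := by
      refine ⟨hs0, ?_, fun i j' hij => ?_, fun i j' hij => ?_⟩
      · have := hconf j f₀ (by rw [hf₀]; simp)
        rw [hf₀, ← htest] at this
        exact_mod_cast this
      · have := hmono.injective (a₁ := π.symm i) (a₂ := π.symm j') (by simpa using hij)
        exact π.symm.injective this
      · have hlt : π.symm j' < π.symm i := by
          rw [← hmono.lt_iff_lt]; simpa using hij
        obtain ⟨f, hf⟩ := hdiff i j'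
        have h1 := hconf j f (by
          rw [hf, hlift, hlift, sub_nonneg]
          have := hβ hlt.le
          simp only [Equiv.apply_symm_apply] at this
          exact mul_le_mul_of_nonneg_left this hD.le)
        rw [hf, sub_nonneg, show elementary (Matrix.of fun i => g (c j i)) =
          fun k => (testVec U N τ k : ℝ) from funext fun k => (htest k).symm,
          ← hcastDot, ← hcastDot] at h1
        exact_mod_cast h1
    have hG : testValue U a N τ =
        ∑ i, a β' i * ((fun k => (U i k : ℝ)) ⬝ᵥ elementary (Matrix.of fun i => g (c j i))) := by
      rw [testValue, hF.rank_dependent π _ _ hsπ hst]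
      refine Finset.sum_congr rfl fun i _ => ?_
      rw [testRes, hcastDot, show elementary (Matrix.of fun i => g (c j i)) =
          fun k => (testVec U N τ k : ℝ) from funext fun k => (htest k).symm]
    rw [← hG, ← htest]
    rcases hadm.test_nonneg.eq_or_lt with h0 | h0
    · rw [← h0, Int.cast_zero, mul_zero]
      exact hray τ hτ hadm h0.symm
    · have h1 := hvert τ hτ hadm h0
      have h2 : (0 : ℝ) < D * testVec U N τ 0 := by
        have := hU.pos
        exact_mod_cast mul_pos this h0
      rw [le_div_iff₀ h2] at h1
      linarith
  have hone : ∑ j, t j * elementary (Matrix.of fun i => g (c j i)) 0 = 1 := by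
    have := congrFun hsum 0
    rw [Finset.sum_apply] at this
    simpa using this.symm
  have hFβ : D * objective X y a β = ∑ j, t j * ∑ i, a β' i *
      ((fun k => (U i k : ℝ)) ⬝ᵥ elementary (Matrix.of fun i => g (c j i))) := by
    simp only [Finset.mul_sum]
    rw [hval, Finset.mul_sum, Finset.sum_comm]
    refine Finset.sum_congr rfl fun i _ => ?_
    have h1 := hlift i β
    rw [hsum, dotProduct_sum] at h1
    rw [← mul_assoc, mul_comm (D : ℝ), mul_assoc, ← h1, Finset.mul_sum]
    refine Finset.sum_congr rfl fun j _ => ?_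
    rw [dotProduct_smul, smul_eq_mul]
    ring
  have hfin : D * v * 1 ≤ D * objective X y a β := by
    rw [← hone, hFβ, Finset.mul_sum]
    refine Finset.sum_le_sum fun j _ => ?_
    have := mul_le_mul_of_nonneg_left (key j) (ht j)
    linarith
  rw [mul_one] at hfin
  exact le_of_mul_le_mul_left hfin hD

end

end RankRegression

/-! ### Bit lengths and the cost of expressions -/

namespace OracleRAM

theorem bitLen_zero : bitLen 0 = 1 := rfl

theorem bitLen_one : bitLen 1 = 2 := by
  rw [bitLen, Int.natAbs_one, Nat.size_one]

theorem one_le_bitLen (z : ℤ) : 1 ≤ bitLen z := Nat.le_add_left _ _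

theorem bitLen_le_succ {z : ℤ} {b : ℕ} : bitLen z ≤ b + 1 ↔ z.natAbs < 2 ^ b := by
  rw [bitLen, Nat.add_le_add_iff_right, Nat.size_le]

theorem natAbs_lt_of_bitLen (z : ℤ) : z.natAbs < 2 ^ (bitLen z - 1) := by
  rw [bitLen, Nat.add_sub_cancel]
  exact Nat.lt_size_self _

theorem bitLen_natCast_le (k : ℕ) : bitLen (k : ℤ) ≤ k + 1 := by
  rw [bitLen_le_succ, Int.natAbs_natCast]
  exact Nat.lt_two_pow_self

theorem bitLen_mul_le (x y : ℤ) : bitLen (x * y) ≤ bitLen x + bitLen y := by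
  have hx := natAbs_lt_of_bitLen x
  have hy := natAbs_lt_of_bitLen y
  have h : bitLen (x * y) ≤ (bitLen x - 1 + (bitLen y - 1)) + 1 := by
    rw [bitLen_le_succ, Int.natAbs_mul, pow_add]
    exact Nat.mul_lt_mul'' hx hy
  have := one_le_bitLen x
  have := one_le_bitLen y
  omega

theorem bitLen_add_le_max (x y : ℤ) : bitLen (x + y) ≤ max (bitLen x) (bitLen y) + 1 := by
  have hx := natAbs_lt_of_bitLen x
  have hy := natAbs_lt_of_bitLen y
  have h1 := one_le_bitLen x
  rw [bitLen_le_succ]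
  have hM : ∀ z, bitLen z ≤ max (bitLen x) (bitLen y) →
      2 ^ (bitLen z - 1) ≤ 2 ^ (max (bitLen x) (bitLen y) - 1) := fun z hz =>
    Nat.pow_le_pow_right two_pos (Nat.sub_le_sub_right hz 1)
  have h2 := hM x (le_max_left _ _)
  have h3 := hM y (le_max_right _ _)
  have h4 : 2 ^ max (bitLen x) (bitLen y) = 2 * 2 ^ (max (bitLen x) (bitLen y) - 1) := by
    rw [← pow_succ', Nat.sub_add_cancel (h1.trans (le_max_left _ _))]
  have := Int.natAbs_add_le x y
  omega

theorem bitLen_add_le (x y : ℤ) : bitLen (x + y) ≤ bitLen x + bitLen y := by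
  have := bitLen_add_le_max x y
  have := one_le_bitLen x
  have := one_le_bitLen y
  omega

theorem bitLen_neg (x : ℤ) : bitLen (-x) = bitLen x := by
  rw [bitLen, bitLen, Int.natAbs_neg]

theorem bitLen_sub_le (x y : ℤ) : bitLen (x - y) ≤ bitLen x + bitLen y := by
  rw [sub_eq_add_neg, ← bitLen_neg y]
  exact bitLen_add_le _ _

theorem bitLen_div_le (x y : ℤ) : bitLen (x / y) ≤ bitLen x :=
  Nat.add_le_add_right (Nat.size_le_size (Int.natAbs_ediv_le_natAbs x y)) 1

/-- A factor such that the value and the cost of an expression are, in bits, at most this factor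
times the bit length of the cells it reads. -/
def Arith.weight : Arith → ℕ
  | .lit c => bitLen c
  | .reg _ => 1
  | .get _ e => 2 * e.weight + 1
  | .add e f => 2 * (e.weight + f.weight)
  | .sub e f => 2 * (e.weight + f.weight)
  | .mul e f => 2 * (e.weight + f.weight)
  | .div e f => 2 * (e.weight + f.weight)

/-- All cells that the expression reads have bit length at most `b`. -/
def Arith.Small (m : Mem) (b : ℕ) : Arith → Prop
  | .lit _ => True
  | .reg r => bitLen (m.reg r) ≤ b
  | .get k e => e.Small m b ∧ bitLen (m.bank k (e.val m)) ≤ b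
  | .add e f => e.Small m b ∧ f.Small m b
  | .sub e f => e.Small m b ∧ f.Small m b
  | .mul e f => e.Small m b ∧ f.Small m b
  | .div e f => e.Small m b ∧ f.Small m b

theorem Arith.Small.bitLen_le_and_cost_le {m : Mem} {b : ℕ} (hb : 1 ≤ b) {e : Arith}
    (h : e.Small m b) : bitLen (e.val m) ≤ e.weight * b ∧ e.cost m ≤ e.weight * b := by
  have hop : ∀ {u v x y x' y' z : ℕ}, x ≤ u * b ∧ x' ≤ u * b → y ≤ v * b ∧ y' ≤ v * b →
      z ≤ x + y → z ≤ 2 * (u + v) * b ∧ x' + y' + x + y ≤ 2 * (u + v) * b := by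
    intro u v x y x' y' z hx hy hz
    have : 2 * (u + v) * b = u * b + v * b + u * b + v * b := by ring
    omega
  induction e with
  | lit c => exact ⟨Nat.le_mul_of_pos_right _ hb, Nat.le_mul_of_pos_right _ hb⟩
  | reg r => rw [weight, one_mul]; exact ⟨h, h⟩
  | get k e ih =>
    have h1 := ih h.1
    have h2 := h.2
    have : (2 * e.weight + 1) * b = e.weight * b + e.weight * b + b := by ring
    simp only [weight, val, cost]
    omega
  | add e f ihe ihf => exact hop (ihe h.1) (ihf h.2) (bitLen_add_le _ _)
  | sub e f ihe ihf => exact hop (ihe h.1) (ihf h.2) (bitLen_sub_le _ _)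
  | mul e f ihe ihf => exact hop (ihe h.1) (ihf h.2) (bitLen_mul_le _ _)
  | div e f ihe ihf =>
    exact hop (ihe h.1) (ihf h.2) ((bitLen_div_le _ _).trans (Nat.le_add_right _ _))

theorem Arith.Small.bitLen_le {m : Mem} {b : ℕ} (hb : 1 ≤ b) {e : Arith}
    (h : e.Small m b) : bitLen (e.val m) ≤ e.weight * b :=
  (h.bitLen_le_and_cost_le hb).1

/-- All cells of the storage have bit length at most `b`. -/
structure Mem.Bounded (b : ℕ) (m : Mem) : Prop where
  one_le : 1 ≤ b
  reg : ∀ r, bitLen (m.reg r) ≤ b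
  bank : ∀ k i, bitLen (m.bank k i) ≤ b

theorem Mem.Bounded.small {b : ℕ} {m : Mem} (h : m.Bounded b) (e : Arith) : e.Small m b := by
  induction e with
  | lit c => trivial
  | reg r => exact h.reg r
  | get k e ih => exact ⟨ih, h.bank _ _⟩
  | add e f ihe ihf => exact ⟨ihe, ihf⟩
  | sub e f ihe ihf => exact ⟨ihe, ihf⟩
  | mul e f ihe ihf => exact ⟨ihe, ihf⟩
  | div e f ihe ihf => exact ⟨ihe, ihf⟩

theorem Mem.Bounded.cost_le {b : ℕ} {m : Mem} (h : m.Bounded b) (e : Arith) :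
    e.cost m ≤ e.weight * b :=
  ((h.small e).bitLen_le_and_cost_le h.one_le).2

/-! ### Weakest preconditions with automatic time bounds -/

/-- Time bound for a program all whose loops make at most `b` iterations per entry, whose cells
always have bit length at most `b`, and whose queries have bit length at most `b`, including the
answer. -/
def Cmd.cap (b : ℕ) : Cmd → ℕ
  | .skip => 1
  | .assign _ e => e.weight * b + 1
  | .store _ i e => i.weight * b + e.weight * b + 1
  | .seq c d => c.cap b + d.cap b
  | .ifPos e c d => e.weight * b + 1 + (c.cap b + d.cap b)
  | .whilePos e c => (b + 1) * (e.weight * b + 1 + c.cap b)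
  | .query _ len _ => len.weight * b + 1 + b

/-- The program contains a command that writes into register `r`. -/
def Cmd.WritesReg (r : ℕ) : Cmd → Prop
  | .skip => False
  | .assign s _ => r = s
  | .store _ _ _ => False
  | .seq c d => c.WritesReg r ∨ d.WritesReg r
  | .ifPos _ c d => c.WritesReg r ∨ d.WritesReg r
  | .whilePos _ c => c.WritesReg r
  | .query _ _ _ => False

/-- The program contains a command that writes into bank `k`. -/
def Cmd.WritesBank (k : ℕ) : Cmd → Prop
  | .skip => False
  | .assign _ _ => False
  | .store l _ _ => k = l
  | .seq c d => c.WritesBank k ∨ d.WritesBank k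
  | .ifPos _ c d => c.WritesBank k ∨ d.WritesBank k
  | .whilePos _ c => c.WritesBank k
  | .query _ _ l => k = l

/-- The storages agree on all registers and banks into which the program does not write. -/
structure Frame (c : Cmd) (m m' : Mem) : Prop where
  reg : ∀ r, ¬ c.WritesReg r → m'.reg r = m.reg r
  bank : ∀ k, ¬ c.WritesBank k → m'.bank k = m.bank k

@[simp] theorem Mem.setReg_reg (m : Mem) (r : ℕ) (z : ℤ) (s : ℕ) :
    (m.setReg r z).reg s = if s = r then z else m.reg s := by
  simp [Mem.setReg, Function.update_apply]

@[simp] theorem Mem.setReg_bank (m : Mem) (r : ℕ) (z : ℤ) : (m.setReg r z).bank = m.bank := rfl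

@[simp] theorem Mem.setBank_reg (m : Mem) (k : ℕ) (f : ℤ → ℤ) : (m.setBank k f).reg = m.reg := rfl

@[simp] theorem Mem.setBank_bank (m : Mem) (k : ℕ) (f : ℤ → ℤ) (l : ℕ) :
    (m.setBank k f).bank l = if l = k then f else m.bank l := by
  simp [Mem.setBank, Function.update_apply]

theorem Exec.frame {O : List ℤ → List ℤ} {c : Cmd} {m m' : Mem} {t : ℕ} (h : Exec O c m m' t) :
    Frame c m m' := by
  induction h with
  | skip m => exact ⟨fun _ _ => rfl, fun _ _ => rfl⟩
  | assign r e m => exact ⟨fun s hs => by simp [show s ≠ r from hs], fun _ _ => rfl⟩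
  | store k i e m => exact ⟨fun _ _ => rfl, fun l hl => by simp [show l ≠ k from hl]⟩
  | seq _ _ ih1 ih2 =>
    exact ⟨fun r hr => (ih2.reg r fun h => hr (.inr h)).trans (ih1.reg r fun h => hr (.inl h)),
      fun k hk => (ih2.bank k fun h => hk (.inr h)).trans (ih1.bank k fun h => hk (.inl h))⟩
  | ifPos_true _ _ ih =>
    exact ⟨fun r hr => ih.reg r fun h => hr (.inl h), fun k hk => ih.bank k fun h => hk (.inl h)⟩
  | ifPos_false _ _ ih =>
    exact ⟨fun r hr => ih.reg r fun h => hr (.inr h), fun k hk => ih.bank k fun h => hk (.inr h)⟩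
  | while_true _ _ _ ih1 ih2 =>
    exact ⟨fun r hr => (ih2.reg r hr).trans (ih1.reg r hr),
      fun k hk => (ih2.bank k hk).trans (ih1.bank k hk)⟩
  | while_false _ => exact ⟨fun _ _ => rfl, fun _ _ => rfl⟩
  | query k len l m => exact ⟨fun _ _ => rfl, fun j hj => by simp [show j ≠ l from hj]⟩

theorem Frame.refl (c : Cmd) (m : Mem) : Frame c m m := ⟨fun _ _ => rfl, fun _ _ => rfl⟩

theorem Frame.trans {c : Cmd} {m m' m'' : Mem} (h : Frame c m m') (h' : Frame c m' m'') :
    Frame c m m'' :=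
  ⟨fun r hr => (h'.reg r hr).trans (h.reg r hr), fun k hk => (h'.bank k hk).trans (h.bank k hk)⟩

theorem Frame.mono {c d : Cmd} {m m' : Mem} (h : Frame c m m')
    (hr : ∀ r, c.WritesReg r → d.WritesReg r) (hk : ∀ k, c.WritesBank k → d.WritesBank k) :
    Frame d m m' :=
  ⟨fun r h' => h.reg r fun h'' => h' (hr r h''), fun k h' => h.bank k fun h'' => h' (hk k h'')⟩

/-- Started in the storage `m`, if this is bounded by `b`, the program halts in a storage that
satisfies `Q` and is bounded by `b`, within the time `c.cap b`. -/
def WP (O : List ℤ → List ℤ) (b : ℕ) (c : Cmd) (m : Mem) (Q : Mem → Prop) : Prop :=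
  m.Bounded b → ∃ m' t, Exec O c m m' t ∧ t ≤ c.cap b ∧ m'.Bounded b ∧ Q m'

section

variable {O : List ℤ → List ℤ} {b : ℕ} {m : Mem} {Q : Mem → Prop}

theorem WP.of_bounded {c : Cmd} (h : m.Bounded b → WP O b c m Q) : WP O b c m Q :=
  fun hm => h hm hm

/-- Consequence rule, with the frame of the program. -/
theorem WP.imp {c : Cmd} {P : Mem → Prop} (h : WP O b c m P)
    (hPQ : ∀ m', Frame c m m' → m'.Bounded b → P m' → Q m') : WP O b c m Q := fun hm => by
  obtain ⟨m', t, he, ht, hb, hP⟩ := h hm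
  exact ⟨m', t, he, ht, hb, hPQ m' he.frame hb hP⟩

theorem WP.skip (h : Q m) : WP O b .skip m Q := fun hm => ⟨m, 1, .skip m, le_rfl, hm, h⟩

theorem WP.assign {r : ℕ} {e : Arith} (hb : bitLen (e.val m) ≤ b) (h : Q (m.setReg r (e.val m))) :
    WP O b (.assign r e) m Q := fun hm => by
  refine ⟨_, _, .assign r e m, Nat.add_le_add_right (hm.cost_le e) 1, ⟨hm.one_le, fun s => ?_,
    hm.bank⟩, h⟩
  rw [Mem.setReg_reg]
  split_ifs
  · exact hb
  · exact hm.reg s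

theorem WP.store {k : ℕ} {i e : Arith} (hb : bitLen (e.val m) ≤ b)
    (h : Q (m.setBank k (Function.update (m.bank k) (i.val m) (e.val m)))) :
    WP O b (.store k i e) m Q := fun hm => by
  refine ⟨_, _, .store k i e m,
    Nat.add_le_add_right (Nat.add_le_add (hm.cost_le i) (hm.cost_le e)) 1, ⟨hm.one_le, hm.reg,
    fun l a => ?_⟩, h⟩
  rw [Mem.setBank_bank]
  split_ifs
  · rw [Function.update_apply]
    split_ifs
    · exact hb
    · exact hm.bank k a
  · exact hm.bank l a

theorem WP.seq {c d : Cmd} (h : WP O b c m fun m' => WP O b d m' Q) : WP O b (.seq c d) m Q :=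
  fun hm => by
  obtain ⟨m', t, he, ht, hb, h'⟩ := h hm
  obtain ⟨m'', t', he', ht', hb', hQ⟩ := h' hb
  exact ⟨m'', _, .seq he he', Nat.add_le_add ht ht', hb', hQ⟩

theorem WP.ifPos {e : Arith} {c d : Cmd} (hc : 0 < e.val m → WP O b c m Q)
    (hd : ¬ 0 < e.val m → WP O b d m Q) : WP O b (.ifPos e c d) m Q := fun hm => by
  have he := hm.cost_le e
  by_cases h : 0 < e.val m
  · obtain ⟨m', t, hex, ht, hb, hQ⟩ := hc h hm
    refine ⟨m', _, .ifPos_true h hex, ?_, hb, hQ⟩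
    simp only [Cmd.cap]
    omega
  · obtain ⟨m', t, hex, ht, hb, hQ⟩ := hd h hm
    refine ⟨m', _, .ifPos_false h hex, ?_, hb, hQ⟩
    simp only [Cmd.cap]
    omega

theorem bitLen_le_wordLen {w : List ℤ} {z : ℤ} (h : z ∈ w) : bitLen z ≤ wordLen w :=
  List.single_le_sum (fun _ _ => Nat.zero_le _) _ (List.mem_map_of_mem h)

theorem length_readWord (f : ℤ → ℤ) (len : ℕ) : (readWord f len).length = len := by
  simp [readWord]

theorem getElem_readWord (f : ℤ → ℤ) (len k : ℕ) (hk : k < (readWord f len).length) :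
    (readWord f len)[k] = f k := by
  have h : readWord f len = (List.range len).map fun i : ℕ => f i := by
    simp [readWord, ← List.map_eq_flatMap]
  simp only [h, List.getElem_map, List.getElem_range]
theorem WP.query {k : ℕ} {len : Arith} {l : ℕ} {w : List ℤ}
    (hw : readWord (m.bank k) (len.val m).toNat = w) (hb : wordLen w + wordLen (O w) ≤ b)
    (h : Q (m.setBank l (writeWord (m.bank l) (O w)))) :
    WP O b (.query k len l) m Q := fun hm => by
  subst hw
  refine ⟨_, _, .query k len l m, ?_, ⟨hm.one_le, hm.reg, fun j a => ?_⟩, h⟩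
  · have := hm.cost_le len
    simp only [Cmd.cap]
    omega
  · rw [Mem.setBank_bank]
    split_ifs
    · rw [writeWord]
      split_ifs with ha
      · rw [List.getD_eq_getElem _ _ (by omega)]
        exact (bitLen_le_wordLen (List.getElem_mem _)).trans (by omega)
      · exact hm.bank l a
    · exact hm.bank j a

/-- Execute `c` with the values `0, …, e - 1` in register `r`. -/
def Cmd.forLoop (r : ℕ) (e : Arith) (c : Cmd) : Cmd :=
  .seq (.assign r (.lit 0))
    (.whilePos (.sub e (.reg r)) (.seq c (.assign r (.add (.reg r) (.lit 1)))))

@[simp] theorem Cmd.writesReg_forLoop (s r : ℕ) (e : Arith) (c : Cmd) :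
    (Cmd.forLoop r e c).WritesReg s ↔ s = r ∨ c.WritesReg s := by
  simp only [forLoop, WritesReg]
  tauto

@[simp] theorem Cmd.writesBank_forLoop (k r : ℕ) (e : Arith) (c : Cmd) :
    (Cmd.forLoop r e c).WritesBank k ↔ c.WritesBank k := by
  simp [forLoop, WritesBank]

/-- Rule for loops, with the invariant `I`. Anything outside the frame of the loop may be used
without being part of the invariant. -/
theorem WP.forLoop {r : ℕ} {e : Arith} {c : Cmd} (N : ℕ) (I : ℕ → Mem → Prop) (hN : N < b)
    (hr : ¬ c.WritesReg r) (he : ∀ m', Frame (.forLoop r e c) m m' → e.val m' = N)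
    (h0 : I 0 (m.setReg r 0))
    (hstep : ∀ k < N, ∀ m', Frame (.forLoop r e c) m m' → m'.Bounded b → m'.reg r = k → I k m' →
      WP O b c m' fun m'' => I (k + 1) (m''.setReg r ((k + 1 : ℕ) : ℤ)))
    (hend : ∀ m', Frame (.forLoop r e c) m m' → m'.reg r = N → I N m' → Q m') :
    WP O b (.forLoop r e c) m Q := by
  have hframe : ∀ z, Frame (.forLoop r e c) m (m.setReg r z) := fun z =>
    ⟨fun s hs => by
      have : s ≠ r := fun h => hs (by simp [h])
      simp [this], fun _ _ => rfl⟩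
  refine WP.seq (WP.assign ?_ ?_)
  · simp only [Arith.val]
    exact (bitLen_natCast_le 0).trans (by omega)
  simp only [Arith.val]
  set w := Cmd.whilePos (.sub e (.reg r)) (.seq c (.assign r (.add (.reg r) (.lit 1)))) with hw
  have key : ∀ j k, k + j = N → ∀ m', Frame (.forLoop r e c) m m' → m'.reg r = k → I k m' →
      m'.Bounded b → ∃ m'' t, Exec O w m' m'' t ∧
        t ≤ (j + 1) * ((Arith.sub e (.reg r)).weight * b + 1 +
          (Cmd.seq c (.assign r (.add (.reg r) (.lit 1)))).cap b) ∧ m''.Bounded b ∧ Q m'' := by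
    intro j
    induction j with
    | zero =>
      intro k hk m' hf hk' hI hb
      obtain rfl : k = N := by omega
      refine ⟨m', _, .while_false ?_, ?_, hb, hend m' hf hk' hI⟩
      · simp [Arith.val, he m' hf, hk']
      · have := hb.cost_le (.sub e (.reg r))
        omega
    | succ j ih =>
      intro k hk m' hf hk' hI hb
      have hbody : WP O b (.seq c (.assign r (.add (.reg r) (.lit 1)))) m' fun m'' =>
          Frame (.forLoop r e c) m m'' ∧ m''.reg r = ((k + 1 : ℕ) : ℤ) ∧ I (k + 1) m'' := by
        refine WP.seq ((hstep k (by omega) m' hf hb hk' hI).imp fun m₁ hf₁ _ hI₁ => ?_)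
        have hk₁ : m₁.reg r + 1 = ((k + 1 : ℕ) : ℤ) := by
          rw [hf₁.reg r hr, hk']; push_cast; rfl
        refine WP.assign ?_ ?_
        · simp only [Arith.val, hk₁]
          exact (bitLen_natCast_le _).trans (by omega)
        · simp only [Arith.val, hk₁]
          refine ⟨(hf.trans (hf₁.mono ?_ ?_)).trans ⟨fun s hs => ?_, fun _ _ => rfl⟩, by simp, hI₁⟩
          · intro s hs; simp [hs]
          · intro s hs; simp [hs]
          · have : s ≠ r := fun h => hs (by simp [h])
            simp [this]
      obtain ⟨m₁, t₁, hex₁, ht₁, hb₁, hf₁, hr₁, hI₁⟩ := hbody hb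
      obtain ⟨m₂, t₂, hex₂, ht₂, hb₂, hQ⟩ := ih (k + 1) (by omega) m₁ hf₁ hr₁ hI₁ hb₁
      refine ⟨m₂, _, .while_true ?_ hex₁ hex₂, ?_, hb₂, hQ⟩
      · simp only [Arith.val, he m' hf, hk']
        omega
      · have := hb.cost_le (.sub e (.reg r))
        rw [add_mul (j + 1) 1, one_mul]
        omega
  intro hm
  obtain ⟨m', t, hex, ht, hb, hQ⟩ := key N 0 (by omega) _ (hframe 0) (by simp) h0 hm
  refine ⟨m', t, hex, ht.trans ?_, hb, hQ⟩
  exact Nat.mul_le_mul_right _ (by omega)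

/-- Execute the commands `c 0, …, c (k - 1)`. -/
def Cmd.block : {k : ℕ} → (Fin k → Cmd) → Cmd
  | 0, _ => .skip
  | _ + 1, c => .seq (c 0) (Cmd.block fun j => c j.succ)

@[simp] theorem Cmd.writesReg_block {k : ℕ} (c : Fin k → Cmd) (r : ℕ) :
    (Cmd.block c).WritesReg r ↔ ∃ j, (c j).WritesReg r := by
  induction k with
  | zero => simp [block, WritesReg]
  | succ k ih => simp [block, WritesReg, ih, Fin.exists_fin_succ]

@[simp] theorem Cmd.writesBank_block {k : ℕ} (c : Fin k → Cmd) (r : ℕ) :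
    (Cmd.block c).WritesBank r ↔ ∃ j, (c j).WritesBank r := by
  induction k with
  | zero => simp [block, WritesBank]
  | succ k ih => simp [block, WritesBank, ih, Fin.exists_fin_succ]

/-- Rule for blocks, with the invariant `I`. -/
theorem WP.block {k : ℕ} {c : Fin k → Cmd} (I : ℕ → Mem → Prop) (h0 : I 0 m)
    (hstep : ∀ j : Fin k, ∀ m', Frame (.block c) m m' → I j m' → WP O b (c j) m' (I (j + 1)))
    (hend : ∀ m', Frame (.block c) m m' → I k m' → Q m') : WP O b (.block c) m Q := by
  induction k generalizing I m with
  | zero => exact WP.skip (hend m (Frame.refl _ _) h0)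
  | succ k ih =>
    refine WP.seq ((hstep 0 m (Frame.refl _ _) h0).imp fun m₁ hf _ hI => ?_)
    have hf' : Frame (.block c) m m₁ := hf.mono
      (fun r hr => (Cmd.writesReg_block c r).mpr ⟨0, hr⟩)
      (fun r hr => (Cmd.writesBank_block c r).mpr ⟨0, hr⟩)
    have hmono : ∀ m₂, Frame (.block fun j => c j.succ) m₁ m₂ → Frame (.block c) m m₂ :=
      fun m₂ h => hf'.trans (h.mono
        (fun r hr => by
          obtain ⟨j, hj⟩ := (Cmd.writesReg_block _ r).mp hr
          exact (Cmd.writesReg_block c r).mpr ⟨j.succ, hj⟩)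
        (fun r hr => by
          obtain ⟨j, hj⟩ := (Cmd.writesBank_block _ r).mp hr
          exact (Cmd.writesBank_block c r).mpr ⟨j.succ, hj⟩))
    refine ih (fun j => I (j + 1)) (by simpa using hI) (fun j m₂ hf₂ hI₂ => ?_) fun m₂ hf₂ hI₂ => ?_
    · have := hstep j.succ m₂ (hmono m₂ hf₂) (by simpa using hI₂)
      simpa using this
    · exact hend m₂ (hmono m₂ hf₂) hI₂

end

/-! ### Polynomial time bounds -/

/-- The function is given by a polynomial. -/
def IsPolynomial (f : ℕ → ℕ) : Prop := ∃ T : Polynomial ℕ, ∀ L, T.eval L = f L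

theorem IsPolynomial.const (c : ℕ) : IsPolynomial fun _ => c := ⟨Polynomial.C c, fun L => by simp⟩

theorem IsPolynomial.id : IsPolynomial fun L => L := ⟨Polynomial.X, fun L => by simp⟩

theorem IsPolynomial.eval (q : Polynomial ℕ) : IsPolynomial fun L => q.eval L := ⟨q, fun _ => rfl⟩

theorem IsPolynomial.add {f g : ℕ → ℕ} (hf : IsPolynomial f) (hg : IsPolynomial g) :
    IsPolynomial fun L => f L + g L := by
  obtain ⟨S, hS⟩ := hf
  obtain ⟨T, hT⟩ := hg
  exact ⟨S + T, fun L => by simp [hS, hT]⟩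

theorem IsPolynomial.mul {f g : ℕ → ℕ} (hf : IsPolynomial f) (hg : IsPolynomial g) :
    IsPolynomial fun L => f L * g L := by
  obtain ⟨S, hS⟩ := hf
  obtain ⟨T, hT⟩ := hg
  exact ⟨S * T, fun L => by simp [hS, hT]⟩

theorem IsPolynomial.pow {f : ℕ → ℕ} (hf : IsPolynomial f) (k : ℕ) :
    IsPolynomial fun L => f L ^ k := by
  obtain ⟨S, hS⟩ := hf
  exact ⟨S ^ k, fun L => by simp [hS]⟩

theorem IsPolynomial.cap {f : ℕ → ℕ} (hf : IsPolynomial f) (c : Cmd) :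
    IsPolynomial fun L => c.cap (f L) := by
  have hw : ∀ e : Arith, IsPolynomial fun L => e.weight * f L := fun e =>
    (IsPolynomial.const _).mul hf
  induction c with
  | skip => exact .const 1
  | assign r e => exact (hw e).add (.const 1)
  | store k i e => exact ((hw i).add (hw e)).add (.const 1)
  | seq c d ihc ihd => exact ihc.add ihd
  | ifPos e c d ihc ihd => exact ((hw e).add (.const 1)).add (ihc.add ihd)
  | whilePos e c ih => exact (hf.add (.const 1)).mul (((hw e).add (.const 1)).add ih)
  | query k len l => exact ((hw len).add (.const 1)).add hf

/-! ### Expressions for sums, powers and determinants -/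

/-- The sum of the expressions `e 0, …, e (k - 1)`. -/
def Arith.sum : {k : ℕ} → (Fin k → Arith) → Arith
  | 0, _ => .lit 0
  | _ + 1, e => .add (e 0) (Arith.sum fun j => e j.succ)

theorem Arith.val_sum (m : Mem) {k : ℕ} (e : Fin k → Arith) :
    (Arith.sum e).val m = ∑ j, (e j).val m := by
  induction k with
  | zero => rfl
  | succ k ih => rw [Fin.sum_univ_succ, ← ih]; rfl

theorem Arith.Small.sum {m : Mem} {b k : ℕ} {e : Fin k → Arith} (h : ∀ j, (e j).Small m b) :
    (Arith.sum e).Small m b := by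
  induction k with
  | zero => trivial
  | succ k ih => exact ⟨h 0, ih fun j => h j.succ⟩

/-- The expression `e ^ k`. -/
def Arith.pow (e : Arith) : ℕ → Arith
  | 0 => .lit 1
  | k + 1 => .mul (e.pow k) e

theorem Arith.val_pow (m : Mem) (e : Arith) (k : ℕ) : (e.pow k).val m = e.val m ^ k := by
  induction k with
  | zero => simp [pow, val]
  | succ k ih => rw [pow_succ, ← ih]; rfl

theorem Arith.Small.pow {m : Mem} {b : ℕ} {e : Arith} (h : e.Small m b) (k : ℕ) :
    (e.pow k).Small m b := by
  induction k with
  | zero => trivial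
  | succ k ih => exact ⟨ih, h⟩

/-- The determinant of a matrix of expressions, expanded along the first row. -/
def Arith.det : {k : ℕ} → (Fin k → Fin k → Arith) → Arith
  | 0, _ => .lit 1
  | _ + 1, A => Arith.sum fun j =>
      .mul (.mul (.lit ((-1) ^ (j : ℕ))) (A 0 j)) (Arith.det fun r c => A r.succ (j.succAbove c))

theorem Arith.val_det (m : Mem) {k : ℕ} (A : Fin k → Fin k → Arith) :
    (Arith.det A).val m = (Matrix.of fun i j => (A i j).val m).det := by
  induction k with
  | zero => simp [det, val]
  | succ k ih =>
    rw [det, val_sum, Matrix.det_succ_row_zero]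
    refine Finset.sum_congr rfl fun j _ => ?_
    simp only [val, ih]
    rfl

theorem Arith.Small.det {m : Mem} {b k : ℕ} {A : Fin k → Fin k → Arith}
    (h : ∀ i j, (A i j).Small m b) : (Arith.det A).Small m b := by
  induction k with
  | zero => trivial
  | succ k ih => exact Arith.Small.sum fun j => ⟨⟨trivial, h _ _⟩, ih fun _ _ => h _ _⟩

end OracleRAM

/-! ### The input word and the table of rows -/

namespace RankRegression

open OracleRAM

theorem getD_flatten_ofFn {α : Type*} {n w : ℕ} (f : Fin n → List α) (hf : ∀ i, (f i).length = w)
    (z : α) (i : Fin n) {r : ℕ} (hr : r < w) :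
    (List.ofFn f).flatten.getD (i * w + r) z = (f i).getD r z := by
  induction n with
  | zero => exact i.elim0
  | succ n ih =>
    rw [List.ofFn_succ, List.flatten_cons]
    refine Fin.cases ?_ (fun i => ?_) i
    · rw [List.getD_append _ _ _ _ (by simp [hf, hr])]
      simp
    · rw [List.getD_append_right _ _ _ _ (by
        rw [hf, Fin.val_succ, add_mul]; omega), hf]
      rw [← ih (fun i => f i.succ) (fun i => hf _) i]
      congr 1
      rw [Fin.val_succ, add_mul]
      omega

section

variable {n p : ℕ} (X : Matrix (Fin n) (Fin p) ℚ) (y : Fin n → ℚ)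

/-- The entries of `(X, y)`, in the order of the input word. -/
def entries : List ℚ := (List.ofFn fun i => List.ofFn (X i)).flatten ++ List.ofFn y

theorem length_entries : (entries X y).length = n * (p + 1) := by
  have : (List.ofFn fun i => List.ofFn (X i)).flatten.length = n * p := by
    rw [List.length_flatten, List.map_ofFn]
    simp [Function.comp_def]
  rw [entries, List.length_append, this, List.length_ofFn]
  ring

theorem entries_getD_predictor (i : Fin n) (j : Fin p) :
    (entries X y).getD (i * p + j) 0 = X i j := by
  have hlen : (List.ofFn fun i => List.ofFn (X i)).flatten.length = n * p := by
    rw [List.length_flatten, List.map_ofFn]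
    simp [Function.comp_def]
  rw [entries, List.getD_append, getD_flatten_ofFn _ (w := p) (by simp) _ _ j.is_lt]
  · simp
  · rw [hlen]
    have h1 : ((i : ℕ) + 1) * p ≤ n * p := Nat.mul_le_mul_right _ i.is_lt
    have := j.is_lt
    linarith [add_mul (i : ℕ) 1 p]

theorem entries_getD_response (i : Fin n) : (entries X y).getD (n * p + i) 0 = y i := by
  have hlen : (List.ofFn fun i => List.ofFn (X i)).flatten.length = n * p := by
    rw [List.length_flatten, List.map_ofFn]
    simp [Function.comp_def]
  rw [entries, List.getD_append_right _ _ _ _ (by omega), hlen]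
  simp

theorem ratWord_eq {k : ℕ} (v : Fin k → ℚ) :
    ratWord v = ((List.ofFn v).map fun r => [r.num, (r.den : ℤ)]).flatten := by
  rw [ratWord, fractionWord, List.map_ofFn]
  rfl

theorem inputWord_eq : inputWord X y =
    (n : ℤ) :: (p : ℤ) :: ((entries X y).map fun r => [r.num, (r.den : ℤ)]).flatten := by
  rw [inputWord, entries, List.map_append, List.flatten_append, ← ratWord_eq, List.map_flatten,
    List.flatten_flatten, List.map_ofFn, List.map_ofFn]
  simp only [Function.comp_def, ← ratWord_eq]

theorem dataBits_eq : dataBits X y = ((entries X y).map ratBits).sum := by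
  rw [entries, List.map_append, List.sum_append, List.map_flatten, List.sum_flatten, List.map_ofFn,
    List.map_ofFn, List.map_ofFn, List.sum_ofFn, List.sum_ofFn, dataBits, vecBits]
  simp only [Function.comp_def, List.map_ofFn, List.sum_ofFn, vecBits]

theorem bitLen_num_le (r : ℚ) : bitLen r.num ≤ ratBits r := by
  rw [bitLen, ratBits]; omega

theorem bitLen_den_le (r : ℚ) : bitLen (r.den : ℤ) ≤ ratBits r := by
  rw [bitLen, ratBits, Int.natAbs_natCast]; omega

theorem ratBits_le_dataBits {r : ℚ} (hr : r ∈ entries X y) : ratBits r ≤ dataBits X y := by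
  rw [dataBits_eq]
  exact List.single_le_sum (fun _ _ => Nat.zero_le _) _ (List.mem_map_of_mem hr)

theorem card_le_dataBits : n ≤ dataBits X y := by
  have h : ∀ r : ℚ, 1 ≤ ratBits r := fun r => Nat.le_add_left _ _
  have : ∑ _i : Fin n, 1 ≤ vecBits y := Finset.sum_le_sum fun i _ => h (y i)
  rw [dataBits]
  simp at this
  omega

theorem length_inputWord : (inputWord X y).length = 2 * (entries X y).length + 2 := by
  have hlen : ((entries X y).map fun r => [r.num, (r.den : ℤ)]).flatten.length =
      2 * (entries X y).length := by
    rw [List.length_flatten, List.map_map]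
    simp [Function.comp_def, mul_comm]
  rw [inputWord_eq, List.length_cons, List.length_cons, hlen]

theorem bank_init_num {k : ℕ} (hk : k < (entries X y).length) :
    (Mem.init (inputWord X y)).bank 0 (2 * k + 2) = ((entries X y).getD k 0).num ∧
      (Mem.init (inputWord X y)).bank 0 (2 * k + 3) = ((entries X y).getD k 0).den := by
  have hget : ∀ r < 2, ((entries X y).map fun r => [r.num, (r.den : ℤ)]).flatten.getD
      (k * 2 + r) 0 =
        [((entries X y).getD k 0).num, (((entries X y).getD k 0).den : ℤ)].getD r 0 := by
    intro r hr
    have h := getD_flatten_ofFn (w := 2)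
      (fun i : Fin (entries X y).length => [((entries X y)[i]).num, (((entries X y)[i]).den : ℤ)])
      (by simp) 0 ⟨k, hk⟩ hr
    have he : (entries X y).map (fun r => [r.num, (r.den : ℤ)]) =
        List.ofFn fun i : Fin (entries X y).length =>
          [((entries X y)[i]).num, (((entries X y)[i]).den : ℤ)] := by
      conv_lhs => rw [← List.ofFn_getElem (xs := entries X y), List.map_ofFn]
      rfl
    rw [List.getD_eq_getElem _ _ hk, he]
    exact h
  have h0 : (Mem.init (inputWord X y)).bank 0 = writeWord (fun _ => 0) (inputWord X y) := rfl
  rw [h0]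
  have hw := length_inputWord X y
  constructor
  · have := hget 0 (by norm_num)
    rw [add_zero] at this
    rw [writeWord, if_pos (by omega), show (2 * (k : ℤ) + 2).toNat = k * 2 + 1 + 1 by omega,
      inputWord_eq, List.getD_cons_succ, List.getD_cons_succ, this]
    rfl
  · have := hget 1 (by norm_num)
    rw [writeWord, if_pos (by omega), show (2 * (k : ℤ) + 3).toNat = k * 2 + 1 + 1 + 1 by omega,
      inputWord_eq, List.getD_cons_succ, List.getD_cons_succ, this]
    rfl

theorem bank_init_zero : (Mem.init (inputWord X y)).bank 0 0 = n ∧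
    (Mem.init (inputWord X y)).bank 0 1 = p := by
  have h0 : (Mem.init (inputWord X y)).bank 0 = writeWord (fun _ => 0) (inputWord X y) := rfl
  have hw := length_inputWord X y
  rw [h0, writeWord, writeWord, if_pos (by omega), if_pos (by omega), inputWord_eq]
  exact ⟨rfl, rfl⟩

theorem bounded_init {b : ℕ} (hb : dataBits X y + p + 1 ≤ b) :
    (Mem.init (inputWord X y)).Bounded b := by
  refine ⟨by omega, fun r => ?_, fun k i => ?_⟩
  · change bitLen 0 ≤ b
    rw [bitLen_zero]; omega
  · change bitLen ((if k = 0 then writeWord (fun _ => 0) (inputWord X y) else fun _ => 0) i) ≤ b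
    split_ifs
    · rw [writeWord]
      split_ifs with hi
      · rw [List.getD_eq_getElem _ _ (by omega)]
        have hmem := List.getElem_mem (l := inputWord X y) (n := i.toNat) (by omega)
        generalize (inputWord X y)[i.toNat] = z at hmem
        rw [inputWord_eq, List.mem_cons, List.mem_cons, List.mem_flatten] at hmem
        rcases hmem with rfl | rfl | ⟨l, hl, hz⟩
        · have := card_le_dataBits X y
          exact (bitLen_natCast_le n).trans (by omega)
        · exact (bitLen_natCast_le p).trans (by omega)
        · obtain ⟨r, hr, rfl⟩ := List.mem_map.mp hl
          have h1 := ratBits_le_dataBits X y hr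
          have h2 := bitLen_num_le r
          have h3 := bitLen_den_le r
          simp only [List.mem_cons, List.not_mem_nil, or_false] at hz
          rcases hz with rfl | rfl <;> omega
      · rw [bitLen_zero]; omega
    · rw [bitLen_zero]; omega

/-- A common denominator of the data: the product of all denominators. -/
def commonDen : ℕ := ((entries X y).map Rat.den).prod

theorem commonDen_pos : 0 < commonDen X y :=
  List.prod_pos fun a ha => by
    obtain ⟨r, _, rfl⟩ := List.mem_map.mp ha
    exact r.pos

theorem bitLen_prod_den_le (l : List ℚ) :
    bitLen ((l.map Rat.den).prod : ℤ) ≤ (l.map ratBits).sum + 2 := by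
  induction l with
  | nil => exact le_rfl
  | cons r l ih =>
    rw [List.map_cons, List.prod_cons, List.map_cons, List.sum_cons, Nat.cast_mul]
    have := bitLen_mul_le (r.den : ℤ) ((l.map Rat.den).prod : ℕ)
    have := bitLen_den_le r
    omega

/-- The integer `D • r`, where `D` is the common denominator of the data. -/
def scaledEntry (k : ℕ) : ℤ :=
  ((entries X y).getD k 0).num * ((commonDen X y : ℤ) / ((entries X y).getD k 0).den)

theorem scaledEntry_cast {k : ℕ} (hk : k < (entries X y).length) :
    (scaledEntry X y k : ℝ) = (commonDen X y : ℤ) * ((entries X y).getD k 0 : ℚ) := by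
  set r := (entries X y).getD k 0 with hr
  have hmem : r ∈ entries X y := by
    rw [hr, List.getD_eq_getElem _ _ hk]; exact List.getElem_mem _
  have hdvd : (r.den : ℤ) ∣ (commonDen X y : ℤ) := by
    exact_mod_cast List.dvd_prod (List.mem_map_of_mem hmem)
  obtain ⟨e, he⟩ := hdvd
  have hden : (r.den : ℤ) ≠ 0 := by exact_mod_cast r.pos.ne'
  rw [scaledEntry, ← hr, he, Int.mul_ediv_cancel_left _ hden]
  have : (r : ℝ) = r.num / r.den := by exact_mod_cast (Rat.num_div_den r).symm
  rw [this]
  have hden' : (r.den : ℝ) ≠ 0 := by exact_mod_cast r.pos.ne'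
  push_cast
  field_simp

theorem bitLen_scaledEntry_le (k : ℕ) (hk : k < (entries X y).length) :
    bitLen (scaledEntry X y k) ≤ 2 * dataBits X y + 2 := by
  have hmem : (entries X y).getD k 0 ∈ entries X y := by
    rw [List.getD_eq_getElem _ _ hk]; exact List.getElem_mem _
  have h1 := bitLen_mul_le ((entries X y).getD k 0).num
    ((commonDen X y : ℤ) / ((entries X y).getD k 0).den)
  have h2 := bitLen_div_le (commonDen X y : ℤ) ((entries X y).getD k 0).den
  have h3 := bitLen_prod_den_le (entries X y)
  have h4 := (bitLen_num_le ((entries X y).getD k 0)).trans (ratBits_le_dataBits X y hmem)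
  rw [← dataBits_eq, ← commonDen] at h3
  rw [scaledEntry]
  omega

/-- The integral rows `D • (y_i, -x_i)`, followed by a zero row and the unit rows. -/
def rowTable (i : ℕ) (k : Fin (p + 1)) : ℤ :=
  if i < n then
    Fin.cases (scaledEntry X y (n * p + i)) (fun j => -scaledEntry X y (i * p + j)) k
  else if i = n + 1 + k then 1 else 0

theorem index_lt {i : ℕ} (hi : i < n) (j : Fin p) : i * p + j < (entries X y).length := by
  rw [length_entries]
  have h1 : (i + 1) * p ≤ n * p := Nat.mul_le_mul_right _ hi
  have := j.is_lt
  linarith [add_mul i 1 p, mul_add n p 1]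

theorem index_lt' {i : ℕ} (hi : i < n) : n * p + i < (entries X y).length := by
  rw [length_entries, mul_add]
  omega

theorem isRowTable : IsRowTable (rowTable X y) X y (commonDen X y : ℤ) where
  pos := by exact_mod_cast commonDen_pos X y
  response i := by
    rw [rowTable, if_pos i.is_lt, Fin.cases_zero, scaledEntry_cast X y (index_lt' X y i.is_lt),
      entries_getD_response]
  predictor i j := by
    rw [rowTable, if_pos i.is_lt, Fin.cases_succ, Int.cast_neg,
      scaledEntry_cast X y (index_lt X y i.is_lt j), entries_getD_predictor]
  zero := by
    ext k
    simp [rowTable]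
    omega
  unit k := by
    ext l
    rw [rowTable, if_neg (by omega), Pi.single_apply]
    by_cases h : l = k
    · simp [h]
    · rw [if_neg h, if_neg]
      intro h'
      exact h (Fin.ext (by omega))

theorem bitLen_rowTable_le (i : ℕ) (k : Fin (p + 1)) :
    bitLen (rowTable X y i k) ≤ 2 * dataBits X y + 2 := by
  rw [rowTable]
  split_ifs with hi
  · refine Fin.cases ?_ (fun j => ?_) k
    · exact bitLen_scaledEntry_le X y _ (index_lt' X y hi)
    · simp only [Fin.cases_succ]
      rw [bitLen_neg]
      exact bitLen_scaledEntry_le X y _ (index_lt X y hi j)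
  · exact le_add_left le_rfl
  · exact le_add_left (show 1 ≤ 2 by norm_num)

end

/-! ### Preparing the data

Registers: `1` common denominator, `2` main counter, `3` and `4` counters for rows, `5` flag for
admissible codes, `6` and `7` numerator and denominator of the tested value, `8` flag for
unboundedness, `9` rank of a residual. Banks: `0` input, `1` output, `3` sample point, `4` tested
vector, `7` queried permutation, `8` answer of the oracle, `10 + k` column `k` of the table of
rows. -/

/-- The number of rows. -/
def sizeE : Arith := .get 0 (.lit 0)

/-- The entry of the data with index `e`, multiplied by the common denominator. -/
def scaledE (e : Arith) : Arith :=
  .mul (.get 0 (.add (.mul (.lit 2) e) (.lit 2)))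
    (.div (.reg 1) (.get 0 (.add (.mul (.lit 2) e) (.lit 3))))

/-- Compute the common denominator. -/
def denCmd (p : ℕ) : Cmd :=
  .seq (.assign 1 (.lit 1)) (.forLoop 3 (.mul sizeE (.lit (p + 1)))
    (.assign 1 (.mul (.reg 1) (.get 0 (.add (.mul (.lit 2) (.reg 3)) (.lit 3))))))

/-- Write the rows of the data into the table. -/
def dataRowsCmd (p : ℕ) : Cmd :=
  .forLoop 3 sizeE (.seq
    (.store 10 (.reg 3) (scaledE (.add (.mul sizeE (.lit p)) (.reg 3))))
    (.block fun j : Fin p => .store (11 + j) (.reg 3)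
      (.sub (.lit 0) (scaledE (.add (.mul (.reg 3) (.lit p)) (.lit (j : ℕ)))))))

/-- Write the unit rows into the table. -/
def unitRowsCmd (p : ℕ) : Cmd :=
  .block fun k : Fin (p + 1) => .store (10 + k) (.add sizeE (.lit (1 + k : ℕ))) (.lit 1)

/-- The storage holds the number `n` of rows, the common denominator `D` and the table `U`. -/
structure Prepared {p : ℕ} (n : ℕ) (D : ℤ) (U : ℕ → Fin (p + 1) → ℤ) (m : Mem) : Prop where
  size : m.bank 0 0 = n
  den : m.reg 1 = D
  table : ∀ (k : Fin (p + 1)) (i : ℕ), m.bank (10 + k) i = U i k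

section

variable {n p : ℕ} {X : Matrix (Fin n) (Fin p) ℚ} {y : Fin n → ℚ} {O : List ℤ → List ℤ} {b : ℕ}

theorem wp_denCmd (hb : n * (p + 1) + dataBits X y + p + 3 ≤ b) :
    WP O b (denCmd p) (Mem.init (inputWord X y)) fun m => m.reg 1 = commonDen X y := by
  refine WP.seq (WP.assign (by rw [Arith.val, bitLen_one]; omega) ?_)
  refine WP.forLoop (n * (p + 1))
    (fun k m => m.reg 1 = ((((entries X y).take k).map Rat.den).prod : ℕ)) (by omega)
    (by simp [Cmd.WritesReg]) (fun m' hf => ?_) (by simp [Arith.val])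
    (fun k hk m' hf _ hr hI => ?_) (fun m' _ _ hI => ?_)
  · rw [sizeE, Arith.val, Arith.val, Arith.val, Arith.val, hf.bank 0 (by simp [Cmd.WritesBank]),
      Mem.setReg_bank, (bank_init_zero X y).1]
    push_cast
    rfl
  · have hk' : k < (entries X y).length := by rwa [length_entries]
    have hval : (Arith.mul (.reg 1) (.get 0 (.add (.mul (.lit 2) (.reg 3)) (.lit 3)))).val m' =
        ((((entries X y).take (k + 1)).map Rat.den).prod : ℕ) := by
      simp only [Arith.val]
      rw [hI, hr, hf.bank 0 (by simp [Cmd.WritesBank]), Mem.setReg_bank,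
        (bank_init_num X y hk').2, List.take_add_one, List.getElem?_eq_getElem hk',
        List.getD_eq_getElem _ _ hk']
      simp only [Option.toList_some, List.map_append, List.prod_append, List.map_cons,
        List.map_nil, List.prod_cons, List.prod_nil, mul_one, Nat.cast_mul]
    refine WP.assign ?_ ?_
    · rw [hval]
      refine (bitLen_prod_den_le _).trans ?_
      have : (((entries X y).take (k + 1)).map ratBits).sum ≤ dataBits X y := by
        rw [dataBits_eq]
        exact ((List.take_sublist _ _).map _).sum_le_sum fun _ _ => Nat.zero_le _
      omega
    · rw [hval]
      simp
  · rw [hI, ← length_entries X y, List.take_length, commonDen]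

theorem val_scaledE {m : Mem} (hm : m.bank 0 = (Mem.init (inputWord X y)).bank 0)
    (hD : m.reg 1 = commonDen X y) {e : Arith} {k : ℕ} (he : e.val m = k)
    (hk : k < (entries X y).length) : (scaledE e).val m = scaledEntry X y k := by
  simp only [scaledE, Arith.val]
  rw [he, hm, hD, (bank_init_num X y hk).1, (bank_init_num X y hk).2]
  rfl

theorem wp_dataRowsCmd {m : Mem} (hm : m.bank 0 = (Mem.init (inputWord X y)).bank 0)
    (hD : m.reg 1 = commonDen X y) (hzero : ∀ (k : Fin (p + 1)) i, m.bank (10 + k) i = 0)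
    (hb : n + 2 * dataBits X y + 2 < b) :
    WP O b (dataRowsCmd p) m fun m => ∀ (k : Fin (p + 1)) (i : ℕ),
      m.bank (10 + k) i = if i < n then rowTable X y i k else 0 := by
  have hbank : ∀ m', Frame (dataRowsCmd p) m m' →
      m'.bank 0 = (Mem.init (inputWord X y)).bank 0 := fun m' hf =>
    (hf.bank 0 (by simp [dataRowsCmd, Cmd.WritesBank]; intros; omega)).trans hm
  have hreg : ∀ m', Frame (dataRowsCmd p) m m' → m'.reg 1 = commonDen X y := fun m' hf =>
    (hf.reg 1 (by simp [dataRowsCmd, Cmd.WritesReg])).trans hD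
  refine WP.forLoop n
    (fun t m => ∀ (k : Fin (p + 1)) (i : ℕ),
      m.bank (10 + k) i = if i < t then rowTable X y i k else 0) (by omega)
    (by simp [Cmd.WritesReg]) (fun m' hf => ?_) (fun k i => by simpa using hzero k i)
    (fun t ht m' hf _ hr hI => ?_) (fun m' _ _ hI => hI)
  · rw [sizeE, Arith.val, Arith.val, hbank m' hf, (bank_init_zero X y).1]
  · have hrow0 : rowTable X y t 0 = scaledEntry X y (n * p + t) := by
      rw [rowTable, if_pos ht, Fin.cases_zero]
    have hrowS : ∀ j : Fin p, rowTable X y t j.succ = -scaledEntry X y (t * p + j) := fun j => by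
      rw [rowTable, if_pos ht, Fin.cases_succ]
    have hval0 : (scaledE (.add (.mul sizeE (.lit p)) (.reg 3))).val m' = rowTable X y t 0 := by
      rw [hrow0]
      refine val_scaledE (hbank m' hf) (hreg m' hf) ?_ (index_lt' X y ht)
      simp only [Arith.val, sizeE, hbank m' hf, (bank_init_zero X y).1, hr]
      push_cast
      rfl
    refine WP.seq (WP.store ?_ ?_)
    · rw [hval0]
      exact (bitLen_rowTable_le X y t 0).trans (by omega)
    rw [hval0]
    refine WP.block (fun s m'' => ∀ (k : Fin (p + 1)) (i : ℕ), m''.bank (10 + k) i =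
        if i < t ∨ (i = t ∧ (k : ℕ) < s + 1) then rowTable X y i k else 0) ?_ ?_ ?_
    · intro k i
      simp only [Arith.val, hr]
      rw [Mem.setBank_bank]
      by_cases hk : k = 0
      · subst hk
        have h0 := hI 0 i
        simp only [Fin.val_zero, add_zero] at h0
        simp only [Fin.val_zero, add_zero, if_true, Function.update_apply, Nat.cast_inj, h0]
        by_cases hit : i = t
        · subst hit; simp
        · simp [hit]
      · have hk0 : (k : ℕ) ≠ 0 := fun h => hk (Fin.ext h)
        rw [if_neg (by omega), hI]
        congr 1
        simp only [eq_iff_iff]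
        omega
    · intro j m₂ hf₂ hI₂
      have hbank₂ : m₂.bank 0 = (Mem.init (inputWord X y)).bank 0 := by
        rw [hf₂.bank 0 (by simp [Cmd.WritesBank]; intros; omega), Mem.setBank_bank,
          if_neg (by norm_num),
          hbank m' hf]
      have hreg₂ : m₂.reg 1 = commonDen X y := by
        rw [hf₂.reg 1 (by simp [Cmd.WritesReg]), Mem.setBank_reg, hreg m' hf]
      have hr₂ : m₂.reg 3 = t := by
        rw [hf₂.reg 3 (by simp [Cmd.WritesReg]), Mem.setBank_reg, hr]
      have hval : (Arith.sub (.lit 0) (scaledE (.add (.mul (.reg 3) (.lit p))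
          (.lit (j : ℕ))))).val m₂ = rowTable X y t j.succ := by
        rw [Arith.val, val_scaledE hbank₂ hreg₂ (k := t * p + j) ?_ (index_lt X y ht j), hrowS,
          Arith.val, zero_sub]
        simp only [Arith.val, hr₂]
        push_cast
        rfl
      refine WP.store ?_ ?_
      · rw [hval]
        exact (bitLen_rowTable_le X y t _).trans (by omega)
      · rw [hval]
        simp only [Arith.val, hr₂]
        intro k i
        rw [Mem.setBank_bank]
        by_cases hk : k = j.succ
        · subst hk
          have h0 := hI₂ j.succ i
          simp only [Fin.val_succ] at h0
          rw [Fin.val_succ, if_pos (by omega), Function.update_apply,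
            show 11 + (j : ℕ) = 10 + (j + 1) by omega, h0]
          by_cases hit : i = t
          · subst hit; simp
          · simp [hit]
        · have hk0 : (k : ℕ) ≠ j + 1 := fun h => hk (Fin.ext h)
          rw [if_neg (by omega), hI₂]
          congr 1
          simp only [eq_iff_iff]
          omega
    · intro m₂ _ hI₂ k i
      rw [Mem.setReg_bank, hI₂]
      congr 1
      have := k.is_lt
      simp only [eq_iff_iff]
      omega

theorem wp_unitRowsCmd {m : Mem} (hn : m.bank 0 0 = n)
    (hm : ∀ (k : Fin (p + 1)) (i : ℕ),
      m.bank (10 + k) i = if i < n then rowTable X y i k else 0) (hb : 2 ≤ b) :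
    WP O b (unitRowsCmd p) m fun m => ∀ (k : Fin (p + 1)) (i : ℕ),
      m.bank (10 + k) i = rowTable X y i k := by
  refine WP.block (fun s m' => ∀ (k : Fin (p + 1)) (i : ℕ), m'.bank (10 + k) i =
    if i < n ∨ (k : ℕ) < s then rowTable X y i k else 0) (by simpa using hm) ?_ ?_
  · intro j m₂ hf₂ hI₂
    have hn₂ : m₂.bank 0 0 = n := by
      rw [hf₂.bank 0 (by simp [Cmd.WritesBank]; intros; omega), hn]
    refine WP.store (by rw [Arith.val, bitLen_one]; exact hb) ?_
    intro k i
    have haddr : (Arith.add sizeE (.lit (1 + j : ℕ))).val m₂ = ((n + 1 + j : ℕ) : ℤ) := by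
      simp only [Arith.val, sizeE, hn₂]
      push_cast
      ring
    rw [haddr, Mem.setBank_bank, Arith.val]
    by_cases hk : k = j
    · subst hk
      rw [if_pos rfl, Function.update_apply, hI₂]
      by_cases hi : i < n
      · rw [if_neg (by omega)]
        simp [hi]
      · simp only [hi, rowTable, if_false, Nat.cast_inj]
        split_ifs <;> simp_all
    · have hk0 : (k : ℕ) ≠ j := fun h => hk (Fin.ext h)
      rw [if_neg (by omega), hI₂]
      congr 1
      simp only [eq_iff_iff]
      omega
  · intro m₂ _ hI₂ k i
    rw [hI₂, if_pos (.inr k.is_lt)]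

/-- Compute the common denominator and the table of rows. -/
def prepareCmd (p : ℕ) : Cmd := .seq (denCmd p) (.seq (dataRowsCmd p) (unitRowsCmd p))

theorem wp_prepareCmd (hb : n * (p + 1) + n + 2 * dataBits X y + p + 3 ≤ b) :
    WP O b (prepareCmd p) (Mem.init (inputWord X y)) fun m =>
      Prepared n (commonDen X y) (rowTable X y) m := by
  refine WP.seq ((wp_denCmd (by omega)).imp fun m₁ hf₁ _ hD₁ => ?_)
  have hbank₁ : ∀ k, m₁.bank k = (Mem.init (inputWord X y)).bank k := fun k =>
    hf₁.bank k (by simp [denCmd, Cmd.WritesBank])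
  refine WP.seq ((wp_dataRowsCmd (hbank₁ 0) hD₁ (fun k i => ?_) (by omega)).imp
    fun m₂ hf₂ _ hT₂ => ?_)
  · rw [hbank₁]
    change (if 10 + (k : ℕ) = 0 then _ else fun _ => (0 : ℤ)) i = 0
    rw [if_neg (by omega)]
  have hn₂ : m₂.bank 0 0 = n := by
    rw [hf₂.bank 0 (by simp [dataRowsCmd, Cmd.WritesBank]; intros; omega), hbank₁,
      (bank_init_zero X y).1]
  refine (wp_unitRowsCmd hn₂ hT₂ (by omega)).imp fun m₃ hf₃ _ hT₃ => ⟨?_, ?_, hT₃⟩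
  · rw [hf₃.bank 0 (by simp [unitRowsCmd, Cmd.WritesBank]; intros; omega), hn₂]
  · rw [hf₃.reg 1 (by simp [unitRowsCmd, Cmd.WritesReg]),
      hf₂.reg 1 (by simp [dataRowsCmd, Cmd.WritesReg]), hD₁]

end

end RankRegression

/-! ### Decoding a code into vectors -/

namespace RankRegression

open OracleRAM Matrix

/-- The number of rows of the table. -/
def rowCountE (p : ℕ) : Arith := .add sizeE (.lit (p + 2 : ℕ))

/-- Digit `a` of the main counter. -/
def digitE (p a : ℕ) : Arith :=
  .sub (.div (.reg 2) ((rowCountE p).pow a))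
    (.mul (rowCountE p) (.div (.reg 2) ((rowCountE p).pow (a + 1))))

/-- The entries of matrix number `c`. -/
def formE (p c : ℕ) (r k : Fin (p + 1)) : Arith :=
  .sub (.get (10 + k) (digitE p (2 * (c * (p + 1) + r))))
    (.get (10 + k) (digitE p (2 * (c * (p + 1) + r) + 1)))

/-- The elementary vector of matrix number `c`. -/
def elementaryE (p c : ℕ) (k : Fin (p + 1)) : Arith :=
  .mul (.det (formE p c))
    (.det (Function.update (formE p c) 0 fun l => .lit (if l = k then 1 else 0)))

/-- The sample point. -/
def sampleE (p : ℕ) (k : Fin (p + 1)) : Arith :=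
  .sum fun c : Fin (p + 1) => elementaryE p c k

/-- Write the sample point and the tested vector. -/
def vectorsCmd (p : ℕ) : Cmd :=
  .block fun k : Fin (p + 1) => .seq (.store 3 (.lit (k : ℕ)) (sampleE p k))
    (.store 4 (.lit (k : ℕ)) (elementaryE p (p + 1) k))

/-- A bound for the weights of the expressions of the sample point and of the tested vector. -/
def vectorWeight (p : ℕ) : ℕ :=
  ∑ k, (sampleE p k).weight + ∑ k, (elementaryE p (p + 1) k).weight + 1

/-- The homogeneous residual of the row at the address `e` for the vector in bank `l`. -/
def dotE (p l : ℕ) (e : Arith) : Arith :=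
  .sum fun k : Fin (p + 1) => .mul (.get (10 + k) e) (.get l (.lit (k : ℕ)))

/-- The storage holds the sample point and the tested vector of the code `τ`. -/
structure Decoded {p : ℕ} (n : ℕ) (D : ℤ) (U : ℕ → Fin (p + 1) → ℤ) (N τ : ℕ) (m : Mem) : Prop
    extends Prepared n D U m where
  sample : ∀ k : Fin (p + 1), m.bank 3 (k : ℕ) = sampleVec U N τ k
  test : ∀ k : Fin (p + 1), m.bank 4 (k : ℕ) = testVec U N τ k

section

variable {n p : ℕ} {D : ℤ} {U : ℕ → Fin (p + 1) → ℤ} {O : List ℤ → List ℤ} {b β N τ : ℕ}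
  {m m' : Mem}

theorem Prepared.frame (h : Prepared n D U m) {c : Cmd} (hf : Frame c m m')
    (hr : ¬ c.WritesReg 1) (hk : ∀ k, c.WritesBank k → k ≠ 0 ∧ k < 10) : Prepared n D U m' where
  size := by rw [hf.bank 0 fun h => (hk 0 h).1 rfl, h.size]
  den := by rw [hf.reg 1 hr, h.den]
  table k i := by
    rw [hf.bank _ fun h => absurd (hk _ h).2 (by omega), h.table]

theorem Decoded.frame (h : Decoded n D U N τ m) {c : Cmd} (hf : Frame c m m')
    (hr : ¬ c.WritesReg 1) (hk : ∀ k, c.WritesBank k → k = 1 ∨ k = 7 ∨ k = 8) :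
    Decoded n D U N τ m' where
  toPrepared := h.toPrepared.frame hf hr fun k hk' => by have := hk k hk'; omega
  sample k := by rw [hf.bank 3 fun h => by have := hk 3 h; omega, h.sample]
  test k := by rw [hf.bank 4 fun h => by have := hk 4 h; omega, h.test]

theorem Prepared.val_sizeE (h : Prepared n D U m) : sizeE.val m = n := h.size

theorem Prepared.val_rowCountE (h : Prepared n D U m) :
    (rowCountE p).val m = ((n + p + 2 : ℕ) : ℤ) := by
  rw [rowCountE, Arith.val, h.val_sizeE, Arith.val]
  push_cast
  ring

theorem Prepared.val_digitE (h : Prepared n D U m) (hτ : m.reg 2 = τ) (a : ℕ) :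
    (digitE p a).val m = (digit (n + p + 2) a τ : ℕ) := by
  simp only [digitE, Arith.val, Arith.val_pow, h.val_rowCountE, hτ]
  rw [digit, Int.natCast_emod, Int.emod_def, Int.natCast_ediv, Int.natCast_pow, pow_succ,
    Int.ediv_ediv_of_nonneg (by positivity)]

theorem Prepared.val_formE (h : Prepared n D U m) (hτ : m.reg 2 = τ) (c : ℕ) (r k : Fin (p + 1)) :
    (formE p c r k).val m = formMatrix U (n + p + 2) τ c r k := by
  simp only [formE, Arith.val, h.val_digitE hτ, h.table]
  rfl

theorem Prepared.val_elementaryE (h : Prepared n D U m) (hτ : m.reg 2 = τ) (c : ℕ)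
    (k : Fin (p + 1)) :
    (elementaryE p c k).val m = elementary (formMatrix U (n + p + 2) τ c) k := by
  rw [elementaryE, Arith.val, Arith.val_det, Arith.val_det, elementary]
  congr 2
  · ext r l
    exact h.val_formE hτ c r l
  · ext r l
    by_cases hr : r = 0
    · subst hr
      simp [Arith.val, Pi.single_apply]
    · simp [hr, h.val_formE hτ]

theorem Prepared.val_sampleE (h : Prepared n D U m) (hτ : m.reg 2 = τ) (k : Fin (p + 1)) :
    (sampleE p k).val m = sampleVec U (n + p + 2) τ k := by
  rw [sampleE, Arith.val_sum]
  exact Finset.sum_congr rfl fun c _ => h.val_elementaryE hτ c k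

theorem Prepared.small_elementaryE (h : Prepared n D U m) (hτ : m.reg 2 = τ)
    (hτβ : bitLen (τ : ℤ) ≤ β) (hn : bitLen (n : ℤ) ≤ β) (hU : ∀ i k, bitLen (U i k) ≤ β) (c : ℕ)
    (k : Fin (p + 1)) : (elementaryE p c k).Small m β := by
  have hreg : (Arith.reg 2).Small m β := by
    change bitLen (m.reg 2) ≤ β
    rwa [hτ]
  have hrow : (rowCountE p).Small m β := ⟨⟨trivial, by
    change bitLen (m.bank 0 0) ≤ β
    rwa [h.size]⟩, trivial⟩
  have hdigit : ∀ a, (digitE p a).Small m β := fun a => ⟨⟨hreg, hrow.pow _⟩, hrow, hreg, hrow.pow _⟩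
  have hget : ∀ (k : Fin (p + 1)) a, (Arith.get (10 + k) (digitE p a)).Small m β := fun k a =>
    ⟨hdigit a, by rw [h.val_digitE hτ, h.table]; exact hU _ _⟩
  refine ⟨Arith.Small.det fun r l => ⟨hget _ _, hget _ _⟩, Arith.Small.det fun r l => ?_⟩
  by_cases hr : r = 0
  · subst hr
    rw [Function.update_self]
    trivial
  · rw [Function.update_of_ne hr]
    exact ⟨hget _ _, hget _ _⟩

theorem Prepared.small_sampleE (h : Prepared n D U m) (hτ : m.reg 2 = τ)
    (hτβ : bitLen (τ : ℤ) ≤ β) (hn : bitLen (n : ℤ) ≤ β) (hU : ∀ i k, bitLen (U i k) ≤ β)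
    (k : Fin (p + 1)) : (sampleE p k).Small m β :=
  Arith.Small.sum fun c => h.small_elementaryE hτ hτβ hn hU c k

theorem weight_sampleE_le (p : ℕ) (k : Fin (p + 1)) : (sampleE p k).weight ≤ vectorWeight p := by
  have := Finset.single_le_sum (f := fun k => (sampleE p k).weight) (fun _ _ => Nat.zero_le _)
    (Finset.mem_univ k)
  rw [vectorWeight]
  omega

theorem weight_elementaryE_le (p : ℕ) (k : Fin (p + 1)) :
    (elementaryE p (p + 1) k).weight ≤ vectorWeight p := by
  have := Finset.single_le_sum (f := fun k => (elementaryE p (p + 1) k).weight)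
    (fun _ _ => Nat.zero_le _) (Finset.mem_univ k)
  rw [vectorWeight]
  omega

theorem wp_vectorsCmd (h : Prepared n D U m) (hτ : m.reg 2 = τ)
    (hτβ : bitLen (τ : ℤ) ≤ β) (hn : bitLen (n : ℤ) ≤ β) (hU : ∀ i k, bitLen (U i k) ≤ β)
    (hb : vectorWeight p * β ≤ b) :
    WP O b (vectorsCmd p) m fun m' => Decoded n D U (n + p + 2) τ m' ∧
      ∀ k, bitLen (testVec U (n + p + 2) τ k) ≤ vectorWeight p * β := by
  have hβ : 1 ≤ β := (one_le_bitLen _).trans hn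
  have hprep : ∀ m', Frame (vectorsCmd p) m m' → Prepared n D U m' ∧ m'.reg 2 = τ := fun m' hf =>
    ⟨h.frame hf (by simp [vectorsCmd, Cmd.WritesReg]) fun k hk => by
      simp [vectorsCmd, Cmd.WritesBank] at hk
      omega, by rw [hf.reg 2 (by simp [vectorsCmd, Cmd.WritesReg]), hτ]⟩
  have hbits : ∀ k, bitLen (testVec U (n + p + 2) τ k) ≤ vectorWeight p * β := fun k => by
    rw [testVec, ← h.val_elementaryE hτ]
    exact ((h.small_elementaryE hτ hτβ hn hU _ k).bitLen_le hβ).trans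
      (Nat.mul_le_mul_right _ (weight_elementaryE_le p k))
  refine WP.block (fun s m' => ∀ k : Fin (p + 1), (k : ℕ) < s →
    m'.bank 3 (k : ℕ) = sampleVec U (n + p + 2) τ k ∧
      m'.bank 4 (k : ℕ) = testVec U (n + p + 2) τ k) (fun k hk => absurd hk (Nat.not_lt_zero _))
    (fun j m₁ hf₁ hI => ?_) fun m₁ hf₁ hI => ⟨⟨(hprep m₁ hf₁).1, fun k => (hI k k.is_lt).1,
      fun k => (hI k k.is_lt).2⟩, hbits⟩
  obtain ⟨hp₁, hτ₁⟩ := hprep m₁ hf₁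
  refine WP.seq (WP.store ?_ ?_)
  · exact ((hp₁.small_sampleE hτ₁ hτβ hn hU j).bitLen_le hβ).trans
      ((Nat.mul_le_mul_right _ (weight_sampleE_le p j)).trans hb)
  rw [hp₁.val_sampleE hτ₁]
  -- the second store reads none of the cells changed by the first one
  have hp₂ : Prepared n D U (m₁.setBank 3 (Function.update (m₁.bank 3)
      ((Arith.lit (j : ℕ)).val m₁) (sampleVec U (n + p + 2) τ j))) :=
    ⟨by simpa using hp₁.size, by simpa using hp₁.den, fun k i => by
      rw [Mem.setBank_bank, if_neg (by omega)]
      exact hp₁.table k i⟩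
  refine WP.store ?_ ?_
  · rw [hp₂.val_elementaryE (by simpa using hτ₁)]
    exact (hbits j).trans hb
  rw [hp₂.val_elementaryE (by simpa using hτ₁)]
  intro k hk
  by_cases hkj : k = j
  · subst hkj
    simp [Arith.val, testVec]
  · have hne : ((k : ℕ) : ℤ) ≠ ((j : ℕ) : ℤ) := fun h => hkj (Fin.ext (by exact_mod_cast h))
    have hlt : (k : ℕ) < j := by
      have : (k : ℕ) ≠ j := fun h => hkj (Fin.ext h)
      omega
    simpa [Arith.val, Function.update_of_ne hne] using hI k hlt

theorem Decoded.val_dotE_sample (h : Decoded n D U N τ m) {e : Arith} {i : ℕ} (he : e.val m = i) :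
    (dotE p 3 e).val m = sampleRes U N τ i := by
  rw [dotE, Arith.val_sum, sampleRes, dotProduct]
  refine Finset.sum_congr rfl fun k _ => ?_
  simp only [Arith.val]
  rw [he, h.table, h.sample]

theorem Decoded.val_dotE_test (h : Decoded n D U N τ m) {e : Arith} {i : ℕ} (he : e.val m = i) :
    (dotE p 4 e).val m = testRes U N τ i := by
  rw [dotE, Arith.val_sum, testRes, dotProduct]
  refine Finset.sum_congr rfl fun k _ => ?_
  simp only [Arith.val]
  rw [he, h.table, h.test]

end

/-! ### Sorting the sampled residuals and testing admissibility -/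

/-- Set the flag if the sample point is finite and the tested vector is in the upper halfspace. -/
def flagCmd : Cmd :=
  .seq (.assign 5 (.lit 1)) (.seq (.ifPos (.get 3 (.lit 0)) .skip (.assign 5 (.lit 0)))
    (.ifPos (.add (.get 4 (.lit 0)) (.lit 1)) .skip (.assign 5 (.lit 0))))

/-- Compare the residuals of the rows in registers `3` and `4`. -/
def pairCmd (p : ℕ) : Cmd :=
  .ifPos (.sub (dotE p 3 (.reg 3)) (dotE p 3 (.reg 4)))
    (.seq (.assign 9 (.add (.reg 9) (.lit 1)))
      (.ifPos (.sub (dotE p 4 (.reg 4)) (dotE p 4 (.reg 3))) (.assign 5 (.lit 0)) .skip))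
    (.ifPos (.sub (dotE p 3 (.reg 4)) (dotE p 3 (.reg 3))) .skip
      (.ifPos (.mul (.sub (.reg 3) (.reg 4)) (.sub (.reg 3) (.reg 4))) (.assign 5 (.lit 0)) .skip))

/-- Compare the residual of the row in register `3` with all others, and write the row into the
permutation, at the place given by the rank. -/
def rowCmd (p : ℕ) : Cmd :=
  .seq (.assign 9 (.lit 0))
    (.seq (.forLoop 4 sizeE (pairCmd p)) (.store 7 (.reg 9) (.reg 3)))

/-- Compare all residuals. -/
def scanCmd (p : ℕ) : Cmd := .forLoop 3 sizeE (rowCmd p)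

section

variable {n p : ℕ} {D : ℤ} {U : ℕ → Fin (p + 1) → ℤ} {O : List ℤ → List ℤ} {b N τ : ℕ}
  {m m' : Mem}

/-- The pair of rows contradicts admissibility. -/
def Conflict (U : ℕ → Fin (p + 1) → ℤ) (N τ i j : ℕ) : Prop :=
  (sampleRes U N τ j < sampleRes U N τ i ∧ testRes U N τ i < testRes U N τ j) ∨
    (sampleRes U N τ i = sampleRes U N τ j ∧ i ≠ j)

theorem admissible_iff : Admissible U n N τ ↔ (0 < sampleVec U N τ 0 ∧ 0 ≤ testVec U N τ 0) ∧
    ∀ i < n, ∀ j < n, ¬ Conflict U N τ i j := by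
  constructor
  · rintro ⟨h1, h2, h3, h4⟩
    refine ⟨⟨h1, h2⟩, fun i hi j hj => ?_⟩
    rintro (⟨h, h'⟩ | ⟨h, h'⟩)
    · exact absurd (h4 ⟨i, hi⟩ ⟨j, hj⟩ h) (not_le.mpr h')
    · exact h' (Fin.mk.inj_iff.mp (h3 ⟨i, hi⟩ ⟨j, hj⟩ h))
  · rintro ⟨⟨h1, h2⟩, h3⟩
    refine ⟨h1, h2, fun i j hij => ?_, fun i j hij => ?_⟩
    · by_contra h
      exact h3 i i.is_lt j j.is_lt (.inr ⟨hij, fun h' => h (Fin.ext h')⟩)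
    · by_contra h
      exact h3 i i.is_lt j j.is_lt (.inl ⟨hij, not_le.mp h⟩)

/-- The number of rows among the first `k` whose sampled residual is smaller than that of row
`i`. -/
def sampleRank (U : ℕ → Fin (p + 1) → ℤ) (N τ k i : ℕ) : ℕ :=
  ((Finset.range k).filter fun j => sampleRes U N τ j < sampleRes U N τ i).card

theorem sampleRank_succ (k i : ℕ) : sampleRank U N τ (k + 1) i =
    sampleRank U N τ k i + if sampleRes U N τ k < sampleRes U N τ i then 1 else 0 := by
  rw [sampleRank, sampleRank, Finset.range_add_one, Finset.filter_insert]
  split_ifs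
  · rw [Finset.card_insert_of_notMem (by simp)]
  · rfl

theorem sampleRank_le (k i : ℕ) : sampleRank U N τ k i ≤ k :=
  (Finset.card_filter_le _ _).trans (Finset.card_range k).le

theorem sampleRank_lt {i j : ℕ} (hi : i < n) (h : sampleRes U N τ i < sampleRes U N τ j) :
    sampleRank U N τ n i < sampleRank U N τ n j := by
  refine Finset.card_lt_card ⟨fun k hk => ?_, fun hsub => ?_⟩
  · rw [Finset.mem_filter] at hk ⊢
    exact ⟨hk.1, hk.2.trans h⟩
  · have := hsub (Finset.mem_filter.mpr ⟨Finset.mem_range.mpr hi, h⟩)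
    exact absurd (Finset.mem_filter.mp this).2 (lt_irrefl _)

theorem wp_flagCmd (h : Decoded n D U N τ m) (hb : 2 ≤ b) :
    WP O b flagCmd m fun m' => 0 < m'.reg 5 ↔ 0 < sampleVec U N τ 0 ∧ 0 ≤ testVec U N τ 0 := by
  have hs := h.sample 0
  have ht := h.test 0
  simp only [Fin.val_zero, Nat.cast_zero] at hs ht
  have h0 : bitLen 0 ≤ b := by rw [bitLen_zero]; omega
  have h1 : bitLen 1 ≤ b := by rw [bitLen_one]; exact hb
  refine WP.seq (WP.assign h1 (WP.seq (WP.ifPos (fun hc => WP.skip ?_)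
    (fun hc => WP.assign h0 ?_)))) <;>
  refine WP.ifPos (fun hc' => WP.skip ?_) (fun hc' => WP.assign h0 ?_) <;>
  · simp only [Arith.val, Mem.setReg_bank, Mem.setReg_reg, hs, ht] at hc hc' ⊢
    simp
    omega

theorem wp_pairCmd (h : Decoded n D U N τ m) {i j : ℕ} (hi : m.reg 3 = i) (hj : m.reg 4 = j)
    (hb : bitLen (m.reg 9 + 1) ≤ b) :
    WP O b (pairCmd p) m fun m' =>
      m'.reg 9 = m.reg 9 + (if sampleRes U N τ j < sampleRes U N τ i then 1 else 0) ∧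
      (0 < m'.reg 5 ↔ 0 < m.reg 5 ∧ ¬ Conflict U N τ i j) := by
  have h0 : bitLen 0 ≤ b := (by rw [bitLen_zero]; exact one_le_bitLen _ : bitLen 0 ≤ _).trans hb
  have hs3 := h.val_dotE_sample (e := .reg 3) hi
  have hs4 := h.val_dotE_sample (e := .reg 4) hj
  refine WP.ifPos (fun hc => WP.seq (WP.assign hb ?_)) (fun hc => ?_) <;>
    simp only [Arith.val, hs3, hs4, sub_pos] at hc
  · have h' : Decoded n D U N τ (m.setReg 9 ((Arith.add (.reg 9) (.lit 1)).val m)) :=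
      ⟨⟨h.size, by simpa using h.den, h.table⟩, h.sample, h.test⟩
    have ht3 := h'.val_dotE_test (e := .reg 3) (i := i) (by simpa [Arith.val] using hi)
    have ht4 := h'.val_dotE_test (e := .reg 4) (i := j) (by simpa [Arith.val] using hj)
    simp only [Arith.val] at ht3 ht4
    refine WP.ifPos (fun hc' => WP.assign h0 ?_) (fun hc' => WP.skip ?_) <;>
      simp only [Arith.val, ht3, ht4, sub_pos] at hc' <;>
      simp [Arith.val, Conflict, hc, hc']
    omega
  · refine WP.ifPos (fun hc' => WP.skip ?_) (fun hc' => ?_) <;>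
      simp only [Arith.val, hs3, hs4, sub_pos] at hc'
    · have : sampleRes U N τ i ≠ sampleRes U N τ j := hc'.ne
      simp [Conflict, hc, this]
    · have he : sampleRes U N τ i = sampleRes U N τ j := by omega
      refine WP.ifPos (fun hd => WP.assign h0 ?_) (fun hd => WP.skip ?_) <;>
        simp only [Arith.val, hi, hj] at hd
      · have : i ≠ j := by
          rintro rfl
          simp at hd
        simp [Arith.val, Conflict, he, this]
      · have : i = j := by
          by_contra hne
          apply hd
          have : (i : ℤ) - j ≠ 0 := by omega
          exact mul_self_pos.mpr this
        simp [Conflict, this]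

theorem writesReg_pairCmd (r : ℕ) : (pairCmd p).WritesReg r ↔ r = 9 ∨ r = 5 := by
  simp only [pairCmd, Cmd.WritesReg]
  tauto

theorem writesBank_pairCmd (k : ℕ) : ¬ (pairCmd p).WritesBank k := by
  simp [pairCmd, Cmd.WritesBank]

theorem writesReg_scanCmd (r : ℕ) :
    (scanCmd p).WritesReg r ↔ r = 3 ∨ r = 4 ∨ r = 5 ∨ r = 9 := by
  simp only [scanCmd, rowCmd, Cmd.writesReg_forLoop, Cmd.WritesReg, writesReg_pairCmd]
  tauto

theorem writesBank_scanCmd (k : ℕ) : (scanCmd p).WritesBank k ↔ k = 7 := by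
  simp [scanCmd, rowCmd, Cmd.WritesBank, writesBank_pairCmd]

theorem wp_rowCmd (h : Decoded n D U N τ m) {i : ℕ} (hi : m.reg 3 = i) (hb : n + 1 < b) :
    WP O b (rowCmd p) m fun m' =>
      (0 < m'.reg 5 ↔ 0 < m.reg 5 ∧ ∀ j < n, ¬ Conflict U N τ i j) ∧
      m'.bank 7 = Function.update (m.bank 7) (sampleRank U N τ n i : ℤ) i := by
  refine WP.seq (WP.assign (by rw [Arith.val, bitLen_zero]; omega) (WP.seq ?_))
  have hdec : ∀ m', Frame (.forLoop 4 sizeE (pairCmd p)) (m.setReg 9 ((Arith.lit 0).val m)) m' →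
      Decoded n D U N τ m' ∧ m'.reg 3 = i := fun m' hf => by
    have h' : Decoded n D U N τ (m.setReg 9 ((Arith.lit 0).val m)) :=
      ⟨⟨h.size, by simpa using h.den, h.table⟩, h.sample, h.test⟩
    exact ⟨h'.frame hf (by simp [writesReg_pairCmd]) (by simp [writesBank_pairCmd]), by
      rw [hf.reg 3 (by simp [writesReg_pairCmd]), Mem.setReg_reg, if_neg (by norm_num), hi]⟩
  refine WP.forLoop n (fun k m' => m'.reg 9 = sampleRank U N τ k i ∧
    (0 < m'.reg 5 ↔ 0 < m.reg 5 ∧ ∀ j < k, ¬ Conflict U N τ i j)) (by omega)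
    (by simp [writesReg_pairCmd]) (fun m' hf => (hdec m' hf).1.val_sizeE) ?_ ?_ ?_
  · simp [Arith.val, sampleRank]
  · intro k hk m₁ hf₁ _ hr₁ hI
    obtain ⟨hd₁, hi₁⟩ := hdec m₁ hf₁
    refine (wp_pairCmd hd₁ hi₁ hr₁ ?_).imp fun m₂ _ _ hP => ?_
    · rw [hI.1]
      have := sampleRank_le (U := U) (N := N) (τ := τ) k i
      exact (bitLen_natCast_le (sampleRank U N τ k i + 1)).trans (by omega)
    · rw [Mem.setReg_reg, Mem.setReg_reg, if_neg (by norm_num), if_neg (by norm_num), hP.1, hP.2,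
        hI.1, hI.2, sampleRank_succ]
      refine ⟨by push_cast; rfl, ?_⟩
      constructor
      · rintro ⟨⟨h1, h2⟩, h3⟩
        refine ⟨h1, fun j hj => ?_⟩
        rcases Nat.lt_succ_iff_lt_or_eq.mp hj with h | rfl
        · exact h2 j h
        · exact h3
      · rintro ⟨h1, h2⟩
        exact ⟨⟨h1, fun j hj => h2 j (by omega)⟩, h2 k (by omega)⟩
  · intro m₁ hf₁ _ hI
    obtain ⟨_, hi₁⟩ := hdec m₁ hf₁
    refine WP.of_bounded fun hbd => WP.store (hbd.reg 3) ?_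
    refine ⟨hI.2, ?_⟩
    simp only [Arith.val, Mem.setBank_bank, if_true, hI.1, hi₁]
    rw [hf₁.bank 7 (by simp [writesBank_pairCmd]), Mem.setReg_bank]

theorem wp_scanCmd (h : Decoded n D U N τ m) (hb : n + 1 < b)
    (hflag : 0 < m.reg 5 ↔ 0 < sampleVec U N τ 0 ∧ 0 ≤ testVec U N τ 0) :
    WP O b (scanCmd p) m fun m' => (0 < m'.reg 5 ↔ Admissible U n N τ) ∧
      (Admissible U n N τ → ∀ i < n, m'.bank 7 (sampleRank U N τ n i) = i) := by
  have hdec : ∀ m', Frame (scanCmd p) m m' → Decoded n D U N τ m' := fun m' hf =>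
    h.frame hf (by simp [writesReg_scanCmd]) (by simp [writesBank_scanCmd])
  refine WP.forLoop n (fun k m' => (0 < m'.reg 5 ↔ 0 < m.reg 5 ∧ ∀ i < k, ∀ j < n,
      ¬ Conflict U N τ i j) ∧
    (Admissible U n N τ → ∀ i < k, m'.bank 7 (sampleRank U N τ n i) = i)) (by omega)
    ?_ (fun m' hf => (hdec m' hf).val_sizeE) ?_ ?_ ?_
  · simp [rowCmd, Cmd.WritesReg, writesReg_pairCmd]
  · simp
  · intro k hk m₁ hf₁ _ hr₁ hI
    refine (wp_rowCmd (hdec m₁ hf₁) hr₁ hb).imp fun m₂ _ _ hP => ?_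
    rw [Mem.setReg_reg, if_neg (by norm_num), Mem.setReg_bank, hP.1, hP.2, hI.1]
    constructor
    · constructor
      · rintro ⟨⟨h1, h2⟩, h3⟩
        refine ⟨h1, fun j hj => ?_⟩
        rcases Nat.lt_succ_iff_lt_or_eq.mp hj with h | rfl
        · exact h2 j h
        · exact h3
      · rintro ⟨h1, h2⟩
        exact ⟨⟨h1, fun j hj => h2 j (by omega)⟩, h2 k (by omega)⟩
    · intro hadm i hi
      rw [Function.update_apply]
      rcases Nat.lt_succ_iff_lt_or_eq.mp hi with hik | rfl
      · -- distinct residuals have distinct ranks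
        have hne : sampleRank U N τ n i ≠ sampleRank U N τ n k := by
          have : sampleRes U N τ i ≠ sampleRes U N τ k := fun he => by
            have := Fin.mk.inj_iff.mp (hadm.injective ⟨i, hik.trans hk⟩ ⟨k, hk⟩ he)
            omega
          rcases this.lt_or_gt with h | h
          · exact (sampleRank_lt (hik.trans hk) h).ne
          · exact (sampleRank_lt hk h).ne'
        rw [if_neg (by exact_mod_cast hne)]
        exact hI.2 hadm i hik
      · rw [if_pos rfl]
  · intro m₁ _ _ hI
    refine ⟨?_, hI.2⟩
    rw [hI.1, hflag, admissible_iff]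

/-- The ranks of the sampled residuals invert the permutation that sorts them, so bank `7` holds
this permutation. -/
theorem readWord_eq_permWord {X : Matrix (Fin n) (Fin p) ℚ} {y : Fin n → ℚ}
    (hU : IsRowTable U X y D) (hadm : Admissible U n N τ) {π : Equiv.Perm (Fin n)}
    (hπ : StrictlyOrders X y π (affinePoint (sampleVec U N τ)))
    (hm : ∀ i < n, m.bank 7 (sampleRank U N τ n i) = i) :
    readWord (m.bank 7) n = permWord π := by
  have hrank : ∀ k : Fin n, sampleRank U N τ n (π k) = k := by
    intro k
    have hlt : ∀ l, sampleRes U N τ (π l) < sampleRes U N τ (π k) ↔ l < k := fun l =>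
      (hU.dot_lt_iff hadm.sample_pos _ _).trans hπ.lt_iff_lt
    rw [sampleRank]
    have himg : (Finset.range n).filter
        (fun j => sampleRes U N τ j < sampleRes U N τ (π k)) =
        (Finset.univ.filter fun l : Fin n => l < k).image fun l => ((π l : Fin n) : ℕ) := by
      ext j
      simp only [Finset.mem_filter, Finset.mem_range, Finset.mem_image, Finset.mem_univ, true_and]
      constructor
      · rintro ⟨hj, hjk⟩
        refine ⟨π.symm ⟨j, hj⟩, ?_, by simp⟩
        rw [← hlt]
        simpa using hjk
      · rintro ⟨l, hl, rfl⟩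
        exact ⟨Fin.is_lt _, (hlt l).mpr hl⟩
    rw [himg, Finset.card_image_of_injective _ fun a c hac => π.injective (Fin.ext hac),
      Finset.filter_gt_eq_Iio, Fin.card_Iio]
  refine List.ext_getElem (by rw [length_readWord, permWord, List.length_ofFn]) fun k h1 h2 => ?_
  have hk : k < n := by rwa [length_readWord] at h1
  have := hm (π ⟨k, hk⟩) (Fin.is_lt _)
  rw [hrank] at this
  rw [getElem_readWord, this]
  simp only [permWord, List.getElem_ofFn]

end

end RankRegression

/-! ### Evaluating the function at a candidate -/

namespace RankRegression

open OracleRAM Matrix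

/-- Add the contribution of the row in register `3` to the fraction in the registers `6`, `7`. -/
def termCmd (p : ℕ) : Cmd :=
  .seq (.assign 6 (.add (.mul (.reg 6) (.get 8 (.add (.mul (.lit 2) (.reg 3)) (.lit 1))))
      (.mul (.mul (.get 8 (.mul (.lit 2) (.reg 3))) (dotE p 4 (.reg 3))) (.reg 7))))
    (.assign 7 (.mul (.reg 7) (.get 8 (.add (.mul (.lit 2) (.reg 3)) (.lit 1)))))

/-- Ask for the coefficients of the sampled cell and evaluate its linear function at the tested
vector, as a fraction in the registers `6`, `7`. -/
def evalCmd (p : ℕ) : Cmd :=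
  .seq (.query 7 sizeE 8) (.seq (.assign 6 (.lit 0)) (.seq (.assign 7 (.lit 1))
    (.forLoop 3 sizeE (termCmd p))))

section

variable {n p : ℕ} {D : ℤ} {U : ℕ → Fin (p + 1) → ℤ} {O : List ℤ → List ℤ} {b N τ : ℕ}
  {m m' : Mem}

theorem writeWord_ratWord (f : ℤ → ℤ) (c : Fin n → ℚ) {i : ℕ} (hi : i < n) :
    writeWord f (ratWord c) (2 * i) = (c ⟨i, hi⟩).num ∧
      writeWord f (ratWord c) (2 * i + 1) = (c ⟨i, hi⟩).den := by
  have hlen : (ratWord c).length = 2 * n := by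
    rw [ratWord, fractionWord, List.length_flatten, List.map_ofFn]
    simp [Function.comp_def, mul_comm]
  have hget : ∀ r < 2, (ratWord c).getD (i * 2 + r) 0 =
      [(c ⟨i, hi⟩).num, ((c ⟨i, hi⟩).den : ℤ)].getD r 0 := fun r hr =>
    getD_flatten_ofFn (w := 2) (fun i => [(c i).num, ((c i).den : ℤ)]) (fun _ => rfl) 0 ⟨i, hi⟩ hr
  constructor
  · have := hget 0 two_pos
    rw [add_zero] at this
    rw [writeWord, if_pos (by omega), show (2 * (i : ℤ)).toNat = i * 2 by omega, this]
    rfl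
  · have := hget 1 one_lt_two
    rw [writeWord, if_pos (by omega), show (2 * (i : ℤ) + 1).toNat = i * 2 + 1 by omega, this]
    rfl

theorem wordLen_permWord_le (π : Equiv.Perm (Fin n)) : wordLen (permWord π) ≤ n * (n + 1) := by
  rw [wordLen, permWord, List.map_ofFn, List.sum_ofFn]
  refine (Finset.sum_le_card_nsmul _ _ (n + 1) fun k _ => ?_).trans (by simp)
  exact (bitLen_natCast_le _).trans (by have := (π k).is_lt; omega)

theorem wordLen_ratWord_le (c : Fin n → ℚ) : wordLen (ratWord c) ≤ 2 * vecBits c := by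
  rw [wordLen, ratWord, fractionWord, List.map_flatten, List.sum_flatten, List.map_ofFn,
    List.map_ofFn, List.sum_ofFn, vecBits, Finset.mul_sum]
  refine Finset.sum_le_sum fun i _ => ?_
  have := bitLen_num_le (c i)
  have := bitLen_den_le (c i)
  simp
  omega

theorem bitLen_sum_le {k : ℕ} (f : Fin k → ℤ) : bitLen (∑ j, f j) ≤ ∑ j, bitLen (f j) + 1 := by
  induction k with
  | zero => simp [bitLen_zero]
  | succ k ih =>
    rw [Fin.sum_univ_succ, Fin.sum_univ_succ]
    have := bitLen_add_le (f 0) (∑ j : Fin k, f j.succ)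
    have := ih fun j => f j.succ
    omega

theorem bitLen_testRes_le {β : ℕ} (hU : ∀ i k, bitLen (U i k) ≤ β)
    (hz : ∀ k, bitLen (testVec U N τ k) ≤ β) (i : ℕ) :
    bitLen (testRes U N τ i) ≤ (p + 1) * (2 * β) + 1 := by
  rw [testRes, dotProduct]
  refine (bitLen_sum_le _).trans (Nat.add_le_add_right ?_ 1)
  refine (Finset.sum_le_card_nsmul _ _ (2 * β) fun k _ => ?_).trans (by simp)
  have := bitLen_mul_le (U i k) (testVec U N τ k)
  have := hU i k
  have := hz k
  omega

theorem wp_evalCmd (h : Decoded n D U N τ m) {π : Equiv.Perm (Fin n)}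
    (hw : readWord (m.bank 7) n = permWord π) {c : Fin n → ℚ} (hO : O (permWord π) = ratWord c)
    {B β : ℕ} (hB : vecBits c ≤ B) (hZ : ∀ i < n, bitLen (testRes U N τ i) ≤ β)
    (hb : n * (n + 1) + 2 * B ≤ b) (hb' : n * (B + β + 1) + 2 ≤ b) :
    WP O b (evalCmd p) m fun m' => 0 < m'.reg 7 ∧
      (m'.reg 6 : ℝ) = m'.reg 7 * ∑ i : Fin n, (c i : ℝ) * testRes U N τ i ∧
      bitLen (m'.reg 7) ≤ n * (B + β + 1) + 2 := by
  have hnb : n < b := lt_of_lt_of_le (by nlinarith) hb'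
  refine WP.seq (WP.query (w := permWord π) (by rw [h.val_sizeE, Int.toNat_natCast, hw]) ?_ ?_)
  · rw [hO]
    have := wordLen_permWord_le π
    have := wordLen_ratWord_le c
    omega
  rw [hO]
  refine WP.seq (WP.assign (by rw [Arith.val, bitLen_zero]; omega)
    (WP.seq (WP.assign (by rw [Arith.val, bitLen_one]; omega) ?_)))
  simp only [Arith.val]
  set m₀ := ((m.setBank 8 (writeWord (m.bank 8) (ratWord c))).setReg 6 0).setReg 7 1 with hm₀
  have h₀ : Decoded n D U N τ m₀ :=
    ⟨⟨by simpa [hm₀] using h.size, by simpa [hm₀] using h.den, fun k i => by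
      simp only [hm₀, Mem.setReg_bank, Mem.setBank_bank]
      by_cases hk : 10 + (k : ℕ) = 8
      · omega
      · rw [if_neg hk, h.table]⟩, by simpa [hm₀] using h.sample, by simpa [hm₀] using h.test⟩
  have hdec : ∀ m', Frame (.forLoop 3 sizeE (termCmd p)) m₀ m' → Decoded n D U N τ m' ∧
      m'.bank 8 = writeWord (m.bank 8) (ratWord c) := fun m' hf =>
    ⟨h₀.frame hf (by simp [termCmd, Cmd.WritesReg]) (by simp [termCmd, Cmd.WritesBank]), by
      rw [hf.bank 8 (by simp [termCmd, Cmd.WritesBank])]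
      simp [hm₀]⟩
  -- each term adds `B + β + 1` bits
  refine WP.forLoop n (fun k m' => 0 < m'.reg 7 ∧
    (m'.reg 6 : ℝ) = m'.reg 7 * ∑ i ∈ Finset.range k,
      ((if hi : i < n then c ⟨i, hi⟩ else 0 : ℚ) : ℝ) * testRes U N τ i ∧
    bitLen (m'.reg 6) ≤ k * (B + β + 1) + 2 ∧ bitLen (m'.reg 7) ≤ k * (B + β + 1) + 2) hnb
    (by simp [termCmd, Cmd.WritesReg]) (fun m' hf => (hdec m' hf).1.val_sizeE) ?_ ?_ ?_
  · simp [hm₀, bitLen_zero, bitLen_one]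
  · intro k hk m₁ hf₁ _ hr₁ ⟨hpos, hsum, hbit6, hbit7⟩
    obtain ⟨hd₁, hbank⟩ := hdec m₁ hf₁
    obtain ⟨hnum, hden⟩ := writeWord_ratWord (m.bank 8) c hk
    have hdot := hd₁.val_dotE_test (e := .reg 3) hr₁
    have hrat : ratBits (c ⟨k, hk⟩) ≤ B := (Finset.single_le_sum (f := fun i => ratBits (c i))
      (fun _ _ => Nat.zero_le _) (Finset.mem_univ _)).trans hB
    have hnumB := (bitLen_num_le (c ⟨k, hk⟩)).trans hrat
    have hdenB := (bitLen_den_le (c ⟨k, hk⟩)).trans hrat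
    have hZk := hZ k hk
    have hmul : (k + 1) * (B + β + 1) ≤ n * (B + β + 1) := Nat.mul_le_mul_right _ hk
    have hexp : (k + 1) * (B + β + 1) = k * (B + β + 1) + (B + β + 1) := by ring
    set r := c ⟨k, hk⟩ with hr
    set z := testRes U N τ k with hz
    have h6 : bitLen (m₁.reg 6 * r.den + r.num * z * m₁.reg 7) ≤ (k + 1) * (B + β + 1) + 2 := by
      have h1 := bitLen_mul_le (m₁.reg 6) r.den
      have h2 := bitLen_mul_le (r.num * z) (m₁.reg 7)
      have h3 := bitLen_mul_le r.num z
      have h4 := bitLen_add_le_max (m₁.reg 6 * r.den) (r.num * z * m₁.reg 7)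
      omega
    have h7 : bitLen (m₁.reg 7 * r.den) ≤ (k + 1) * (B + β + 1) + 2 := by
      have h1 := bitLen_mul_le (m₁.reg 7) r.den
      omega
    have hv6 : (Arith.add (.mul (.reg 6) (.get 8 (.add (.mul (.lit 2) (.reg 3)) (.lit 1))))
        (.mul (.mul (.get 8 (.mul (.lit 2) (.reg 3))) (dotE p 4 (.reg 3))) (.reg 7))).val m₁ =
        m₁.reg 6 * r.den + r.num * z * m₁.reg 7 := by
      simp only [Arith.val] at hdot ⊢
      rw [hdot, hr₁, hbank, hnum, hden]
    refine WP.seq (WP.assign ?_ (WP.assign ?_ ?_))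
    · rw [hv6]
      omega
    · simp only [Arith.val, Mem.setReg_reg, Mem.setReg_bank, hr₁, hbank]
      norm_num
      rw [hden]
      omega
    · rw [hv6]
      simp only [Arith.val, Mem.setReg_reg, Mem.setReg_bank, hbank]
      norm_num
      rw [hr₁, hden]
      refine ⟨mul_pos hpos (by exact_mod_cast r.pos), ?_, h6, h7⟩
      rw [Finset.sum_range_succ, dif_pos hk, ← hr, ← hz]
      have hrr : (r : ℝ) = r.num / r.den := by exact_mod_cast (Rat.num_div_den r).symm
      have hden0 : (r.den : ℝ) ≠ 0 := by exact_mod_cast r.pos.ne'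
      push_cast at hsum ⊢
      rw [hsum, hrr]
      field_simp
  · intro m₁ _ _ ⟨hpos, hsum, _, hbit7⟩
    refine ⟨hpos, ?_, hbit7⟩
    rw [hsum, Finset.sum_range]
    simp

end

/-! ### The search for the minimum -/

/-- Record a decreasing ray, or a vertex that improves on the best one. -/
def updateCmd (p : ℕ) : Cmd :=
  .ifPos (.get 4 (.lit 0))
    (.ifPos (.sub
        (.mul (.get 1 (.lit (1 + 2 * p : ℕ))) (.mul (.reg 7) (.mul (.reg 1) (.get 4 (.lit 0)))))
        (.mul (.reg 6) (.get 1 (.lit (2 + 2 * p : ℕ)))))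
      (.seq
        (.block fun j : Fin p => .seq
          (.store 1 (.lit (1 + 2 * j : ℕ)) (.get 4 (.lit (j + 1 : ℕ))))
          (.store 1 (.lit (2 + 2 * j : ℕ)) (.get 4 (.lit 0))))
        (.seq (.store 1 (.lit (1 + 2 * p : ℕ)) (.reg 6))
          (.store 1 (.lit (2 + 2 * p : ℕ)) (.mul (.reg 7) (.mul (.reg 1) (.get 4 (.lit 0)))))))
      .skip)
    (.ifPos (.sub (.lit 0) (.reg 6)) (.assign 8 (.lit 1)) .skip)

/-- Process the code in the main counter. -/
def candidateCmd (p : ℕ) : Cmd :=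
  .seq (vectorsCmd p) (.seq flagCmd (.seq (scanCmd p)
    (.ifPos (.reg 5) (.seq (evalCmd p) (updateCmd p)) .skip)))

/-- Process all codes. Initially, the best value is the fraction `1 / 0`, which exceeds every
proper fraction in the comparison by cross multiplication. -/
def searchCmd (p : ℕ) : Cmd :=
  .seq (.store 1 (.lit (1 + 2 * p : ℕ)) (.lit 1))
    (.forLoop 2 ((rowCountE p).pow (2 * ((p + 2) * (p + 1)))) (candidateCmd p))

/-- Complete the output. -/
def finishCmd (p : ℕ) : Cmd :=
  .ifPos (.reg 8) (.seq (.store 1 (.lit 0) (.lit 0)) (.assign 0 (.lit 1)))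
    (.seq (.store 1 (.lit 0) (.lit 1)) (.assign 0 (.lit (3 + 2 * p : ℕ))))

/-- The algorithm for `p` predictors. -/
def minimizeCmd (p : ℕ) : Cmd := .seq (prepareCmd p) (.seq (searchCmd p) (finishCmd p))

/-- What is known after the first `k` codes: register `8` tells whether a decreasing ray was met,
and bank `1` holds the best admissible vertex and its value. -/
structure Record {n p : ℕ} (F : (Fin p → ℝ) → ℝ) (a : (Fin p → ℝ) → Fin n → ℝ) (D : ℤ)
    (U : ℕ → Fin (p + 1) → ℤ) (N k : ℕ) (m : Mem) : Prop where
  unbounded : 0 < m.reg 8 → ¬ BddBelow (Set.range F)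
  ray : ¬ 0 < m.reg 8 → ∀ τ < k, Admissible U n N τ → testVec U N τ 0 = 0 → 0 ≤ testValue U a N τ
  den_nonneg : 0 ≤ m.bank 1 (2 + 2 * p : ℕ)
  num_of_den : m.bank 1 (2 + 2 * p : ℕ) = 0 → m.bank 1 (1 + 2 * p : ℕ) = 1
  value : 0 < m.bank 1 (2 + 2 * p : ℕ) → ∃ z : Fin (p + 1) → ℤ, 0 < z 0 ∧
    (∀ j : Fin p, m.bank 1 (1 + 2 * j : ℕ) = z j.succ ∧ m.bank 1 (2 + 2 * j : ℕ) = z 0) ∧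
    F (affinePoint z) ≤ (m.bank 1 (1 + 2 * p : ℕ) : ℝ) / m.bank 1 (2 + 2 * p : ℕ)
  vertex : ∀ τ < k, Admissible U n N τ → 0 < testVec U N τ 0 →
    0 < m.bank 1 (2 + 2 * p : ℕ) ∧ (m.bank 1 (1 + 2 * p : ℕ) : ℝ) / m.bank 1 (2 + 2 * p : ℕ) ≤
      testValue U a N τ / (D * testVec U N τ 0)

section

variable {n p : ℕ} {X : Matrix (Fin n) (Fin p) ℚ} {y : Fin n → ℚ} {D : ℤ}
  {U : ℕ → Fin (p + 1) → ℤ} {a : (Fin p → ℝ) → Fin n → ℝ} {O : List ℤ → List ℤ} {b N τ : ℕ}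
  {m m' : Mem} {F : (Fin p → ℝ) → ℝ}

theorem Record.congr {k : ℕ} (h : Record F a D U N k m) (hr : m'.reg 8 = m.reg 8)
    (hb : m'.bank 1 = m.bank 1) : Record F a D U N k m' := by
  obtain ⟨h1, h2, h3, h4, h5, h6⟩ := h
  rw [← hr] at h1 h2
  rw [← hb] at h3 h4 h5 h6
  exact ⟨h1, h2, h3, h4, h5, h6⟩

theorem Record.succ {k : ℕ} (h : Record F a D U N k m)
    (hray : ¬ 0 < m.reg 8 → Admissible U n N k → testVec U N k 0 = 0 → 0 ≤ testValue U a N k)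
    (hvert : Admissible U n N k → 0 < testVec U N k 0 →
      0 < m.bank 1 (2 + 2 * p : ℕ) ∧ (m.bank 1 (1 + 2 * p : ℕ) : ℝ) / m.bank 1 (2 + 2 * p : ℕ) ≤
        testValue U a N k / (D * testVec U N k 0)) : Record F a D U N (k + 1) m where
  unbounded := h.unbounded
  ray h8 τ hτ := by
    rcases Nat.lt_succ_iff_lt_or_eq.mp hτ with hlt | rfl
    · exact h.ray h8 τ hlt
    · exact hray h8
  den_nonneg := h.den_nonneg
  num_of_den := h.num_of_den
  value := h.value
  vertex τ hτ := by
    rcases Nat.lt_succ_iff_lt_or_eq.mp hτ with hlt | rfl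
    · exact h.vertex τ hlt
    · exact hvert

theorem wp_updateCmd (hF : IsGEN X y a) (hU : IsRowTable U X y D) (h : Decoded n D U N τ m)
    (hadm : Admissible U n N τ) (hrec : Record (objective X y a) a D U N τ m)
    (hden : 0 < m.reg 7) (hnum : (m.reg 6 : ℝ) = m.reg 7 * testValue U a N τ)
    (hb : bitLen (m.reg 7) + (bitLen D + bitLen (testVec U N τ 0)) ≤ b) :
    WP O b (updateCmd p) m fun m' => Record (objective X y a) a D U N (τ + 1) m' := by
  have ht0 := h.test 0
  simp only [Fin.val_zero, Nat.cast_zero] at ht0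
  have hdenR : (0 : ℝ) < m.reg 7 := by exact_mod_cast hden
  refine WP.ifPos (fun hz => ?_) (fun hz => ?_) <;> simp only [Arith.val, ht0] at hz
  · -- a vertex; its value is the fraction `m.reg 6 / w`
    set w := m.reg 7 * (D * testVec U N τ 0) with hw
    have hDz : 0 < D * testVec U N τ 0 := mul_pos hU.pos hz
    have hwpos : 0 < w := mul_pos hden hDz
    have hwR : (0 : ℝ) < w := by exact_mod_cast hwpos
    have hDzR : (0 : ℝ) < D * testVec U N τ 0 := by exact_mod_cast hDz
    have hval : testValue U a N τ / (D * testVec U N τ 0) = (m.reg 6 : ℝ) / w := by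
      rw [hnum, hw]
      push_cast
      rw [mul_div_mul_left _ _ hdenR.ne']
    refine WP.ifPos (fun hc => ?_) (fun hc => WP.skip ?_) <;>
      simp only [Arith.val, ht0, h.den, ← hw, sub_pos] at hc
    · refine WP.seq (WP.block (fun s m' => ∀ j : Fin p, (j : ℕ) < s →
        m'.bank 1 (1 + 2 * j : ℕ) = testVec U N τ j.succ ∧
          m'.bank 1 (2 + 2 * j : ℕ) = testVec U N τ 0)
        (fun j hj => absurd hj (Nat.not_lt_zero _)) (fun j m₁ hf₁ hI => ?_)
        fun m₁ hf₁ hI => ?_)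
      · have h₁ : Decoded n D U N τ m₁ := h.frame hf₁ (by simp [Cmd.WritesReg])
          (by simp [Cmd.WritesBank])
        have h₁0 := h₁.test 0
        have h₁j := h₁.test j.succ
        simp only [Fin.val_zero, Nat.cast_zero, Fin.val_succ] at h₁0 h₁j
        refine WP.of_bounded fun hbd => WP.seq (WP.store (hbd.bank 4 _)
          (WP.store (hbd.bank 4 _) fun k hk => ?_))
        simp only [Arith.val, Mem.setBank_bank, if_true, if_neg (show ¬ 4 = 1 by norm_num), h₁0,
          h₁j, Function.update_apply, Nat.cast_inj]
        by_cases hkj : k = j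
        · subst hkj
          rw [if_neg (by omega)]
          simp
        · have hne : (k : ℕ) ≠ j := fun h => hkj (Fin.ext h)
          rw [if_neg (by omega), if_neg (by omega), if_neg (by omega), if_neg (by omega)]
          exact hI k (by omega)
      · have h₁ : Decoded n D U N τ m₁ := h.frame hf₁ (by simp [Cmd.WritesReg])
          (by simp [Cmd.WritesBank])
        have h₁0 := h₁.test 0
        simp only [Fin.val_zero, Nat.cast_zero] at h₁0
        have hr : ∀ r, m₁.reg r = m.reg r := fun r => hf₁.reg r (by simp [Cmd.WritesReg])
        refine WP.of_bounded fun hbd => WP.seq (WP.store (hbd.reg 6) (WP.store ?_ ?_))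
        · simp only [Arith.val, Mem.setBank_reg, Mem.setBank_bank,
            if_neg (show ¬ 4 = 1 by norm_num), h₁0, h₁.den, hr]
          have := bitLen_mul_le (m.reg 7) (D * testVec U N τ 0)
          have := bitLen_mul_le D (testVec U N τ 0)
          omega
        set m₂ := (m₁.setBank 1 (Function.update (m₁.bank 1)
          ((Arith.lit (1 + 2 * p : ℕ)).val m₁) ((Arith.reg 6).val m₁))) with hm₂
        set m₃ := m₂.setBank 1 (Function.update (m₂.bank 1) ((Arith.lit (2 + 2 * p : ℕ)).val m₂)
          ((Arith.mul (.reg 7) (.mul (.reg 1) (.get 4 (.lit 0)))).val m₂)) with hm₃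
        have hbank1 : ∀ i : ℕ, i ≠ 1 + 2 * p → i ≠ 2 + 2 * p → m₃.bank 1 i = m₁.bank 1 i := by
          intro i hi1 hi2
          simp only [hm₃, hm₂, Arith.val, Mem.setBank_bank, if_true, Function.update_apply,
            Nat.cast_inj, if_neg hi1, if_neg hi2]
        have hbn : m₃.bank 1 (1 + 2 * p : ℕ) = m.reg 6 := by
          simp only [hm₃, hm₂, Arith.val, Mem.setBank_bank, if_true, Function.update_apply,
            Nat.cast_inj, hr]
          rw [if_neg (by omega)]
        have hbd' : m₃.bank 1 (2 + 2 * p : ℕ) = w := by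
          simp only [hm₃, hm₂, Arith.val, Mem.setBank_bank, Mem.setBank_reg, if_true,
            Function.update_self, if_neg (show ¬ 4 = 1 by norm_num), h₁0, h₁.den, hr]
          rfl
        have hreg8 : m₃.reg 8 = m.reg 8 := by
          simp only [hm₃, hm₂, Mem.setBank_reg, hr]
        clear_value m₃
        refine Record.succ ⟨?_, ?_, ?_, ?_, ?_, ?_⟩ ?_ ?_
        · rw [hreg8]; exact hrec.unbounded
        · rw [hreg8]; exact hrec.ray
        · rw [hbd']; exact hwpos.le
        · rw [hbd']; exact fun h => absurd h hwpos.ne'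
        · intro _
          refine ⟨testVec U N τ, hz, fun j => ?_, ?_⟩
          · rw [hbank1 _ (by omega) (by omega), hbank1 _ (by omega) (by omega)]
            exact hI j j.is_lt
          · rw [hbn, hbd', ← hval]
            exact hadm.objective_le hF hU hz
        · intro σ hσ hadmσ hzσ
          obtain ⟨hpos, hle⟩ := hrec.vertex σ hσ hadmσ hzσ
          rw [hbn, hbd']
          refine ⟨hwpos, le_trans ?_ hle⟩
          have hposR : (0 : ℝ) < m.bank 1 (2 + 2 * p : ℕ) := by exact_mod_cast hpos
          rw [div_le_div_iff₀ hwR hposR]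
          exact_mod_cast hc.le
        · intro _ _ h0
          exact absurd h0 hz.ne'
        · intro _ _
          rw [hbn, hbd', hval]
          exact ⟨hwpos, le_rfl⟩
    · refine hrec.succ (fun _ _ h0 => absurd h0 hz.ne') fun _ _ => ?_
      rw [not_lt] at hc
      have hpos : 0 < m.bank 1 (2 + 2 * p : ℕ) := by
        refine lt_of_le_of_ne hrec.den_nonneg fun h0 => ?_
        rw [hrec.num_of_den h0.symm, ← h0] at hc
        omega
      have hposR : (0 : ℝ) < m.bank 1 (2 + 2 * p : ℕ) := by exact_mod_cast hpos
      refine ⟨hpos, ?_⟩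
      rw [hval, div_le_div_iff₀ hposR hwR]
      exact_mod_cast hc
  · -- a ray
    have hz0 : testVec U N τ 0 = 0 := le_antisymm (not_lt.mp hz) hadm.test_nonneg
    refine WP.ifPos (fun hc => WP.assign ?_ ?_) (fun hc => WP.skip ?_) <;>
      simp only [Arith.val, zero_sub, neg_pos] at hc
    · have := one_le_bitLen (m.reg 7)
      have := one_le_bitLen D
      rw [Arith.val, bitLen_one]
      omega
    · have hneg : testValue U a N τ < 0 := by
        have : (m.reg 6 : ℝ) < 0 := by exact_mod_cast hc
        rw [hnum] at this
        exact (pos_iff_neg_of_mul_neg this).mp hdenR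
      have h8 : (m.setReg 8 ((Arith.lit 1).val m)).reg 8 = 1 := by simp [Arith.val]
      refine Record.succ ⟨fun _ => hadm.not_bddBelow hF hU hz0 hneg, fun h => ?_, hrec.den_nonneg,
        hrec.num_of_den, hrec.value, hrec.vertex⟩ (fun h => ?_) fun _ h => absurd h hz
      · rw [h8] at h; exact absurd one_pos h
      · rw [h8] at h; exact absurd one_pos h
    · refine hrec.succ (fun _ _ _ => ?_) fun _ h => absurd h hz
      have : (0 : ℝ) ≤ m.reg 6 := by exact_mod_cast not_lt.mp hc
      rw [hnum] at this
      exact nonneg_of_mul_nonneg_right this hdenR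

theorem writesReg_candidateCmd {r : ℕ} (h : (candidateCmd p).WritesReg r) : 3 ≤ r := by
  simp [candidateCmd, vectorsCmd, flagCmd, evalCmd, termCmd, updateCmd, Cmd.WritesReg,
    writesReg_scanCmd] at h
  omega

theorem writesBank_candidateCmd {k : ℕ} (h : (candidateCmd p).WritesBank k) : k ≠ 0 ∧ k < 10 := by
  simp [candidateCmd, vectorsCmd, flagCmd, evalCmd, termCmd, updateCmd, Cmd.WritesBank,
    writesBank_scanCmd] at h
  omega

theorem wp_candidateCmd (hF : IsGEN X y a) (hU : IsRowTable U X y D) {B : ℕ}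
    (hO : IsCoefficientOracle X y a O B) (h : Prepared n D U m) (hτ : m.reg 2 = τ)
    (hrec : Record (objective X y a) a D U (n + p + 2) τ m) {β : ℕ}
    (hτβ : bitLen (τ : ℤ) ≤ β) (hn : bitLen (n : ℤ) ≤ β) (hUβ : ∀ i k, bitLen (U i k) ≤ β)
    (hDβ : bitLen D ≤ β) (hb : n * (n + 1) + 2 * B ≤ b)
    (hb' : n * (B + ((p + 1) * (2 * (vectorWeight p * β)) + 1) + 1) + 2 +
      (β + vectorWeight p * β) ≤ b) :
    WP O b (candidateCmd p) m fun m' =>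
      Record (objective X y a) a D U (n + p + 2) (τ + 1) m' := by
  have hw : 1 ≤ vectorWeight p := Nat.le_add_left _ _
  have hwβ : β ≤ vectorWeight p * β := Nat.le_mul_of_pos_left _ hw
  have hnb : n + 1 < b := by
    have h1 : n * 1 ≤ n * (B + ((p + 1) * (2 * (vectorWeight p * β)) + 1) + 1) :=
      Nat.mul_le_mul_left _ (by omega)
    omega
  refine WP.seq ((wp_vectorsCmd h hτ hτβ hn hUβ (by omega)).imp fun m₁ hf₁ _ ⟨hd₁, hz⟩ => ?_)
  refine WP.seq ((wp_flagCmd hd₁ (by omega)).imp fun m₂ hf₂ _ hflag => ?_)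
  have hd₂ : Decoded n D U (n + p + 2) τ m₂ := hd₁.frame hf₂ (by simp [flagCmd, Cmd.WritesReg])
    (by simp [flagCmd, Cmd.WritesBank])
  refine WP.seq ((wp_scanCmd hd₂ hnb hflag).imp fun m₃ hf₃ _ ⟨hok, hperm⟩ => ?_)
  have hd₃ : Decoded n D U (n + p + 2) τ m₃ := hd₂.frame hf₃ (by simp [writesReg_scanCmd])
    (by simp [writesBank_scanCmd])
  have hrec₃ : Record (objective X y a) a D U (n + p + 2) τ m₃ := by
    refine hrec.congr ?_ ?_
    · rw [hf₃.reg 8 (by simp [writesReg_scanCmd]), hf₂.reg 8 (by simp [flagCmd, Cmd.WritesReg]),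
        hf₁.reg 8 (by simp [vectorsCmd, Cmd.WritesReg])]
    · rw [hf₃.bank 1 (by simp [writesBank_scanCmd]), hf₂.bank 1 (by simp [flagCmd, Cmd.WritesBank]),
        hf₁.bank 1 (by simp [vectorsCmd, Cmd.WritesBank])]
  refine WP.ifPos (fun h5 => ?_) (fun h5 => WP.skip ?_)
  · have hadm : Admissible U n (n + p + 2) τ := hok.mp h5
    obtain ⟨π, hπ⟩ := hadm.exists_strictlyOrders hU
    obtain ⟨c, hac, hOc, hcB⟩ := hO π _ hπ
    have hval : testValue U a (n + p + 2) τ =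
        ∑ i : Fin n, (c i : ℝ) * testRes U (n + p + 2) τ i :=
      Finset.sum_congr rfl fun i _ => by rw [hac]
    refine WP.seq ((wp_evalCmd hd₃ (readWord_eq_permWord hU hadm hπ (hperm hadm)) hOc hcB
      (fun i _ => bitLen_testRes_le (fun i k => (hUβ i k).trans hwβ) hz i) hb (by omega)).imp
      fun m₄ hf₄ _ ⟨hden, hnum, hbit⟩ => ?_)
    refine wp_updateCmd hF hU (hd₃.frame hf₄ (by simp [evalCmd, termCmd, Cmd.WritesReg])
      (by simp [evalCmd, termCmd, Cmd.WritesBank])) hadm (hrec₃.congr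
      (hf₄.reg 8 (by simp [evalCmd, termCmd, Cmd.WritesReg]))
      (hf₄.bank 1 (by simp [evalCmd, termCmd, Cmd.WritesBank]))) hden (by rw [hnum, hval]) ?_
    have := hz 0
    omega
  · have hadm : ¬ Admissible U n (n + p + 2) τ := fun h => h5 (hok.mpr h)
    exact hrec₃.succ (fun _ h => absurd h hadm) fun h => absurd h hadm

/-- The word of the answer `1`, `z_1 / z_0`, …, `z_p / z_0`, `s / e`. -/
theorem readWord_answer {f : ℤ → ℤ} {z : Fin (p + 1) → ℤ} (h0 : f 0 = 1)
    (hz : ∀ j : Fin p, f (1 + 2 * j : ℕ) = z j.succ ∧ f (2 + 2 * j : ℕ) = z 0) :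
    readWord f (3 + 2 * p) = 1 :: (fractionWord (fun j : Fin p => z j.succ) (fun _ => z 0) ++
      [f (1 + 2 * p : ℕ), f (2 + 2 * p : ℕ)]) := by
  have hlen : (fractionWord (fun j : Fin p => z j.succ) (fun _ => z 0)).length = 2 * p := by
    rw [fractionWord, List.length_flatten, List.map_ofFn]
    simp [Function.comp_def, mul_comm]
  refine List.ext_getElem ?_ fun k h1 h2 => ?_
  · rw [length_readWord]
    simp [hlen]
    omega
  rw [getElem_readWord, ← List.getD_eq_getElem _ 0 h2]
  rw [length_readWord] at h1
  obtain rfl | ⟨k, rfl⟩ : k = 0 ∨ ∃ l, k = l + 1 := by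
    cases k
    · exact .inl rfl
    · exact .inr ⟨_, rfl⟩
  · simpa using h0
  rw [List.getD_cons_succ]
  rcases lt_or_ge k (2 * p) with hk | hk
  · rw [List.getD_append _ _ _ _ (by omega), fractionWord]
    have hget := fun r (hr : r < 2) => getD_flatten_ofFn (w := 2)
      (fun j : Fin p => [z j.succ, z 0]) (fun _ => rfl) 0 ⟨k / 2, by omega⟩ hr
    obtain ⟨hz1, hz2⟩ := hz ⟨k / 2, by omega⟩
    simp only at hz1 hz2 hget
    rcases Nat.mod_two_eq_zero_or_one k with hpar | hpar
    · rw [show k = k / 2 * 2 + 0 by omega, hget 0 two_pos,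
        show k / 2 * 2 + 0 + 1 = 1 + 2 * (k / 2) by omega, hz1]
      rfl
    · rw [show k = k / 2 * 2 + 1 by omega, hget 1 one_lt_two,
        show k / 2 * 2 + 1 + 1 = 2 + 2 * (k / 2) by omega, hz2]
      rfl
  · rw [List.getD_append_right _ _ _ _ (by omega), hlen]
    obtain rfl | rfl : k = 2 * p ∨ k = 2 * p + 1 := by omega
    · simp [add_comm]
    · rw [show 2 * p + 1 + 1 = 2 + 2 * p by omega, show 2 * p + 1 - 2 * p = 1 by omega]
      rfl

theorem wp_finishCmd (hF : IsGEN X y a) (hU : IsRowTable U X y D) {N : ℕ} (hN : N = n + p + 2)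
    (hrec : Record (objective X y a) a D U N (N ^ (2 * ((p + 2) * (p + 1)))) m)
    (hb : 2 * p + 4 ≤ b) :
    WP O b (finishCmd p) m fun m' => SolvesMin (objective X y a) m'.output := by
  have h0 : bitLen 0 ≤ b := by rw [bitLen_zero]; omega
  have h1 : bitLen 1 ≤ b := by rw [bitLen_one]; omega
  refine WP.ifPos (fun h8 => WP.seq (WP.store h0 (WP.assign h1 (.inl ⟨?_, hrec.unbounded h8⟩))))
    (fun h8 => WP.seq (WP.store h1 (WP.assign ((bitLen_natCast_le _).trans (by omega)) ?_)))
  · refine List.ext_getElem (by rw [Mem.output, length_readWord]; simp [Arith.val])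
      fun k hk hk' => ?_
    obtain rfl : k = 0 := by simpa using hk'
    simp only [Mem.output]
    rw [getElem_readWord]
    simp [Arith.val]
  · have hle := fun v hv => le_objective_of_forall_admissible hF hU hN (hrec.ray h8) (v := v) hv
    -- some vertex is admissible, since otherwise every number would be a lower bound
    have hpos : 0 < m.bank 1 (2 + 2 * p : ℕ) := by
      by_contra hneg
      have := hle (objective X y a 0 + 1)
        (fun τ hτ hadm hz => absurd (hrec.vertex τ hτ hadm hz).1 hneg) 0
      linarith
    obtain ⟨z, hz0, hz, hval⟩ := hrec.value hpos
    have hmin := hle _ fun τ hτ hadm hz => (hrec.vertex τ hτ hadm hz).2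
    refine .inr ⟨fun j => z j.succ, fun _ => z 0, m.bank 1 (1 + 2 * p : ℕ),
      m.bank 1 (2 + 2 * p : ℕ), ?_, fun _ => hz0, hpos, le_antisymm hval (hmin _),
      fun β => hval.trans (hmin β)⟩
    have hbank : ∀ i : ℕ, i ≠ 0 → Function.update (m.bank 1) 0 1 (i : ℕ) = m.bank 1 i := by
      intro i hi
      rw [Function.update_of_ne (by exact_mod_cast hi)]
    have hans := readWord_answer (f := Function.update (m.bank 1) 0 1) (z := z)
      (Function.update_self _ _ _) fun j => by
        rw [hbank _ (by omega), hbank _ (by omega)]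
        exact hz j
    rw [hbank _ (by omega), hbank _ (by omega)] at hans
    rw [← hans, Mem.output]
    simp only [Arith.val, Mem.setReg_reg, Mem.setReg_bank, Mem.setBank_bank, if_true,
      Int.toNat_natCast]

theorem wp_searchCmd (hF : IsGEN X y a) (hU : IsRowTable U X y D) {B : ℕ}
    (hO : IsCoefficientOracle X y a O B) (h : Prepared n D U m) (h8 : m.reg 8 = 0)
    (h1 : ∀ i, m.bank 1 i = 0) {β : ℕ}
    (hβ : (n + p + 2) ^ (2 * ((p + 2) * (p + 1))) ≤ β) (hn : bitLen (n : ℤ) ≤ β)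
    (hUβ : ∀ i k, bitLen (U i k) ≤ β) (hDβ : bitLen D ≤ β) (hb : n * (n + 1) + 2 * B ≤ b)
    (hb' : n * (B + ((p + 1) * (2 * (vectorWeight p * β)) + 1) + 1) + 2 +
      (β + vectorWeight p * β) ≤ b) :
    WP O b (searchCmd p) m fun m' => Record (objective X y a) a D U (n + p + 2)
      ((n + p + 2) ^ (2 * ((p + 2) * (p + 1)))) m' := by
  refine WP.seq (WP.store (by rw [Arith.val, bitLen_one]; omega) ?_)
  set m₀ := m.setBank 1 (Function.update (m.bank 1) ((Arith.lit (1 + 2 * p : ℕ)).val m)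
    ((Arith.lit 1).val m)) with hm₀
  have h₀ : Prepared n D U m₀ := ⟨by simpa [hm₀] using h.size, by simpa [hm₀] using h.den,
    fun k i => by
      rw [hm₀, Mem.setBank_bank, if_neg (by omega), h.table]⟩
  have hnum₀ : m₀.bank 1 (1 + 2 * p : ℕ) = 1 := by
    rw [hm₀, Mem.setBank_bank, if_pos rfl]
    simp [Arith.val]
  have hden₀ : m₀.bank 1 (2 + 2 * p : ℕ) = 0 := by
    rw [hm₀, Mem.setBank_bank, if_pos rfl, Function.update_of_ne, h1]
    rw [Arith.val]
    omega
  have hrec₀ : Record (objective X y a) a D U (n + p + 2) 0 m₀ :=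
    ⟨fun h => by rw [hm₀, Mem.setBank_reg, h8] at h; exact absurd h (lt_irrefl _),
      fun _ _ h => absurd h (Nat.not_lt_zero _), hden₀.ge, fun _ => hnum₀,
      fun h => by rw [hden₀] at h; exact absurd h (lt_irrefl _),
      fun _ h => absurd h (Nat.not_lt_zero _)⟩
  have hprep : ∀ m', Frame (.forLoop 2 ((rowCountE p).pow (2 * ((p + 2) * (p + 1))))
      (candidateCmd p)) m₀ m' → Prepared n D U m' := fun m' hf => by
    refine h₀.frame hf ?_ fun k hk => ?_
    · rw [Cmd.writesReg_forLoop]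
      rintro (h | h)
      · omega
      · have := writesReg_candidateCmd h
        omega
    · rw [Cmd.writesBank_forLoop] at hk
      exact writesBank_candidateCmd hk
  refine WP.forLoop ((n + p + 2) ^ (2 * ((p + 2) * (p + 1))))
    (fun k m' => Record (objective X y a) a D U (n + p + 2) k m') (by omega)
    (fun h => by have := writesReg_candidateCmd h; omega)
    (fun m' hf => by rw [Arith.val_pow, (hprep m' hf).val_rowCountE]; push_cast; rfl)
    (hrec₀.congr (by simp) rfl) (fun k hk m₁ hf₁ _ hr₁ hI => ?_) (fun m₁ _ _ hI => hI)
  refine (wp_candidateCmd hF hU hO (hprep m₁ hf₁) hr₁ hI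
    ((bitLen_natCast_le k).trans (by omega)) hn hUβ hDβ hb hb').imp fun m₂ _ _ hrec₂ => ?_
  exact hrec₂.congr (by simp) rfl

/-- A bound for the bit lengths of all numbers and for the lengths of all loops. -/
def resourceBound (p : ℕ) (q : Polynomial ℕ) (L : ℕ) : ℕ :=
  L * (q.eval L + ((p + 1) * (2 * (vectorWeight p * ((L + p + 2) ^ (2 * ((p + 2) * (p + 1))) +
    2 * L + 2))) + 1) + 1) + 2 + ((L + p + 2) ^ (2 * ((p + 2) * (p + 1))) + 2 * L + 2 +
    vectorWeight p * ((L + p + 2) ^ (2 * ((p + 2) * (p + 1))) + 2 * L + 2)) +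
  L * (L + 1) + 2 * q.eval L + L * (p + 1) + 3 * L + 2 * p + 4

theorem isPolynomial_resourceBound (p : ℕ) (q : Polynomial ℕ) :
    IsPolynomial (resourceBound p q) := by
  have hβ : IsPolynomial fun L => (L + p + 2) ^ (2 * ((p + 2) * (p + 1))) + 2 * L + 2 :=
    (((((IsPolynomial.id.add (.const p)).add (.const 2)).pow _).add ((IsPolynomial.const 2).mul
      .id))).add (.const 2)
  have hv := (IsPolynomial.const (vectorWeight p)).mul hβ
  exact ((((((((IsPolynomial.id.mul ((((IsPolynomial.eval q).add (((IsPolynomial.const (p + 1)).mul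
    ((IsPolynomial.const 2).mul hv)).add (.const 1))).add (.const 1)))).add (.const 2)).add
    (hβ.add hv)).add (IsPolynomial.id.mul (IsPolynomial.id.add (.const 1)))).add
    ((IsPolynomial.const 2).mul (.eval q))).add (IsPolynomial.id.mul (.const (p + 1)))).add
    ((IsPolynomial.const 3).mul .id)).add (.const (2 * p))).add (.const 4)

theorem wp_minimizeCmd (hF : IsGEN X y a) (q : Polynomial ℕ)
    (hO : IsCoefficientOracle X y a O (q.eval (dataBits X y)))
    (hb : resourceBound p q (dataBits X y) ≤ b) :
    WP O b (minimizeCmd p) (Mem.init (inputWord X y)) fun m' =>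
      SolvesMin (objective X y a) m'.output := by
  have hnL := card_le_dataBits X y
  set L := dataBits X y with hL
  have hpow : (n + p + 2) ^ (2 * ((p + 2) * (p + 1))) ≤ (L + p + 2) ^ (2 * ((p + 2) * (p + 1))) :=
    Nat.pow_le_pow_left (by omega) _
  set β := (L + p + 2) ^ (2 * ((p + 2) * (p + 1))) + 2 * L + 2 with hβ
  rw [resourceBound, ← hβ] at hb
  have hm1 : n * (q.eval L + ((p + 1) * (2 * (vectorWeight p * β)) + 1) + 1) ≤
      L * (q.eval L + ((p + 1) * (2 * (vectorWeight p * β)) + 1) + 1) :=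
    Nat.mul_le_mul_right _ hnL
  have hm2 : n * (n + 1) ≤ L * (L + 1) := Nat.mul_le_mul hnL (by omega)
  have hm3 : n * (p + 1) ≤ L * (p + 1) := Nat.mul_le_mul_right _ hnL
  refine WP.seq ((wp_prepareCmd (by omega)).imp fun m₁ hf₁ _ hprep => ?_)
  have h8 : m₁.reg 8 = 0 := by
    rw [hf₁.reg 8 (by simp [prepareCmd, denCmd, dataRowsCmd, unitRowsCmd, Cmd.WritesReg])]
    rfl
  have h1 : ∀ i, m₁.bank 1 i = 0 := fun i => by
    rw [hf₁.bank 1 (by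
      simp [prepareCmd, denCmd, dataRowsCmd, unitRowsCmd, Cmd.WritesBank]
      constructor <;> intro x <;> omega)]
    rfl
  refine WP.seq ((wp_searchCmd hF (isRowTable X y) hO hprep h8 h1 (β := β) (by omega)
    ((bitLen_natCast_le n).trans (by omega)) (bitLen_rowTable_le X y · · |>.trans (by omega))
    ((bitLen_prod_den_le _).trans (by rw [← dataBits_eq]; omega)) (by omega) (by omega)).imp
    fun m₂ _ _ hrec => ?_)
  exact wp_finishCmd hF (isRowTable X y) rfl hrec (by omega)

end

/-- Branch on the number `p` of predictors, which is at most `p₀`. -/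
def branchCmd : ℕ → Cmd
  | 0 => minimizeCmd 0
  | p₀ + 1 => .ifPos (.sub (.get 0 (.lit 1)) (.lit (p₀ : ℕ))) (minimizeCmd (p₀ + 1)) (branchCmd p₀)

theorem wp_branchCmd {O : List ℤ → List ℤ} {b p : ℕ} {m : Mem} {Q : Mem → Prop}
    (hm : m.bank 0 1 = p) (h : WP O b (minimizeCmd p) m Q) {p₀ : ℕ} (hp : p ≤ p₀) :
    WP O b (branchCmd p₀) m Q := by
  induction p₀ with
  | zero =>
    obtain rfl : p = 0 := by omega
    exact h
  | succ p₀ ih =>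
    refine WP.ifPos (fun hc => ?_) (fun hc => ih ?_) <;> simp only [Arith.val, hm] at hc
    · obtain rfl : p = p₀ + 1 := by omega
      exact h
    · omega

end RankRegression

theorem mainTheorem3 (p₀ : ℕ) :
    ∃ c : OracleRAM.Cmd, ∀ q : Polynomial ℕ, ∃ T : Polynomial ℕ,
      ∀ (n p : ℕ), p ≤ p₀ →
      ∀ (X : Matrix (Fin n) (Fin p) ℚ) (y : Fin n → ℚ) (a : (Fin p → ℝ) → Fin n → ℝ)
        (O : List ℤ → List ℤ),
        RankRegression.IsGEN X y a →
        RankRegression.IsCoefficientOracle X y a O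
          (q.eval (RankRegression.dataBits X y)) →
        ∃ (w : List ℤ) (t : ℕ),
          OracleRAM.Runs O c (RankRegression.inputWord X y) w t ∧
          t ≤ T.eval (RankRegression.dataBits X y) ∧
          RankRegression.SolvesMin (RankRegression.objective X y a) w := by
  refine ⟨RankRegression.branchCmd p₀, fun q => ?_⟩
  choose T hT using fun p => (RankRegression.isPolynomial_resourceBound p q).cap
    (RankRegression.branchCmd p₀)
  -- the time bound for each `p` is a polynomial; add them up
  refine ⟨∑ p ∈ Finset.range (p₀ + 1), T p, fun n p hp X y a O hF hO => ?_⟩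
  obtain ⟨m, t, hex, ht, _, hm⟩ := RankRegression.wp_branchCmd
    (RankRegression.bank_init_zero X y).2 (RankRegression.wp_minimizeCmd hF q hO le_rfl) hp
    (RankRegression.bounded_init X y (by rw [RankRegression.resourceBound]; omega))
  refine ⟨_, t, ⟨m, hex, rfl⟩, ht.trans ?_, hm⟩
  refine (hT p _).ge.trans ?_
  rw [Polynomial.eval_finsetSum]
  exact Finset.single_le_sum (f := fun p => (T p).eval (RankRegression.dataBits X y))
    (fun _ _ => Nat.zero_le _) (Finset.mem_range.mpr (by omega))
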